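/- **Setting.** Let $\mathcal X\subseteq\mathbb R^D$, $\mathcal Y=\{-1,+1\}$, let $\mathcal D$ be a probability distribution on $\mathcal X\times\mathcal Y$ with marginal $\mathcal D_{\mathcal X}$, let $\ell:\mathcal Z\times\mathcal Y\to[0,1]$ ($\mathcal Z\subseteq\mathbb R$) be a loss that is Lipschitz in its first argument, and let $\mathcal H$ be a finite nonempty set of measurable functions $\mathcal X\to\mathcal Z$. For a region $S\subseteq\mathcal X$ write $\Pr(S)=\mathcal D_{\mathcal X}(S)$, let $\mathcal D_S$ be the distribution of $(x,y)\sim\mathcal D$ given $x\in S$, and put $R(f)=\mathbb E_{\mathcal D}[\ell(f(x),y)]$, $R_S(f)=\mathbb E_{\mathcal D_S}[\ell(f(x),y)]$. Let $h_S^*\in\operatorname{argmin}_{h\in\mathcal H}R_S(h)$, $h^*=h^*_{\mathcal X}$, $R^*=R(h^*)$. For a distribution $\nu$ on $\mathcal X\times\mathcal Y$ let $\rho_\nu(f,g)=\mathbb E_\nu|\ell(f(x),y)-\ell(g(x),y)|$, and let the disagreement coefficient $\theta(\nu,h_0)\in[0,\infty]$ be the least $\theta$ with $\mathbb E_{x}\big[\sup_{h\in\mathcal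 H,\ \rho_\nu(h,h_0)\le r,\ y\in\mathcal Y}|\ell(h(x),y)-\ell(h_0(x),y)|\big]\le\theta r$ for all $r>0$, where $x$ is drawn from the $\mathcal X$-marginal of $\nu$. Let $\theta=\theta(\mathcal D,h^*)$ and $r_0=\max_{h\in\mathcal H}\rho_{\mathcal D}(h,h^*)$. **Algorithm (ARBAL, adaptive threshold).** Let $1\le\tau\le T$ and $\kappa\ge1$ be integers, $\delta>0$, $\rho>0$, $0<c<\tfrac12$, and $\sigma_T=\kappa D\log\frac{8T^3|\mathcal H|^3\kappa D}{\delta}$. Start with $K=1$, $\mathcal X_1=\mathcal X$, $\mathcal H_1=\mathcal H$. In round $t=1,\dots,T$ a fresh pair $(x_t,y_t)\sim\mathcal D$ is drawn independently of the past and $x_t$ is observed; let $\mathcal X_{k}$, $k=k_t$, be the current region containing $x_t$. The label $y_t$ is requested iff $Q_t=1$, where $Q_t$ is an independent coin flip with bias $p_t=\max_{h,h'\in\mathcal H_k,\,y\in\mathcal Y}\big(\ell(h(x_t),y)-\ell(h'(x_t),y)\big)$. For a region $S$ let $T_{S,t}=|\{s\le t:x_s\in S\}|$, $L_{S,t}(f)=\frac1{T_{S,t}}\sum_{s\le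 t,\,x_s\in S}\frac{Q_s}{p_s}\ell(f(x_s),y_s)$ (terms with $p_s=0$ are $0$, and $L_{S,t}=0$ if $T_{S,t}=0$), and $\hat h_{S,t}\in\operatorname{argmin}_{h\in\mathcal H}L_{S,t}(h)$. * If $t\le\tau$ and $K<\kappa$ (split phase): for a coordinate $d$ and a threshold $a\in\mathbb R$ let $\mathcal X_l=\{x\in\mathcal X_k:x_d\le a\}$, $\mathcal X_r=\{x\in\mathcal X_k:x_d>a\}$, and $\gamma_{d,a}=\Pr(\mathcal X_k)\big[L_{\mathcal X_k,t}(\hat h_{\mathcal X_k,t})-L_{\mathcal X_k,t}(1_{\mathcal X_l}\hat h_{\mathcal X_l,t}+1_{\mathcal X_r}\hat h_{\mathcal X_r,t})-\sqrt{2\sigma_T/T_{\mathcal X_k,t}}\big]$. Choose $(d,a)$ maximizing $\gamma_{d,a}$ (ties are broken by a measurable function of the past up to and including round $t$). If the maximum is at least $\gamma_t=\Pr(\mathcal X_k)\rho/2$, replace $\mathcal X_k$ by $\mathcal X_l,\mathcal X_r$, each with hypothesis set $\mathcal H$, and increase $K$ by one; otherwise change nothing. * Otherwise replace $\mathcal H_k$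 by $\{h\in\mathcal H_k:L_{\mathcal X_k,t}(h)\le\min_{g\in\mathcal H_k}L_{\mathcal X_k,t}(g)+\sqrt{8\sigma_T/T_{\mathcal X_k,t}}\}$. After round $T$ return $\hat h_T=\sum_{k=1}^K1_{x\in\mathcal X_k}\hat h_{k,T}$ with $\hat h_{k,T}\in\operatorname{argmin}_{h\in\mathcal H_k}L_{\mathcal X_k,T}(h)$. Let $\tau_T=\sum_{t=1}^T\mathbb E_{x_t\sim\mathcal D_{\mathcal X}}[p_t\mid\mathcal F_{t-1}]$ be the expected number of requested labels, $\mathcal F_{t-1}$ being the first $t-1$ rounds, and, for the final regions, $\theta_{\max}=\max_{k\le K}\theta(\mathcal D_{\mathcal X_k},h^*_{\mathcal X_k})$. **Theorem.** Suppose that $\log_{1/c}\!\Big[\frac{\tau}{2\sigma_T(4/\rho+1)^2}\Big]\le\kappa-1$, and put $$R_U=R^*-\frac{\rho c}{2(1-c)}\Big(1-\frac{2\sigma_T(4/\rho+1)^2}{\tau}\Big).$$ Consider the following property of a run: every intermediate region $S$ (that is, $S=\mathcal X$, and every region present at the beginning of a round of the split phase) admits an axis-aligned split into $S_l=\{x\in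 S:x_d\le a\}$ and $S_r=\{x\in S:x_d>a\}$ with $R_S(h_S^*)-R_S(1_{S_l}h_{S_l}^*+1_{S_r}h_{S_r}^*)\ge\rho$ and $\min\{\Pr(S_l),\Pr(S_r)\}\ge c\Pr(S)$. Then with probability at least $1-\tfrac{3\delta}2$ over the run: if the run has this property, then $$R(\hat h_T)\le R_U+2\sqrt{\frac{8K\sigma_T}{T}}+\frac{16K\sigma_T}{T}$$ and $$\tau_T\le\min\{2\theta r_0,1\}\,\tau+4\theta_{\max}(T-\tau)\Big[R_U+8\sqrt{\frac{K\sigma_T}{T-\tau}}\Big]+\sqrt{32}\,K\sigma_T .$$ (In particular the two bounds hold with probability at least $1-\tfrac{3\delta}2$ if almost every run has the property. For $\tau=T$ the middle term of the last bound is read as $0$.) -/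

import Mathlib

open MeasureTheory ProbabilityTheory
open scoped ENNReal NNReal

noncomputable section

namespace ARBAL

/-- The data of a learning problem on an input space `𝒳 ⊆ ℝ^D` with labels `{-1, +1} = ℤˣ`:
a distribution of labelled examples, a loss `ℓ(prediction, label)` and a finite set `H` of
hypotheses. -/
structure Problem {D : ℕ} (𝒳 : Set (Fin D → ℝ)) where
  dist : Measure (𝒳 × ℤˣ)
  loss : ℝ → ℤˣ → ℝ
  H : Finset (𝒳 → ℝ)

/-- The parameters of a run: the number `T` of rounds, the cap `τ` on the number of rounds of the
split phase, the maximal number `κ` of regions, the confidence parameter `δ`, and the splitting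
threshold `γ`, as a function of the region that contains the current point. -/
structure Params {D : ℕ} (𝒳 : Set (Fin D → ℝ)) where
  T : ℕ
  τ : ℕ
  κ : ℕ
  δ : ℝ
  γ : Set 𝒳 → ℝ

section Learning

variable {D : ℕ} {𝒳 : Set (Fin D → ℝ)} (M : Problem 𝒳)

/-- The marginal distribution on the input space. -/
def Problem.marginal : Measure 𝒳 := M.dist.map Prod.fst

/-- The probability of a region. -/
def Problem.mass (S : Set 𝒳) : ℝ := M.marginal.real S

/-- The distribution of `(x, y)` conditioned on `x ∈ S`. -/
def Problem.distOn (S : Set 𝒳) : Measure (𝒳 × ℤˣ) :=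
  ProbabilityTheory.cond M.dist (Prod.fst ⁻¹' S)

/-- The expected loss `R(f)`. -/
def Problem.risk (f : 𝒳 → ℝ) : ℝ := ∫ z, M.loss (f z.1) z.2 ∂M.dist

/-- The conditional expected loss of `f` on the region `S`. -/
def Problem.riskOn (S : Set 𝒳) (f : 𝒳 → ℝ) : ℝ := ∫ z, M.loss (f z.1) z.2 ∂(M.distOn S)

/-- `h` is a best-in-class hypothesis on the region `S`. -/
def Problem.IsBestOn (S : Set 𝒳) (h : 𝒳 → ℝ) : Prop :=
  h ∈ M.H ∧ ∀ g ∈ M.H, M.riskOn S h ≤ M.riskOn S g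

/-- The distance `E_{(x,y) ∼ ν} |ℓ(f(x), y) - ℓ(g(x), y)|`. -/
def Problem.rho (ν : Measure (𝒳 × ℤˣ)) (f g : 𝒳 → ℝ) : ℝ :=
  ∫ z, |M.loss (f z.1) z.2 - M.loss (g z.1) z.2| ∂ν

/-- The generalized disagreement coefficient of `H` with respect to `ν`, around `h₀`: the least
`θ ∈ [0, ∞]` such that, for all `r > 0`, the expectation over `x` of the largest value of
`|ℓ(h(x), y) - ℓ(h₀(x), y)|` over `h ∈ H` with `rho(h, h₀) ≤ r` and over `y` is at most `θ r`. -/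
def Problem.disagreementCoeff (ν : Measure (𝒳 × ℤˣ)) (h₀ : 𝒳 → ℝ) : ℝ≥0∞ :=
  sInf {θ : ℝ≥0∞ | ∀ r : ℝ, 0 < r →
    ∫⁻ x, (⨆ h ∈ M.H, ⨆ (_ : M.rho ν h h₀ ≤ r), ⨆ y : ℤˣ,
      ENNReal.ofReal |M.loss (h x) y - M.loss (h₀ x) y|) ∂(ν.map Prod.fst) ≤
        θ * ENNReal.ofReal r}

/-- The probability with which the label of `x` is requested when the current hypothesis set is
`V`: the largest value of `ℓ(h(x), y) - ℓ(h'(x), y)` over `h, h' ∈ V` and `y`. -/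
def Problem.reqProb (V : Finset (𝒳 → ℝ)) (x : 𝒳) : ℝ :=
  ⨆ q : V × V × ℤˣ, (M.loss (q.1.1 x) q.2.2 - M.loss (q.2.1.1 x) q.2.2)

/-- The two sides of the axis-aligned split of `S` along coordinate `d` at threshold `c`. -/
def leftPart (S : Set 𝒳) (d : Fin D) (c : ℝ) : Set 𝒳 := {x ∈ S | x.1 d ≤ c}

def rightPart (S : Set 𝒳) (d : Fin D) (c : ℝ) : Set 𝒳 := {x ∈ S | c < x.1 d}

/-- The predictor that uses `f` on `A` and `g` on `B`, for disjoint regions `A` and `B`. -/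
def combine (A B : Set 𝒳) (f g : 𝒳 → ℝ) : 𝒳 → ℝ := fun x => A.indicator f x + B.indicator g x

/-- The region `S` admits an axis-aligned split that improves the conditional best-in-class error
by at least `ρ` and whose two parts have mass at least `c` times that of `S`.  Here `hstar`
gives a best-in-class hypothesis for each region. -/
def Problem.Splittable (hstar : Set 𝒳 → 𝒳 → ℝ) (ρ c : ℝ) (S : Set 𝒳) : Prop :=
  ∃ (d : Fin D) (a : ℝ),
    ρ ≤ M.riskOn S (hstar S) -
      M.riskOn S (combine (leftPart S d a) (rightPart S d a)
        (hstar (leftPart S d a)) (hstar (rightPart S d a))) ∧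
    c * M.mass S ≤ min (M.mass (leftPart S d a)) (M.mass (rightPart S d a))

end Learning

section Algorithm

/-- What happens in one round: a labelled example `(x, y)` and a number `u ∈ [0,1]`, uniformly
distributed, that is used to flip the coin. -/
abbrev Sample {D : ℕ} (𝒳 : Set (Fin D → ℝ)) : Type := (𝒳 × ℤˣ) × unitInterval

/-- The state of the algorithm.  The regions are `region k` for `k < K`, with current hypothesis
sets `hyp k`; `p s` is the request probability `p_s` that was used in round `s`. -/
structure State {D : ℕ} (𝒳 : Set (Fin D → ℝ)) where
  K : ℕ
  region : ℕ → Set 𝒳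
  hyp : ℕ → Finset (𝒳 → ℝ)
  p : ℕ → ℝ

variable {D : ℕ} {𝒳 : Set (Fin D → ℝ)} (M : Problem 𝒳) (A : Params 𝒳)

/-- The slack term `σ_T = κ D log (8 T³ |H|³ κ D / δ)`. -/
def slack : ℝ :=
  A.κ * D * Real.log (8 * (A.T : ℝ) ^ 3 * (M.H.card : ℝ) ^ 3 * A.κ * D / A.δ)

/-- The index of the region that contains `x`. -/
def State.index (st : State 𝒳) (x : 𝒳) : ℕ := sInf {k | k < st.K ∧ x ∈ st.region k}

/-- The hypothesis set of the region that contains `x` determines the request probability. -/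
def State.reqProb (st : State 𝒳) (x : 𝒳) : ℝ := M.reqProb (st.hyp (st.index x)) x

/-- The outcome `Q_s` of the coin with bias `p_s`; the label of round `s` is requested if it is
`1`. -/
def coin (z : ℕ → Sample 𝒳) (p : ℕ → ℝ) (s : ℕ) : ℝ := if ((z s).2 : ℝ) < p s then 1 else 0

open Classical in
/-- The rounds `1, …, t` whose point lies in `S`. -/
def visits (z : ℕ → Sample 𝒳) (t : ℕ) (S : Set 𝒳) : Finset ℕ :=
  {s ∈ Finset.Icc 1 t | (z s).1.1 ∈ S}

/-- The importance-weighted empirical risk of `f` on the region `S` after round `t`. -/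
def empRisk (z : ℕ → Sample 𝒳) (p : ℕ → ℝ) (t : ℕ) (S : Set 𝒳) (f : 𝒳 → ℝ) : ℝ :=
  (∑ s ∈ visits z t S, coin z p s / p s * M.loss (f (z s).1.1) (z s).1.2) /
    ((visits z t S).card : ℝ)

/-- `h` minimizes the importance-weighted empirical risk on `S` over the hypothesis set `V`. -/
def IsERM (z : ℕ → Sample 𝒳) (p : ℕ → ℝ) (t : ℕ) (V : Finset (𝒳 → ℝ)) (S : Set 𝒳)
    (h : 𝒳 → ℝ) : Prop :=
  h ∈ V ∧ ∀ g ∈ V, empRisk M z p t S h ≤ empRisk M z p t S g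

/-- An empirical risk minimizer over `H` on the region `S` after round `t`. -/
def erm (z : ℕ → Sample 𝒳) (p : ℕ → ℝ) (t : ℕ) (S : Set 𝒳) : 𝒳 → ℝ :=
  Classical.epsilon (IsERM M z p t M.H S)

/-- The confidence gap of splitting the region `S` along coordinate `d` at threshold `c` in
round `t`. -/
def gap (z : ℕ → Sample 𝒳) (p : ℕ → ℝ) (t : ℕ) (S : Set 𝒳) (d : Fin D) (c : ℝ) : ℝ :=
  M.mass S *
    (empRisk M z p t S (erm M z p t S) -
      empRisk M z p t S (combine (leftPart S d c) (rightPart S d c)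
        (erm M z p t (leftPart S d c)) (erm M z p t (rightPart S d c))) -
      √(2 * slack M A / ((visits z t S).card : ℝ)))

/-- The beginning of round `t`: the request probability of the observed point is recorded. -/
def State.observe (z : ℕ → Sample 𝒳) (t : ℕ) (st : State 𝒳) : State 𝒳 :=
  { st with p := Function.update st.p t (st.reqProb M (z t).1.1) }

/-- Region `k` is replaced by its two parts, each with a fresh copy of `H`. -/
def State.split (st : State 𝒳) (k : ℕ) (d : Fin D) (c : ℝ) : State 𝒳 :=
  { st with
    K := st.K + 1
    region := Function.update (Function.update st.region k (leftPart (st.region k) d c))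
      st.K (rightPart (st.region k) d c)
    hyp := Function.update (Function.update st.hyp k M.H) st.K M.H }

open Classical in
/-- The hypothesis set of region `k` is shrunk in round `t`. -/
def State.shrink (z : ℕ → Sample 𝒳) (t : ℕ) (st : State 𝒳) (k : ℕ) : State 𝒳 :=
  { st with
    hyp := Function.update st.hyp k
      {h ∈ st.hyp k | empRisk M z st.p t (st.region k) h ≤
        (⨅ g : st.hyp k, empRisk M z st.p t (st.region k) g.1) +
          √(8 * slack M A / ((visits z t (st.region k)).card : ℝ))} }

open Classical in
/-- Round `t`, in which `cut` is the candidate split chosen by the splitting subroutine. -/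
def step (z : ℕ → Sample 𝒳) (cut : Fin D × ℝ) (t : ℕ) (st : State 𝒳) : State 𝒳 :=
  let st' := st.observe M z t
  let k := st.index (z t).1.1
  if t ≤ A.τ ∧ st.K < A.κ then
    if A.γ (st.region k) ≤ gap M A z st'.p t (st.region k) cut.1 cut.2 then
      st'.split M k cut.1 cut.2
    else st'
  else st'.shrink M A z t k

/-- The state after `t` rounds. -/
def run (z : ℕ → Sample 𝒳) (cut : ℕ → Fin D × ℝ) : ℕ → State 𝒳
  | 0 => { K := 1, region := fun _ => Set.univ, hyp := fun _ => M.H, p := fun _ => 0 }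
  | t + 1 => step M A z (cut (t + 1)) (t + 1) (run z cut t)

/-- In every round of the split phase, the candidate split is one of maximal confidence gap for
the region that contains the current point, among all coordinates and all thresholds. -/
def MaximizesGap (z : ℕ → Sample 𝒳) (cut : ℕ → Fin D × ℝ) : Prop :=
  ∀ t, t + 1 ≤ A.τ → (run M A z cut t).K < A.κ →
    ∀ (d : Fin D) (c : ℝ),
      let st := run M A z cut t
      let S := st.region (st.index (z (t + 1)).1.1)
      let p := (st.observe M z (t + 1)).p
      gap M A z p (t + 1) S d c ≤ gap M A z p (t + 1) S (cut (t + 1)).1 (cut (t + 1)).2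

/-- The predictor `∑ k, 1_{x ∈ X_k} h_k(x)`. -/
def State.predictor (st : State 𝒳) (h : ℕ → 𝒳 → ℝ) : 𝒳 → ℝ :=
  fun x => ∑ k ∈ Finset.range st.K, (st.region k).indicator (h k) x

/-- The expected number of requested labels: the sum over the rounds `t = 1, …, T` of the
expectation over the point `x_t` of the request probability `p_t`, the first `t - 1` rounds being
given. -/
def expectedLabels (z : ℕ → Sample 𝒳) (cut : ℕ → Fin D × ℝ) : ℝ :=
  ∑ t ∈ Finset.range A.T, ∫ x, (run M A z cut t).reqProb M x ∂M.marginal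

/-- Every intermediate region of the run (that is, the whole input space, and every region that is
present at the beginning of a round of the split phase) is splittable. -/
def IntermediateSplittable (hstar : Set 𝒳 → 𝒳 → ℝ) (ρ c : ℝ) (z : ℕ → Sample 𝒳)
    (cut : ℕ → Fin D × ℝ) : Prop :=
  M.Splittable hstar ρ c Set.univ ∧
    ∀ t < A.τ, (run M A z cut t).K < A.κ →
      ∀ k < (run M A z cut t).K, M.Splittable hstar ρ c ((run M A z cut t).region k)

end Algorithm

end ARBAL

end

/-! ### Grids on the line whose cells have small mass -/

namespace ARBAL

/-! All probability is confined to one event, `Typical`; on it both bounds are deterministic. The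
event says that importance-weighted risk differences concentrate on every box of mass at least
`5σ/T`, that every box is visited about as often as its mass predicts, and that empirical gains of
splits of the whole space are accurate up to `√(2σ/t)` and a discretization error.

Probability. For a fixed region and a fixed test function `φ`, `weighted` divides by the request
probability `p` only where `p` dominates `|φ|`, and keeps the plain value elsewhere. The terms are
then bounded by one and unbiased given the past, so for a fixed number of visits Hoeffding's lemma
and the supermartingale bound `measure_le_sum_le` give failure probability `exp (-σ)`. For
hypotheses that are still alive, `p` does dominate the loss differences (`run_hyp_subset_of_visit`),
so there the modified weights are those of the algorithm.

The regions depend on the data and range over infinitely many boxes. They are discretized: quantiles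
give `m` grid points per coordinate with cells of mass at most `1/m` (`exists_grid`). With
probability at least `1 - δ/2` no two sample points share a cell in any coordinate, and then a box
made by `n` splits contains the same sample points as some grid region and differs from it by mass
at most `n/m` (`IsBox.exists_approx`). Atoms do no harm, since the cell of a grid point is empty.
With `B` the argument of the logarithm in `σ`, there are at most `B ^ (D (κ - 1))` grid regions,
while `exp (-σ) = B ^ (-κ D)`, so the union bound closes.

Risk. Since `c < 1/2`, the constant `ρ c / (2 (1 - c))` is at most `ρ/2`, so a single split of the
whole space already yields the gain claimed in `R_U`. If `2σ(4/ρ+1)² ≥ τ`, nothing is claimed.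
Otherwise two regions are allowed and `√(2σ/τ) ≤ ρ/4`, so if the space is still whole at round `τ`,
the good split has gap at least `ρ/2`; conversely any executed first split certifies a true gain of
almost `ρ/2` (`Typical.bestLoss_le`). Later splits cannot raise the best loss. On a heavy final
region the best hypothesis is never eliminated (`Typical.survival`), so empirical minimization loses
`O(√(σ q / T))` for mass `q`; a light region loses at most its mass. Cauchy–Schwarz sums these
losses.

Labels. In the split phase the request probability is bounded by the disagreement at radius `r_0`.
Afterwards the hypotheses of a region that has been visited long enough lie within `2 R_S(h*_S) +
O(√(σ/N))` of `h*_S`, `N` being the number of visits. The disagreement coefficient turns this into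
labels, and summing over rounds and regions gives the middle term. The rounds in which a region has
not yet been visited enough cost `O(σ)` per region. -/

/-- The points that are not separated from `x` by a point of the grid `G`. -/
def cell (G : Finset ℝ) (x : ℝ) : Set ℝ := {y | ∀ g ∈ G, g ∉ Set.uIcc x y}

theorem ordConnected_cell (G : Finset ℝ) (x : ℝ) : (cell G x).OrdConnected := by
  refine ⟨fun a ha b hb y hy g hg hgy => ?_⟩
  have h1 := ha g hg
  have h2 := hb g hg
  rw [Set.mem_uIcc] at h1 h2 hgy
  obtain ⟨hy1, hy2⟩ := hy
  push Not at h1 h2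
  rcases hgy with ⟨h3, h4⟩ | ⟨h3, h4⟩
  · exact absurd (h2.1 h3) (by linarith)
  · exact absurd (h1.2 (by linarith)) (by linarith)

theorem disjoint_cell (G : Finset ℝ) (x : ℝ) : ∀ g ∈ G, g ∉ cell G x :=
  fun g hg h => h g hg Set.right_mem_uIcc

theorem measurableSet_cell (G : Finset ℝ) (x : ℝ) : MeasurableSet (cell G x) :=
  (ordConnected_cell G x).measurableSet

/-- Joint measurability lets Fubini compute the probability that one sample point falls into the
cell of another. -/
theorem measurableSet_cell_prod (G : Finset ℝ) : MeasurableSet {q : ℝ × ℝ | q.2 ∈ cell G q.1} := by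
  have : {q : ℝ × ℝ | q.2 ∈ cell G q.1} =
      ⋂ g ∈ G, {q : ℝ × ℝ | (q.1 ≤ g ∧ g ≤ q.2) ∨ (q.2 ≤ g ∧ g ≤ q.1)}ᶜ := by
    ext q
    simp [cell, Set.mem_uIcc]
  rw [this]
  refine Finset.measurableSet_biInter _ fun g _ => MeasurableSet.compl ?_
  exact ((measurableSet_le measurable_fst measurable_const).inter
      (measurableSet_le measurable_const measurable_snd)).union
    ((measurableSet_le measurable_snd measurable_const).inter
      (measurableSet_le measurable_const measurable_fst))

/-- A quantile of a probability distribution on the line. -/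
theorem exists_quantile (ν : Measure ℝ) [IsProbabilityMeasure ν] (u : ℝ) (hu : 0 < u) :
    ∃ g : ℝ, ∀ b, u ≤ ν.real (Set.Iic b) → g ≤ b ∧ u ≤ ν.real (Set.Iic g) := by
  by_cases hne : ∃ b, u ≤ ν.real (Set.Iic b)
  swap
  · exact ⟨0, fun b hb => absurd ⟨b, hb⟩ hne⟩
  have hbdd : BddBelow {b | u ≤ cdf ν b} := by
    have h := (tendsto_cdf_atBot ν).eventually (gt_mem_nhds hu)
    obtain ⟨a, ha⟩ := Filter.eventually_atBot.1 h
    refine ⟨a, fun b hb => ?_⟩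
    by_contra hlt
    exact absurd (ha b (le_of_lt (not_le.1 hlt))) (not_lt.2 hb)
  have hne' : {b | u ≤ cdf ν b}.Nonempty := by
    obtain ⟨b, hb⟩ := hne
    exact ⟨b, by simpa [cdf_eq_real] using hb⟩
  refine ⟨sInf {b | u ≤ cdf ν b}, fun b hb => ⟨csInf_le hbdd (by simpa [cdf_eq_real] using hb), ?_⟩⟩
  rw [← cdf_eq_real]
  have hrc := (cdf ν).right_continuous (sInf {b | u ≤ cdf ν b})
  refine ge_of_tendsto (hrc.mono_left (nhdsWithin_mono _ Set.Ioi_subset_Ici_self)) ?_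
  filter_upwards [self_mem_nhdsWithin] with y hy
  obtain ⟨b, hb, hby⟩ := exists_lt_of_csInf_lt hne' hy
  exact le_trans hb (monotone_cdf ν hby.le)

/-- Every probability distribution on the line has a grid of `m` points whose cells have mass at
most `1 / m`. -/
theorem exists_grid (ν : Measure ℝ) [IsProbabilityMeasure ν] (m : ℕ) (hm : 0 < m) :
    ∃ G : Finset ℝ, G.card ≤ m ∧ ∀ x, ν.real (cell G x) ≤ 1 / m := by
  have hm' : (0 : ℝ) < m := by exact_mod_cast hm
  choose g hg using fun i : ℕ => exists_quantile ν ((i + 1 : ℝ) / m) (by positivity)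
  refine ⟨(Finset.range m).image g, Finset.card_image_le.trans (by simp), fun x => ?_⟩
  set I := cell ((Finset.range m).image g) x
  by_contra hlt
  rw [not_le] at hlt
  have hI : MeasurableSet I := measurableSet_cell _ x
  have hlt' : ENNReal.ofReal (1 / m) < ν I := by
    rw [← ENNReal.ofReal_toReal (measure_ne_top ν I)]
    exact (ENNReal.ofReal_lt_ofReal_iff (lt_trans (by positivity) hlt)).2 hlt
  -- A compact subset has a least and a greatest point, so the excess mass lies in a closed interval
  -- `[a, b]` inside the cell, whatever the endpoints of the cell are.
  obtain ⟨K, hKI, hK, hlK⟩ := hI.exists_lt_isCompact_of_ne_top (measure_ne_top ν I) hlt'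
  have hKne : K.Nonempty := by
    by_contra h
    rw [Set.not_nonempty_iff_eq_empty] at h
    simp [h] at hlK
  obtain ⟨a, haK, ha⟩ := hK.exists_isLeast hKne
  obtain ⟨b, hbK, hb⟩ := hK.exists_isGreatest hKne
  have hKab : K ⊆ Set.Icc a b := fun y hy => ⟨ha hy, hb hy⟩
  have hab : a ≤ b := ha hbK
  have hmass : 1 / (m : ℝ) < ν.real (Set.Icc a b) := by
    have := lt_of_lt_of_le hlK (measure_mono hKab)
    rw [← ENNReal.ofReal_toReal (measure_ne_top ν (Set.Icc a b))] at this
    exact (ENNReal.ofReal_lt_ofReal_iff'.1 this).1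
  have hsplit : ν.real (Set.Iic b) = ν.real (Set.Iio a) + ν.real (Set.Icc a b) := by
    rw [← measureReal_union (by
      rw [Set.disjoint_left]; intro y hy hy'; exact absurd hy'.1 (not_le.2 hy)) measurableSet_Icc]
    congr 1
    ext y
    simp only [Set.mem_Iic, Set.mem_union, Set.mem_Iio, Set.mem_Icc]
    constructor
    · intro h; rcases lt_or_ge y a with h' | h'
      · exact Or.inl h'
      · exact Or.inr ⟨h', h⟩
    · rintro (h | h)
      · exact h.le.trans hab
      · exact h.2
  -- The level `(i + 1) / m` is the first multiple of `1 / m` above the mass of `(-∞, a)`. It is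
  -- reached by `b`, so its quantile is a grid point in `[a, b]`, hence in the cell: a
  -- contradiction.
  set i := ⌊(m : ℝ) * ν.real (Set.Iio a)⌋₊
  have hi1 : (i : ℝ) ≤ m * ν.real (Set.Iio a) := Nat.floor_le (by positivity)
  have hi2 : (m : ℝ) * ν.real (Set.Iio a) < i + 1 := Nat.lt_floor_add_one _
  have hib : (i + 1 : ℝ) / m ≤ ν.real (Set.Iic b) := by
    rw [hsplit, div_le_iff₀ hm']
    have : 1 < m * ν.real (Set.Icc a b) := by rwa [div_lt_iff₀' hm'] at hmass
    nlinarith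
  have him : i < m := by
    have h1 : ν.real (Set.Iic b) ≤ 1 := measureReal_le_one
    have h2 : (i + 1 : ℝ) / m ≤ 1 := hib.trans h1
    rw [div_le_one hm'] at h2
    have : i + 1 ≤ m := by exact_mod_cast h2
    omega
  obtain ⟨hgb, hgi⟩ := hg i b hib
  have hga : a ≤ g i := by
    by_contra h
    rw [not_le] at h
    have h3 : ν.real (Set.Iic (g i)) ≤ ν.real (Set.Iio a) :=
      measureReal_mono fun y hy => lt_of_le_of_lt hy h
    have h4 := hgi.trans h3
    rw [div_le_iff₀ hm'] at h4
    linarith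
  have hgI : g i ∈ I := (ordConnected_cell _ x).out (hKI haK) (hKI hbK) ⟨hga, hgb⟩
  exact disjoint_cell _ x (g i) (Finset.mem_image_of_mem g (Finset.mem_range.2 him)) hgI

open Classical in
/-- The initial segments of the line that end at a grid point. -/
noncomputable def gridSegments (G : Finset ℝ) : Finset (Set ℝ) :=
  insert ∅ (G.image Set.Iic) ∪ insert Set.univ (G.image Set.Iio)

theorem card_gridSegments (G : Finset ℝ) : (gridSegments G).card ≤ 2 * G.card + 2 := by
  classical
  have h1 := Finset.card_insert_le (∅ : Set ℝ) (G.image Set.Iic)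
  have h2 := Finset.card_insert_le (Set.univ : Set ℝ) (G.image Set.Iio)
  have h3 : (G.image Set.Iic).card ≤ G.card := Finset.card_image_le
  have h4 : (G.image Set.Iio).card ≤ G.card := Finset.card_image_le
  have h5 := Finset.card_union_le (insert ∅ (G.image Set.Iic)) (insert Set.univ (G.image Set.Iio))
  unfold gridSegments
  omega

theorem measurableSet_of_mem_gridSegments {G : Finset ℝ} {C : Set ℝ} (h : C ∈ gridSegments G) :
    MeasurableSet C := by
  classical
  simp only [gridSegments, Finset.mem_union, Finset.mem_insert, Finset.mem_image] at h
  rcases h with (h | ⟨g, -, h⟩) | (h | ⟨g, -, h⟩) <;> subst h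
  · exact MeasurableSet.empty
  · exact measurableSet_Iic
  · exact MeasurableSet.univ
  · exact measurableSet_Iio

/-- Rounding the threshold down: the set is the closed ray up to the largest grid point `≤ a`, and
empty if there is none. -/
theorem lower_mem_gridSegments (G : Finset ℝ) (a : ℝ) :
    {x : ℝ | ∃ g ∈ G, x ≤ g ∧ g ≤ a} ∈ gridSegments G := by
  classical
  unfold gridSegments
  rcases (G.filter (· ≤ a)).eq_empty_or_nonempty with h | h
  · have : {x : ℝ | ∃ g ∈ G, x ≤ g ∧ g ≤ a} = ∅ := by
      ext x
      simp only [Set.mem_ofPred_eq, Set.mem_empty_iff_false, iff_false]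
      rintro ⟨g, hg, -, hga⟩
      exact absurd h (Finset.ne_empty_of_mem (Finset.mem_filter.2 ⟨hg, hga⟩))
    simp [this]
  · have hm := Finset.mem_filter.1 ((G.filter (· ≤ a)).max'_mem h)
    have : {x : ℝ | ∃ g ∈ G, x ≤ g ∧ g ≤ a} = Set.Iic ((G.filter (· ≤ a)).max' h) := by
      ext x
      simp only [Set.mem_ofPred_eq, Set.mem_Iic]
      constructor
      · rintro ⟨g, hg, hx, hga⟩
        exact hx.trans (Finset.le_max' _ _ (Finset.mem_filter.2 ⟨hg, hga⟩))
      · intro hx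
        exact ⟨_, hm.1, hx, hm.2⟩
    rw [this]
    refine Finset.mem_union_left _ (Finset.mem_insert_of_mem (Finset.mem_image_of_mem _ hm.1))

/-- Rounding the threshold up: the set is the open ray up to the smallest grid point `> a`, and the
whole line if there is none. -/
theorem upper_mem_gridSegments (G : Finset ℝ) (a : ℝ) :
    {x : ℝ | ∀ g ∈ G, a < g → x < g} ∈ gridSegments G := by
  classical
  unfold gridSegments
  rcases (G.filter (a < ·)).eq_empty_or_nonempty with h | h
  · have : {x : ℝ | ∀ g ∈ G, a < g → x < g} = Set.univ := by
      ext x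
      simp only [Set.mem_ofPred_eq, Set.mem_univ, iff_true]
      intro g hg hga
      exact absurd h (Finset.ne_empty_of_mem (Finset.mem_filter.2 ⟨hg, hga⟩))
    simp [this]
  · have hm := Finset.mem_filter.1 ((G.filter (a < ·)).min'_mem h)
    have : {x : ℝ | ∀ g ∈ G, a < g → x < g} = Set.Iio ((G.filter (a < ·)).min' h) := by
      ext x
      simp only [Set.mem_ofPred_eq, Set.mem_Iio]
      constructor
      · intro hx
        exact hx _ hm.1 hm.2
      · intro hx g hg hga
        exact hx.trans_le (Finset.min'_le _ _ (Finset.mem_filter.2 ⟨hg, hga⟩))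
    rw [this]
    refine Finset.mem_union_right _ (Finset.mem_insert_of_mem (Finset.mem_image_of_mem _ hm.1))

/-- If no two sample points lie in the same cell, every initial segment can be replaced by a grid
segment that contains the same sample points and differs within one cell only. -/
theorem exists_gridSegment (G : Finset ℝ) {ι : Type*} (I : Set ι) (x : ι → ℝ)
    (hx : ∀ i ∈ I, ∀ j ∈ I, i ≠ j → x j ∉ cell G (x i)) (a : ℝ) :
    ∃ C ∈ gridSegments G, (∀ i ∈ I, x i ∈ C ↔ x i ≤ a) ∧
      symmDiff (Set.Iic a) C ⊆ cell G a := by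
  -- If a sample point lies in the cell of `a` to the left of `a`, then separation leaves no other
  -- sample point up to the next grid point, so rounding up adds none. If there is no such point,
  -- rounding down loses none.
  by_cases h : ∃ i ∈ I, x i ∈ cell G a ∧ x i ≤ a
  · obtain ⟨i, hi, hic, hia⟩ := h
    -- The cell of a grid point is empty, because the point itself separates.
    have haG : a ∉ G := fun haG => hic a haG Set.left_mem_uIcc
    refine ⟨_, upper_mem_gridSegments G a, fun j hj => ⟨fun hjC => ?_, fun hja g _ hag =>
      lt_of_le_of_lt hja hag⟩, ?_⟩
    · by_contra hja
      rw [not_le] at hja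
      refine hx i hi j hj (by rintro rfl; exact absurd hia (not_le.2 hja)) fun g hg hgx => ?_
      rw [Set.uIcc_of_le (hia.trans hja.le)] at hgx
      have h1 := hic g hg
      rw [Set.uIcc_of_ge hia] at h1
      have h2 := hjC g hg
      rcases le_or_gt g a with h3 | h3
      · exact h1 ⟨hgx.1, h3⟩
      · exact absurd (h2 h3) (not_lt.2 hgx.2)
    · rintro y (⟨hy1, hy2⟩ | ⟨hy1, hy2⟩) g hg hgy
      · exact hy2 fun g' _ hag' => lt_of_le_of_lt hy1 hag'
      · simp only [Set.mem_Iic, not_le] at hy2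
        rw [Set.uIcc_of_le hy2.le] at hgy
        rcases hgy.1.lt_or_eq with h3 | h3
        · exact absurd (hy1 g hg h3) (not_lt.2 hgy.2)
        · exact haG (h3 ▸ hg)
  · push Not at h
    refine ⟨_, lower_mem_gridSegments G a, fun j hj => ⟨?_, fun hja => ?_⟩, ?_⟩
    · rintro ⟨g, -, h1, h2⟩
      exact h1.trans h2
    · by_contra hjC
      refine absurd hja (not_le.2 (h j hj fun g hg hgy => hjC ?_))
      rw [Set.uIcc_of_ge hja] at hgy
      exact ⟨g, hg, hgy.1, hgy.2⟩
    · rintro y (⟨hy1, hy2⟩ | ⟨hy1, hy2⟩) g hg hgy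
      · rw [Set.uIcc_of_ge hy1] at hgy
        exact hy2 ⟨g, hg, hgy.1, hgy.2⟩
      · obtain ⟨g', _, h1, h2⟩ := hy1
        exact absurd (h1.trans h2) hy2

end ARBAL

/-! ### Boxes and their approximation by finitely many grid regions -/

namespace ARBAL

section Regions

variable {D : ℕ} {𝒳 : Set (Fin D → ℝ)}

/-- The regions that arise from the input space by at most `n` axis-aligned splits. -/
inductive IsBox : ℕ → Set 𝒳 → Prop
  | univ : IsBox 0 Set.univ
  | weaken {n S} : IsBox n S → IsBox (n + 1) S
  | left {n S} (d : Fin D) (a : ℝ) : IsBox n S → IsBox (n + 1) (leftPart S d a)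
  | right {n S} (d : Fin D) (a : ℝ) : IsBox n S → IsBox (n + 1) (rightPart S d a)

theorem IsBox.mono {n m : ℕ} {S : Set 𝒳} (h : IsBox n S) (hnm : n ≤ m) : IsBox m S := by
  induction hnm with
  | refl => exact h
  | step _ ih => exact ih.weaken

theorem measurable_coord (d : Fin D) : Measurable fun x : 𝒳 => x.1 d :=
  (measurable_pi_apply d).comp measurable_subtype_coe

theorem measurableSet_leftPart {S : Set 𝒳} (hS : MeasurableSet S) (d : Fin D) (a : ℝ) :
    MeasurableSet (leftPart S d a) :=
  hS.inter (measurableSet_le (measurable_coord d) measurable_const)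

theorem measurableSet_rightPart {S : Set 𝒳} (hS : MeasurableSet S) (d : Fin D) (a : ℝ) :
    MeasurableSet (rightPart S d a) :=
  hS.inter (measurableSet_lt measurable_const (measurable_coord d))

theorem IsBox.measurableSet {n : ℕ} {S : Set 𝒳} (h : IsBox n S) : MeasurableSet S := by
  induction h with
  | univ => exact MeasurableSet.univ
  | weaken _ ih => exact ih
  | left d a _ ih => exact measurableSet_leftPart ih d a
  | right d a _ ih => exact measurableSet_rightPart ih d a

open Classical in
/-- The half-spaces that are bounded by a grid point, and the trivial ones. -/
noncomputable def gridCuts (G : Fin D → Finset ℝ) : Finset (Set 𝒳) :=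
  Finset.univ.biUnion fun d =>
    (gridSegments (G d)).image (fun C => {x : 𝒳 | x.1 d ∈ C}) ∪
      (gridSegments (G d)).image (fun C => {x : 𝒳 | x.1 d ∈ C}ᶜ)

open Classical in
/-- The intersections of `n` grid cuts. -/
noncomputable def gridRegions (G : Fin D → Finset ℝ) : ℕ → Finset (Set 𝒳)
  | 0 => {Set.univ}
  | n + 1 => (gridRegions G n ×ˢ gridCuts G).image fun q => q.1 ∩ q.2

theorem card_gridCuts (G : Fin D → Finset ℝ) {m : ℕ} (hG : ∀ d, (G d).card ≤ m) :
    (gridCuts G : Finset (Set 𝒳)).card ≤ D * (4 * m + 4) := by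
  classical
  refine Finset.card_biUnion_le.trans ((Finset.sum_le_card_nsmul _ _ (4 * m + 4) fun d _ => ?_).trans
    (by simp))
  refine (Finset.card_union_le _ _).trans ?_
  have h1 := Finset.card_image_le (s := gridSegments (G d)) (f := fun C => {x : 𝒳 | x.1 d ∈ C})
  have h2 := Finset.card_image_le (s := gridSegments (G d)) (f := fun C => {x : 𝒳 | x.1 d ∈ C}ᶜ)
  have h3 := card_gridSegments (G d)
  have h4 := hG d
  omega

theorem card_gridRegions (G : Fin D → Finset ℝ) {m : ℕ} (hG : ∀ d, (G d).card ≤ m) (n : ℕ) :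
    (gridRegions G n : Finset (Set 𝒳)).card ≤ (D * (4 * m + 4)) ^ n := by
  classical
  induction n with
  | zero => simp [gridRegions]
  | succ n ih =>
    refine Finset.card_image_le.trans ?_
    rw [Finset.card_product, pow_succ]
    exact Nat.mul_le_mul ih (card_gridCuts G hG)

theorem segment_mem_gridCuts (G : Fin D → Finset ℝ) (d : Fin D) {C : Set ℝ}
    (hC : C ∈ gridSegments (G d)) : {x : 𝒳 | x.1 d ∈ C} ∈ gridCuts G ∧
      {x : 𝒳 | x.1 d ∈ C}ᶜ ∈ gridCuts G := by
  classical
  unfold gridCuts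
  simp only [Finset.mem_biUnion, Finset.mem_union, Finset.mem_univ, true_and]
  exact ⟨⟨d, Or.inl (Finset.mem_image_of_mem _ hC)⟩, ⟨d, Or.inr (Finset.mem_image_of_mem _ hC)⟩⟩

theorem measurableSet_of_mem_gridCuts {G : Fin D → Finset ℝ} {C : Set 𝒳} (h : C ∈ gridCuts G) :
    MeasurableSet C := by
  classical
  simp only [gridCuts, Finset.mem_biUnion, Finset.mem_union, Finset.mem_image] at h
  obtain ⟨d, -, ⟨C, hC, rfl⟩ | ⟨C, hC, rfl⟩⟩ := h
  · exact measurable_coord d (measurableSet_of_mem_gridSegments hC)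
  · exact (measurable_coord d (measurableSet_of_mem_gridSegments hC)).compl

theorem measurableSet_of_mem_gridRegions {G : Fin D → Finset ℝ} {n : ℕ} {S : Set 𝒳}
    (h : S ∈ gridRegions G n) : MeasurableSet S := by
  classical
  induction n generalizing S with
  | zero => rw [gridRegions, Finset.mem_singleton] at h; subst h; exact MeasurableSet.univ
  | succ n ih =>
    rw [gridRegions, Finset.mem_image] at h
    obtain ⟨q, hq, rfl⟩ := h
    rw [Finset.mem_product] at hq
    exact (ih hq.1).inter (measurableSet_of_mem_gridCuts hq.2)

/-- The regions `S` and `S'` contain the same of the points `x 1, …, x T`, and they differ by a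
set of mass at most `η`. -/
def Problem.Approx (M : Problem 𝒳) (x : ℕ → 𝒳) (T : ℕ) (η : ℝ) (S S' : Set 𝒳) : Prop :=
  (∀ s ∈ Finset.Icc 1 T, x s ∈ S ↔ x s ∈ S') ∧ M.marginal.real (symmDiff S S') ≤ η

theorem marginal_isProbabilityMeasure (M : Problem 𝒳) [IsProbabilityMeasure M.dist] :
    IsProbabilityMeasure M.marginal :=
  Measure.isProbabilityMeasure_map measurable_fst.aemeasurable

/-- The grid `G` is fine for the sample `x 1, …, x T`: no two sample points lie in the same cell. -/
def Separates (G : Fin D → Finset ℝ) (x : ℕ → 𝒳) (T : ℕ) : Prop :=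
  ∀ d, ∀ i ∈ Finset.Icc 1 T, ∀ j ∈ Finset.Icc 1 T, i ≠ j → (x j).1 d ∉ cell (G d) ((x i).1 d)

/-- A box is an intersection of half-spaces, and each half-space is replaced by a grid cut with the
same sample points at the cost of one cell. The errors add up, because the symmetric difference of
two intersections is covered by the symmetric differences of the factors. -/
theorem IsBox.exists_approx {M : Problem 𝒳} [IsProbabilityMeasure M.dist] (hD : Nonempty (Fin D))
    {G : Fin D → Finset ℝ} {m : ℕ} {x : ℕ → 𝒳} {T : ℕ}
    (hmass : ∀ d a, M.marginal.real {x : 𝒳 | x.1 d ∈ cell (G d) a} ≤ 1 / m)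
    (hsep : Separates G x T) {n : ℕ} {S : Set 𝒳} (h : IsBox n S) :
    ∃ S' ∈ gridRegions G n, M.Approx x T (n / m) S S' := by
  classical
  have := marginal_isProbabilityMeasure M
  have key : ∀ {n : ℕ} {S S' C C' : Set 𝒳}, S' ∈ gridRegions G n → M.Approx x T (n / m) S S' →
      C' ∈ gridCuts G → M.Approx x T (1 / m) C C' →
      ∃ S' ∈ gridRegions G (n + 1), M.Approx x T ((n + 1 : ℕ) / m) (S ∩ C) S' := by
    intro n S S' C C' hS' h1 hC' h2
    refine ⟨S' ∩ C', Finset.mem_image.2 ⟨(S', C'), Finset.mem_product.2 ⟨hS', hC'⟩, rfl⟩,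
      fun s hs => and_congr (h1.1 s hs) (h2.1 s hs), ?_⟩
    have hsub : symmDiff (S ∩ C) (S' ∩ C') ⊆ symmDiff S S' ∪ symmDiff C C' := by
      intro y hy
      simp only [Set.mem_symmDiff, Set.mem_inter_iff, Set.mem_union] at hy ⊢
      tauto
    refine (measureReal_mono hsub).trans ((measureReal_union_le _ _).trans ?_)
    refine (add_le_add h1.2 h2.2).trans (le_of_eq ?_)
    push_cast
    ring
  have seg : ∀ d a, ∃ C ∈ gridSegments (G d),
      M.Approx x T (1 / m) {y : 𝒳 | y.1 d ≤ a} {y : 𝒳 | y.1 d ∈ C} := by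
    intro d a
    obtain ⟨C, hC, h1, h2⟩ := exists_gridSegment (G d) (ι := ℕ) (Finset.Icc 1 T)
      (fun s => (x s).1 d) (fun i hi j hj hij => hsep d i hi j hj hij) a
    exact ⟨C, hC, fun s hs => (h1 s hs).symm,
      (measureReal_mono (h₂ := measure_ne_top _ _) (show _ ⊆ {y : 𝒳 | y.1 d ∈ cell (G d) a} from
        fun y hy => h2 hy)).trans (hmass d a)⟩
  induction h with
  | univ =>
    exact ⟨Set.univ, by simp [gridRegions], by simp [Problem.Approx]⟩
  | @weaken n S hS ih =>
    obtain ⟨S', hS', h1⟩ := ih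
    -- A missing split is padded by the trivial cut, which is a grid cut as soon as there is a
    -- coordinate.
    obtain ⟨d⟩ := hD
    have huniv : (Set.univ : Set 𝒳) ∈ gridCuts G :=
      (segment_mem_gridCuts G d (C := Set.univ) (by simp [gridSegments])).1
    obtain ⟨R, hR, h2⟩ := key hS' h1 huniv (C := Set.univ) (by
      refine ⟨fun _ _ => Iff.rfl, ?_⟩
      simp)
    exact ⟨R, hR, by simpa using h2⟩
  | @left n S d a hS ih =>
    obtain ⟨S', hS', h1⟩ := ih
    obtain ⟨C, hC, h2⟩ := seg d a
    exact key hS' h1 (segment_mem_gridCuts G d hC).1 h2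
  | @right n S d a hS ih =>
    obtain ⟨S', hS', h1⟩ := ih
    obtain ⟨C, hC, h2⟩ := seg d a
    have : rightPart S d a = S ∩ {y : 𝒳 | y.1 d ≤ a}ᶜ := by
      ext y; simp [rightPart]
    rw [this]
    refine key hS' h1 (segment_mem_gridCuts G d hC).2 ⟨fun s hs => not_congr (h2.1 s hs), ?_⟩
    have h3 : symmDiff {y : 𝒳 | y.1 d ≤ a}ᶜ {y : 𝒳 | y.1 d ∈ C}ᶜ =
        symmDiff {y : 𝒳 | y.1 d ≤ a} {y : 𝒳 | y.1 d ∈ C} := by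
      ext y
      simp only [Set.mem_symmDiff, Set.mem_compl_iff]
      tauto
    rw [h3]
    exact h2.2

end Regions

end ARBAL

/-! ### Request probabilities and the invariants of a run -/

namespace ARBAL

section ReqProb

variable {D : ℕ} {𝒳 : Set (Fin D → ℝ)} {M : Problem 𝒳}

theorem Problem.le_reqProb {V : Finset (𝒳 → ℝ)} {f g : 𝒳 → ℝ} (hf : f ∈ V) (hg : g ∈ V)
    (x : 𝒳) (y : ℤˣ) : |M.loss (f x) y - M.loss (g x) y| ≤ M.reqProb V x := by
  have hb : BddAbove (Set.range fun q : V × V × ℤˣ =>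
      (M.loss (q.1.1 x) q.2.2 - M.loss (q.2.1.1 x) q.2.2)) := Set.finite_range _ |>.bddAbove
  rw [abs_le]
  constructor
  · have h := le_ciSup hb (⟨g, hg⟩, ⟨f, hf⟩, y)
    unfold Problem.reqProb
    simp only at h
    linarith
  · exact le_ciSup hb (⟨f, hf⟩, ⟨g, hg⟩, y)

theorem Problem.reqProb_le {V : Finset (𝒳 → ℝ)} {x : 𝒳} {c : ℝ} (hc : 0 ≤ c)
    (h : ∀ f ∈ V, ∀ g ∈ V, ∀ y, M.loss (f x) y - M.loss (g x) y ≤ c) : M.reqProb V x ≤ c :=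
  Real.iSup_le (fun q => h q.1.1 q.1.2 q.2.1.1 q.2.1.2 q.2.2) hc

theorem Problem.reqProb_nonneg (V : Finset (𝒳 → ℝ)) (x : 𝒳) : 0 ≤ M.reqProb V x := by
  rcases V.eq_empty_or_nonempty with h | ⟨f, hf⟩
  · subst h
    unfold Problem.reqProb
    rw [Real.iSup_of_isEmpty]
  · exact (abs_nonneg _).trans (M.le_reqProb hf hf x 1)

theorem Problem.reqProb_mono {V W : Finset (𝒳 → ℝ)} (h : V ⊆ W) (x : 𝒳) :
    M.reqProb V x ≤ M.reqProb W x :=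
  Problem.reqProb_le (Problem.reqProb_nonneg W x) fun _ hf _ hg y =>
    (le_abs_self _).trans (M.le_reqProb (h hf) (h hg) x y)

/-- The losses of the hypotheses lie in the unit interval. -/
def Problem.Bounded (M : Problem 𝒳) : Prop :=
  ∀ h ∈ M.H, ∀ x y, M.loss (h x) y ∈ Set.Icc (0 : ℝ) 1

theorem Problem.reqProb_le_one (hM : M.Bounded) {V : Finset (𝒳 → ℝ)} (hV : V ⊆ M.H) (x : 𝒳) :
    M.reqProb V x ≤ 1 :=
  Problem.reqProb_le zero_le_one fun f hf g hg y => by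
    have h1 := (hM f (hV hf) x y).2
    have h2 := (hM g (hV hg) x y).1
    linarith

end ReqProb

section Run

variable {D : ℕ} {𝒳 : Set (Fin D → ℝ)} {M : Problem 𝒳} {A : Params 𝒳} {z : ℕ → Sample 𝒳}
  {cut : ℕ → Fin D × ℝ}

/-- Every point lies in exactly one region. -/
def State.Partition (st : State 𝒳) : Prop := ∀ x, ∃! k, k < st.K ∧ x ∈ st.region k

theorem State.Partition.index_eq {st : State 𝒳} (h : st.Partition) {k : ℕ} {x : 𝒳}
    (hk : k < st.K) (hx : x ∈ st.region k) : st.index x = k := by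
  obtain ⟨j, -, hj⟩ := h x
  have : {k | k < st.K ∧ x ∈ st.region k} = {k} := by
    ext i
    constructor
    · intro hi
      exact (hj i hi).trans (hj k ⟨hk, hx⟩).symm
    · rintro rfl
      exact ⟨hk, hx⟩
  unfold State.index
  rw [this, csInf_singleton]

theorem State.Partition.index_spec {st : State 𝒳} (h : st.Partition) (x : 𝒳) :
    st.index x < st.K ∧ x ∈ st.region (st.index x) := by
  obtain ⟨j, hj, -⟩ := h x
  rw [h.index_eq hj.1 hj.2]
  exact hj

/-- The invariants of the run are obtained by induction over the rounds from this case distinction.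
-/
theorem step_cases (M : Problem 𝒳) (A : Params 𝒳) (z : ℕ → Sample 𝒳) (c : Fin D × ℝ) (t : ℕ)
    (st : State 𝒳) :
    (t ≤ A.τ ∧ st.K < A.κ ∧
      A.γ (st.region (st.index (z t).1.1)) ≤ gap M A z (st.observe M z t).p t
        (st.region (st.index (z t).1.1)) c.1 c.2 ∧
      step M A z c t st = (st.observe M z t).split M (st.index (z t).1.1) c.1 c.2) ∨
    (t ≤ A.τ ∧ st.K < A.κ ∧
      ¬ A.γ (st.region (st.index (z t).1.1)) ≤ gap M A z (st.observe M z t).p t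
        (st.region (st.index (z t).1.1)) c.1 c.2 ∧
      step M A z c t st = st.observe M z t) ∨
    (¬ (t ≤ A.τ ∧ st.K < A.κ) ∧
      step M A z c t st = (st.observe M z t).shrink M A z t (st.index (z t).1.1)) := by
  unfold step
  by_cases h1 : t ≤ A.τ ∧ st.K < A.κ
  · by_cases h2 : A.γ (st.region (st.index (z t).1.1)) ≤ gap M A z (st.observe M z t).p t
        (st.region (st.index (z t).1.1)) c.1 c.2
    · exact Or.inl ⟨h1.1, h1.2, h2, by simp only [if_pos h1, if_pos h2]⟩
    · exact Or.inr (Or.inl ⟨h1.1, h1.2, h2, by simp only [if_pos h1, if_neg h2]⟩)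
  · exact Or.inr (Or.inr ⟨h1, by simp only [if_neg h1]⟩)

theorem State.Partition.split {st : State 𝒳} (h : st.Partition) {k : ℕ} (hk : k < st.K)
    (M : Problem 𝒳) (d : Fin D) (a : ℝ) : (st.split M k d a).Partition := by
  intro x
  obtain ⟨j, ⟨hj1, hj2⟩, hj⟩ := h x
  have hne : k ≠ st.K := hk.ne
  have reg : ∀ i, (st.split M k d a).region i = if i = st.K then rightPart (st.region k) d a else
      if i = k then leftPart (st.region k) d a else st.region i := by
    intro i
    simp only [State.split, Function.update_apply]
  have hK : (st.split M k d a).K = st.K + 1 := rfl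
  by_cases hjk : j = k
  · subst hjk
    by_cases hx : x.1 d ≤ a
    · refine ⟨j, ⟨by omega, ?_⟩, ?_⟩
      · rw [reg, if_neg hne, if_pos rfl]; exact ⟨hj2, hx⟩
      · rintro i ⟨hi1, hi2⟩
        rw [reg] at hi2
        split_ifs at hi2 with h1 h2
        · exact absurd hi2.2 (not_lt.2 hx)
        · exact h2
        · exact hj i ⟨by omega, hi2⟩
    · refine ⟨st.K, ⟨by omega, ?_⟩, ?_⟩
      · rw [reg, if_pos rfl]; exact ⟨hj2, not_le.1 hx⟩
      · rintro i ⟨hi1, hi2⟩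
        rw [reg] at hi2
        split_ifs at hi2 with h1 h2
        · exact h1
        · exact absurd hi2.2 hx
        · exact absurd (hj i ⟨by omega, hi2⟩) h2
  · refine ⟨j, ⟨by omega, ?_⟩, ?_⟩
    · rw [reg, if_neg (by omega), if_neg hjk]; exact hj2
    · rintro i ⟨hi1, hi2⟩
      rw [reg] at hi2
      split_ifs at hi2 with h1 h2
      · exact absurd (hj k ⟨hk, hi2.1⟩).symm hjk
      · exact absurd (hj k ⟨hk, hi2.1⟩).symm hjk
      · exact hj i ⟨by omega, hi2⟩

theorem run_partition (M : Problem 𝒳) (A : Params 𝒳) (z : ℕ → Sample 𝒳)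
    (cut : ℕ → Fin D × ℝ) (t : ℕ) : (run M A z cut t).Partition := by
  induction t with
  | zero =>
    intro x
    exact ⟨0, ⟨Nat.one_pos, Set.mem_univ _⟩, fun i hi => Nat.lt_one_iff.1 hi.1⟩
  | succ t ih =>
    rw [run]
    rcases step_cases M A z (cut (t + 1)) (t + 1) (run M A z cut t) with
      ⟨-, -, -, h⟩ | ⟨-, -, -, h⟩ | ⟨-, h⟩ <;> rw [h]
    · exact State.Partition.split (st := (run M A z cut t).observe M z (t + 1)) ih
        (ih.index_spec _).1 M _ _
    · exact ih
    · exact ih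

theorem run_K_mono (t : ℕ) : (run M A z cut t).K ≤ (run M A z cut (t + 1)).K := by
  rw [run]
  rcases step_cases M A z (cut (t + 1)) (t + 1) (run M A z cut t) with
    ⟨-, -, -, h⟩ | ⟨-, -, -, h⟩ | ⟨-, h⟩ <;> rw [h]
  · exact Nat.le_succ _
  · exact le_rfl
  · exact le_rfl

theorem run_K_monotone : Monotone fun t => (run M A z cut t).K :=
  monotone_nat_of_le_succ run_K_mono

theorem one_le_run_K (t : ℕ) : 1 ≤ (run M A z cut t).K :=
  run_K_monotone (M := M) (A := A) (z := z) (cut := cut) (Nat.zero_le t)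

theorem run_K_le (hκ : 1 ≤ A.κ) (t : ℕ) : (run M A z cut t).K ≤ A.κ := by
  induction t with
  | zero => exact hκ
  | succ t ih =>
    rw [run]
    rcases step_cases M A z (cut (t + 1)) (t + 1) (run M A z cut t) with
      ⟨-, h1, -, h⟩ | ⟨-, -, -, h⟩ | ⟨-, h⟩ <;> rw [h]
    · exact h1
    · exact ih
    · exact ih

theorem run_isBox (t : ℕ) : ∀ k < (run M A z cut t).K,
    IsBox ((run M A z cut t).K - 1) ((run M A z cut t).region k) := by
  induction t with
  | zero => intro k _; exact IsBox.univ
  | succ t ih =>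
    rw [run]
    have hidx := ((run_partition M A z cut t).index_spec (z (t + 1)).1.1).1
    rcases step_cases M A z (cut (t + 1)) (t + 1) (run M A z cut t) with
      ⟨-, -, -, h⟩ | ⟨-, -, -, h⟩ | ⟨-, h⟩ <;> rw [h]
    · intro i hi
      have hK : (((run M A z cut t).observe M z (t + 1)).split M
          ((run M A z cut t).index (z (t + 1)).1.1) (cut (t + 1)).1 (cut (t + 1)).2).K - 1 =
          ((run M A z cut t).K - 1) + 1 := by
        change (run M A z cut t).K + 1 - 1 = _
        have := one_le_run_K (M := M) (A := A) (z := z) (cut := cut) t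
        omega
      rw [hK]
      have hi' : i < (run M A z cut t).K + 1 := hi
      simp only [State.split, Function.update_apply]
      split_ifs with h1 h2
      · exact IsBox.right _ _ (ih _ hidx)
      · exact IsBox.left _ _ (ih _ hidx)
      · refine (ih i ?_).weaken
        have h1' : i ≠ (run M A z cut t).K := h1
        omega
    · exact ih
    · exact ih

theorem run_region_measurableSet (t k : ℕ) (hk : k < (run M A z cut t).K) :
    MeasurableSet ((run M A z cut t).region k) :=
  (run_isBox t k hk).measurableSet

theorem run_hyp_subset (t : ℕ) : ∀ k, (run M A z cut t).hyp k ⊆ M.H := by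
  classical
  induction t with
  | zero => intro k; exact subset_rfl
  | succ t ih =>
    rw [run]
    rcases step_cases M A z (cut (t + 1)) (t + 1) (run M A z cut t) with
      ⟨-, -, -, h⟩ | ⟨-, -, -, h⟩ | ⟨-, h⟩ <;> rw [h]
    · intro i
      simp only [State.split, Function.update_apply]
      split_ifs
      · exact subset_rfl
      · exact subset_rfl
      · exact ih i
    · exact ih
    · intro i
      simp only [State.shrink, Function.update_apply]
      split_ifs with h1
      · exact (Finset.filter_subset _ _).trans (ih _)
      · exact ih i

theorem step_p (c : Fin D × ℝ) (t : ℕ) (st : State 𝒳) :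
    (step M A z c t st).p = (st.observe M z t).p := by
  rcases step_cases M A z c t st with ⟨-, -, -, h⟩ | ⟨-, -, -, h⟩ | ⟨-, h⟩ <;> rw [h] <;> rfl

theorem run_p {s t : ℕ} (hst : s < t) :
    (run M A z cut t).p (s + 1) = (run M A z cut s).reqProb M (z (s + 1)).1.1 := by
  induction t with
  | zero => omega
  | succ t ih =>
    rw [run, step_p]
    simp only [State.observe, Function.update_apply]
    split_ifs with h
    · have : s = t := by omega
      subst this; rfl
    · exact ih (by omega)

/-- After `t` rounds, the algorithm is still in the split phase. -/
def Splitting (M : Problem 𝒳) (A : Params 𝒳) (z : ℕ → Sample 𝒳) (cut : ℕ → Fin D × ℝ)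
    (t : ℕ) : Prop := t + 1 ≤ A.τ ∧ (run M A z cut t).K < A.κ

theorem Splitting.mono {s t : ℕ} (h : Splitting M A z cut t) (hst : s ≤ t) :
    Splitting M A z cut s :=
  ⟨by have := h.1; omega, lt_of_le_of_lt (run_K_monotone hst) h.2⟩

theorem Splitting.hyp_eq {t : ℕ} (h : Splitting M A z cut t) (k : ℕ) :
    (run M A z cut t).hyp k = M.H := by
  induction t generalizing k with
  | zero => rfl
  | succ t ih =>
    have h' := h.mono (Nat.le_succ t)
    rw [run]
    rcases step_cases M A z (cut (t + 1)) (t + 1) (run M A z cut t) with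
      ⟨-, -, -, h1⟩ | ⟨-, -, -, h1⟩ | ⟨h0, h1⟩
    · rw [h1]
      simp only [State.split, Function.update_apply]
      split_ifs
      · rfl
      · rfl
      · exact ih h' k
    · rw [h1]
      exact ih h' k
    · exact absurd h' h0

/-- The hypotheses that are left in a region have taken part in the request probabilities of all
earlier points of the region. -/
theorem run_hyp_subset_of_visit {t : ℕ} : ∀ s < t, ∀ k < (run M A z cut t).K,
    (z (s + 1)).1.1 ∈ (run M A z cut t).region k →
    (run M A z cut t).hyp k ⊆
      (run M A z cut s).hyp ((run M A z cut s).index (z (s + 1)).1.1) := by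
  classical
  induction t with
  | zero => intro s hs; omega
  | succ t ih =>
    intro s hs k hk hx
    -- In the split phase every region carries all of `H`, so nothing has been lost at any earlier
    -- round. Afterwards the regions are frozen and the hypothesis sets only shrink.
    by_cases hph : Splitting M A z cut t
    · rw [(hph.mono (by omega : s ≤ t)).hyp_eq]
      exact run_hyp_subset _ _
    · rw [run] at hk hx ⊢
      rcases step_cases M A z (cut (t + 1)) (t + 1) (run M A z cut t) with
        ⟨h0, h0', -, -⟩ | ⟨h0, h0', -, -⟩ | ⟨-, h1⟩
      · exact absurd ⟨h0, h0'⟩ hph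
      · exact absurd ⟨h0, h0'⟩ hph
      · rw [h1] at hk hx ⊢
        have hsub : (((run M A z cut t).observe M z (t + 1)).shrink M A z (t + 1)
            ((run M A z cut t).index (z (t + 1)).1.1)).hyp k ⊆ (run M A z cut t).hyp k := by
          simp only [State.shrink, Function.update_apply]
          split_ifs with h2
          · subst h2
            exact Finset.filter_subset _ _
          · exact subset_rfl
        refine hsub.trans ?_
        rcases Nat.lt_succ_iff_lt_or_eq.1 hs with hst | rfl
        · exact ih s hst k hk hx
        · rw [(run_partition M A z cut s).index_eq hk hx]

/-- This domination is what makes division by small request probabilities harmless: for surviving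
hypotheses the weighted loss differences never exceed one. -/
theorem loss_sub_le_run_p {t s k : ℕ} (hs : s < t) (hk : k < (run M A z cut t).K)
    (hx : (z (s + 1)).1.1 ∈ (run M A z cut t).region k) {f g : 𝒳 → ℝ}
    (hf : f ∈ (run M A z cut t).hyp k) (hg : g ∈ (run M A z cut t).hyp k) (y : ℤˣ) :
    |M.loss (f (z (s + 1)).1.1) y - M.loss (g (z (s + 1)).1.1) y| ≤
      (run M A z cut s).reqProb M (z (s + 1)).1.1 :=
  M.le_reqProb (run_hyp_subset_of_visit s hs k hk hx hf) (run_hyp_subset_of_visit s hs k hk hx hg) _ y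

theorem run_eq_of_not_splitting {t : ℕ} (h : ¬ Splitting M A z cut t) :
    (run M A z cut (t + 1)).K = (run M A z cut t).K ∧
      (run M A z cut (t + 1)).region = (run M A z cut t).region := by
  rw [run]
  rcases step_cases M A z (cut (t + 1)) (t + 1) (run M A z cut t) with
    ⟨h0, h0', -, -⟩ | ⟨h0, h0', -, -⟩ | ⟨-, h1⟩
  · exact absurd ⟨h0, h0'⟩ h
  · exact absurd ⟨h0, h0'⟩ h
  · rw [h1]; exact ⟨rfl, rfl⟩

theorem run_eq_of_le {t u : ℕ} (h : A.τ ≤ t) (htu : t ≤ u) :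
    (run M A z cut u).K = (run M A z cut t).K ∧
      (run M A z cut u).region = (run M A z cut t).region := by
  induction htu with
  | refl => exact ⟨rfl, rfl⟩
  | @step u hu ih =>
    have h1 := run_eq_of_not_splitting (M := M) (A := A) (z := z) (cut := cut) (t := u)
      (fun hs => by have := hs.1; have : t ≤ u := hu; omega)
    exact ⟨h1.1.trans ih.1, h1.2.trans ih.2⟩

end Run

end ARBAL

/-! ### The history of the rounds and exponential supermartingales -/

namespace ARBAL

section Past

variable {Ω : Type*} {mΩ : MeasurableSpace Ω} {E : Type*} [MeasurableSpace E] {Z : ℕ → Ω → E}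

/-- The events of the rounds `1, …, t`. -/
abbrev past (Z : ℕ → Ω → E) (t : ℕ) : MeasurableSpace Ω :=
  MeasurableSpace.comap (fun ω (s : Finset.Icc 1 t) => Z s ω) MeasurableSpace.pi

theorem past_le (hZ : ∀ t, Measurable (Z t)) (t : ℕ) : past Z t ≤ mΩ := by
  refine Measurable.comap_le ?_
  exact measurable_pi_lambda _ fun s => hZ s

theorem measurable_past {s t : ℕ} (h1 : 1 ≤ s) (hst : s ≤ t) : Measurable[past Z t] (Z s) := by
  have h : Measurable[past Z t] (fun ω (s : Finset.Icc 1 t) => Z s ω) := comap_measurable _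
  exact (measurable_pi_apply (⟨s, Finset.mem_Icc.2 ⟨h1, hst⟩⟩ : Finset.Icc 1 t)).comp h

theorem past_mono {s t : ℕ} (hst : s ≤ t) : past Z s ≤ past Z t := by
  refine Measurable.comap_le ?_
  refine @measurable_pi_lambda _ _ _ (past Z t) _ _ fun i => ?_
  have hi := Finset.mem_Icc.1 i.2
  exact measurable_past hi.1 (hi.2.trans hst)

theorem lintegral_indepFun {F : Type*} [MeasurableSpace F] {P : Measure Ω} [IsProbabilityMeasure P]
    {Y : Ω → F} {W : Ω → E} (hY : Measurable Y) (hW : Measurable W) (hind : IndepFun Y W P)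
    {G : F × E → ℝ≥0∞} (hG : Measurable G) :
    ∫⁻ ω, G (Y ω, W ω) ∂P = ∫⁻ ω, ∫⁻ e, G (Y ω, e) ∂(P.map W) ∂P := by
  rw [indepFun_iff_map_prod_eq_prod_map_map hY.aemeasurable hW.aemeasurable] at hind
  have := Measure.isProbabilityMeasure_map (μ := P) hW.aemeasurable
  rw [← lintegral_map hG (hY.prodMk hW), hind, lintegral_prod _ hG.aemeasurable,
    lintegral_map hG.lintegral_prod_right' hY]

/-- The identity of `Ω`, with its target carrying the σ-algebra `past Z t`, stands for the whole
history, so that the joint law of the history and the next sample is a product and Fubini applies.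
-/
theorem indepFun_past (hZ : ∀ t, Measurable (Z t)) {P : Measure Ω} (hind : iIndepFun Z P) (t : ℕ) :
    @IndepFun _ _ _ mΩ (past Z t) _ (id : Ω → Ω) (Z (t + 1)) P := by
  have h := hind.indepFun_finset (Finset.Icc 1 t) {t + 1} (by simp) hZ
  have h2 : IndepFun (fun a (i : Finset.Icc 1 t) => Z i a) (Z (t + 1)) P :=
    h.comp (φ := id) (ψ := fun w : (({t + 1} : Finset ℕ) → E) =>
      w ⟨t + 1, Finset.mem_singleton_self _⟩) measurable_id (measurable_pi_apply _)
  refine (@IndepFun_iff Ω mΩ Ω E (past Z t) _ id (Z (t + 1)) P).2 fun t1 t2 h1 h3 =>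
    (IndepFun_iff _ _ _).1 h2 t1 t2 ?_ h3
  obtain ⟨s, hs, rfl⟩ := h1
  exact hs

theorem lintegral_past (hZ : ∀ t, Measurable (Z t)) {P : Measure Ω} [IsProbabilityMeasure P]
    (hind : iIndepFun Z P) {μ : Measure E} {t : ℕ} (hlaw : P.map (Z (t + 1)) = μ)
    {G : Ω × E → ℝ≥0∞} (hG : Measurable[(past Z t).prod inferInstance] G) :
    ∫⁻ ω, G (ω, Z (t + 1) ω) ∂P = ∫⁻ ω, ∫⁻ e, G (ω, e) ∂μ ∂P := by
  rw [← hlaw]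
  exact @lintegral_indepFun Ω mΩ E _ Ω (past Z t) P _ id (Z (t + 1))
    (measurable_id'' (past_le hZ t)) (hZ _) (indepFun_past hZ hind t) G hG

theorem measurable_section {m m' : MeasurableSpace Ω} (hm : m ≤ m') {β : Type*}
    [MeasurableSpace β] {G : Ω × E → β} (hG : Measurable[m.prod inferInstance] G)
    {W : Ω → E} (hW : Measurable[m'] W) : Measurable[m'] fun ω => G (ω, W ω) :=
  hG.comp (@Measurable.prodMk Ω m' Ω E m _ id W (measurable_id'' hm) hW)

/-- Given the first rounds, the last factor integrates to at most one and can be peeled off; this is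
the supermartingale property, unrolled by induction. -/
theorem lintegral_prod_le_one (hZ : ∀ t, Measurable (Z t)) {P : Measure Ω}
    [IsProbabilityMeasure P] (hind : iIndepFun Z P) {μ : Measure E}
    (hlaw : ∀ t, P.map (Z t) = μ)
    {g : ℕ → Ω × E → ℝ≥0∞} (hg : ∀ t, Measurable[(past Z t).prod inferInstance] (g t))
    (hle : ∀ t ω, ∫⁻ e, g t (ω, e) ∂μ ≤ 1) (n : ℕ) :
    ∫⁻ ω, ∏ t ∈ Finset.range n, g t (ω, Z (t + 1) ω) ∂P ≤ 1 := by
  induction n with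
  | zero => simp
  | succ n ih =>
    simp only [Finset.prod_range_succ]
    have hfirst : Measurable[past Z n] fun ω => ∏ t ∈ Finset.range n, g t (ω, Z (t + 1) ω) := by
      refine @Finset.measurable_prod _ _ _ _ _ _ (past Z n) _ _ fun t ht => ?_
      have htn := Finset.mem_range.1 ht
      exact measurable_section (past_mono htn.le) (hg t) (measurable_past (by omega) htn)
    have hfst : @Measurable _ _ ((past Z n).prod inferInstance) (past Z n)
        (Prod.fst : Ω × E → Ω) := @measurable_fst _ _ (past Z n) _
    have hG : Measurable[(past Z n).prod inferInstance] fun q : Ω × E =>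
        (∏ t ∈ Finset.range n, g t (q.1, Z (t + 1) q.1)) * g n q :=
      Measurable.mul (m := (past Z n).prod inferInstance) (hfirst.comp hfst) (hg n)
    have h := lintegral_past hZ hind (hlaw (n + 1)) hG
    simp only at h
    rw [h]
    refine le_trans (lintegral_mono fun ω => ?_) ih
    have hsec : Measurable fun e => g n (ω, e) :=
      (hg n).comp (@measurable_prodMk_left _ _ (past Z n) _ ω)
    rw [lintegral_const_mul _ hsec]
    exact mul_le_of_le_one_right' (hle n ω)

/-- The exponential tail bound for sums of functions whose exponentials have conditional
expectation at most one. -/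
theorem measure_le_sum_le (hZ : ∀ t, Measurable (Z t)) {P : Measure Ω}
    [IsProbabilityMeasure P] (hind : iIndepFun Z P) {μ : Measure E}
    (hlaw : ∀ t, P.map (Z t) = μ)
    {X : ℕ → Ω × E → ℝ} (hX : ∀ t, Measurable[(past Z t).prod inferInstance] (X t))
    (hle : ∀ t ω, ∫⁻ e, ENNReal.ofReal (Real.exp (X t (ω, e))) ∂μ ≤ 1) (n : ℕ) (u : ℝ) :
    P {ω | u ≤ ∑ t ∈ Finset.range n, X t (ω, Z (t + 1) ω)} ≤ ENNReal.ofReal (Real.exp (-u)) := by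
  have h1 := lintegral_prod_le_one hZ hind hlaw
    (g := fun t q => ENNReal.ofReal (Real.exp (X t q)))
    (fun t => ENNReal.measurable_ofReal.comp (Real.measurable_exp.comp (hX t))) hle n
  have hmeas : Measurable fun ω => ∏ t ∈ Finset.range n,
      ENNReal.ofReal (Real.exp (X t (ω, Z (t + 1) ω))) := by
    refine Finset.measurable_prod _ fun t _ => ?_
    exact ENNReal.measurable_ofReal.comp (Real.measurable_exp.comp
      (measurable_section (past_le hZ t) (hX t) (hZ _)))
  have h2 := mul_meas_ge_le_lintegral (μ := P) hmeas (ENNReal.ofReal (Real.exp u))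
  have hset : {ω | u ≤ ∑ t ∈ Finset.range n, X t (ω, Z (t + 1) ω)} ⊆
      {ω | ENNReal.ofReal (Real.exp u) ≤ ∏ t ∈ Finset.range n,
        ENNReal.ofReal (Real.exp (X t (ω, Z (t + 1) ω)))} := by
    intro ω hω
    have hω' : u ≤ ∑ t ∈ Finset.range n, X t (ω, Z (t + 1) ω) := hω
    change ENNReal.ofReal (Real.exp u) ≤ _
    rw [← ENNReal.ofReal_prod_of_nonneg fun _ _ => (Real.exp_pos _).le, ← Real.exp_sum]
    exact ENNReal.ofReal_le_ofReal (Real.exp_le_exp.2 hω')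
  refine (measure_mono hset).trans ?_
  rw [Real.exp_neg, ENNReal.ofReal_inv_of_pos (Real.exp_pos u), ← one_div,
    ENNReal.le_div_iff_mul_le (Or.inl (by simp [Real.exp_pos])) (Or.inl ENNReal.ofReal_ne_top),
    mul_comm]
  exact h2.trans h1

end Past

end ARBAL

/-! ### Exponential moments of a single round -/

namespace ARBAL

section OneStep

variable {D : ℕ} {𝒳 : Set (Fin D → ℝ)} {M : Problem 𝒳}

instance : MeasurableSingletonClass ℤˣ :=
  ⟨fun y => ⟨{(y : ℤ)}, measurableSet_singleton _, by ext w; simp [Units.ext_iff]⟩⟩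

open Classical in
/-- The importance-weighted value of the test function `φ` in a round with request probability
`p`, wherever `p` dominates `φ`, and the plain value elsewhere. -/
noncomputable def weighted (φ : 𝒳 × ℤˣ → ℝ) (p : ℝ) (w : Sample 𝒳) : ℝ :=
  if ∀ y, |φ (w.1.1, y)| ≤ p then (if (w.2 : ℝ) < p then 1 else 0) / p * φ w.1 else φ w.1

theorem measurable_weighted {φ : 𝒳 × ℤˣ → ℝ} (hφ : Measurable φ) :
    Measurable fun q : ℝ × Sample 𝒳 => weighted φ q.1 q.2 := by
  have hφ' : Measurable fun q : ℝ × Sample 𝒳 => φ q.2.1 :=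
    hφ.comp (measurable_fst.comp measurable_snd)
  have hx : Measurable fun q : ℝ × Sample 𝒳 => q.2.1.1 :=
    measurable_fst.comp (measurable_fst.comp measurable_snd)
  refine Measurable.ite ?_ (((Measurable.ite ?_ measurable_const measurable_const).div
    measurable_fst).mul hφ') hφ'
  · have : {q : ℝ × Sample 𝒳 | ∀ y, |φ (q.2.1.1, y)| ≤ q.1} =
        ⋂ y, {q : ℝ × Sample 𝒳 | |φ (q.2.1.1, y)| ≤ q.1} := by ext q; simp
    rw [this]
    exact MeasurableSet.iInter fun y => measurableSet_le
      (continuous_abs.measurable.comp (hφ.comp (hx.prodMk measurable_const))) measurable_fst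
  · exact measurableSet_lt (measurable_subtype_coe.comp (measurable_snd.comp measurable_snd))
      measurable_fst

/-- The weight `1 / p` is applied only where `p` dominates `|φ|`, so no lower bound on the request
probability is needed. -/
theorem abs_weighted_le_one {φ : 𝒳 × ℤˣ → ℝ} (hφ : ∀ q, |φ q| ≤ 1) (p : ℝ) (w : Sample 𝒳) :
    |weighted φ p w| ≤ 1 := by
  unfold weighted
  split_ifs with h1 h2
  · have h3 := h1 w.1.2
    rcases (abs_nonneg _ |>.trans h3).lt_or_eq with hp | hp
    · rw [abs_mul, abs_of_nonneg (by positivity : (0 : ℝ) ≤ 1 / p), one_div_mul_eq_div,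
        div_le_one hp]
      exact h3
    · simp [← hp]
  · simp
  · exact hφ _

/-- The test that selects the branch involves the point but neither the coin nor the observed label,
so averaging over the coin gives back `φ` in both branches. If `p = 0` passes the test, then `φ`
vanishes there. -/
theorem integral_weighted (φ : 𝒳 × ℤˣ → ℝ) {p : ℝ} (hp : p ≤ 1) (v : 𝒳 × ℤˣ) :
    ∫ u : unitInterval, weighted φ p (v, u) = φ v := by
  unfold weighted
  by_cases h1 : ∀ y, |φ (v.1, y)| ≤ p
  · simp only [h1, implies_true, if_true]
    have h3 := h1 v.2
    rcases (abs_nonneg _ |>.trans h3).lt_or_eq with hp0 | hp0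
    · rw [integral_mul_const, integral_div]
      have : ∫ u : unitInterval, (if (u : ℝ) < p then (1 : ℝ) else 0) = p := by
        have h4 : (fun u : unitInterval => if (u : ℝ) < p then (1 : ℝ) else 0) =
            Set.indicator (Set.Iio (⟨p, hp0.le, hp⟩ : unitInterval)) 1 := by
          ext u
          simp only [Set.indicator, Set.mem_Iio, ← Subtype.coe_lt_coe, Pi.one_apply]
        rw [h4, integral_indicator_one measurableSet_Iio, measureReal_def, unitInterval.volume_Iio]
        exact ENNReal.toReal_ofReal hp0.le
      rw [this, div_self hp0.ne', one_mul]
    · rw [← hp0] at h3 ⊢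
      have h5 : φ v = 0 := abs_nonpos_iff.1 h3
      simp [h5]
  · simp only [h1, if_false]
    simp

theorem mass_eq (M : Problem 𝒳) {S : Set 𝒳} (hS : MeasurableSet S) :
    M.mass S = M.dist.real (Prod.fst ⁻¹' S) := by
  unfold Problem.mass Problem.marginal
  rw [measureReal_def, measureReal_def, Measure.map_apply measurable_fst hS]

theorem restrict_dist [IsProbabilityMeasure M.dist] {S : Set 𝒳} :
    M.dist.restrict (Prod.fst ⁻¹' S) = M.dist (Prod.fst ⁻¹' S) • M.distOn S := by
  unfold Problem.distOn ProbabilityTheory.cond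
  rw [smul_smul]
  by_cases h : M.dist (Prod.fst ⁻¹' S) = 0
  · rw [h, zero_mul, zero_smul, Measure.restrict_eq_zero.2 h]
  · rw [ENNReal.mul_inv_cancel h (measure_ne_top _ _), one_smul]

theorem isProbabilityMeasure_distOn [IsProbabilityMeasure M.dist] {S : Set 𝒳}
    (h : M.dist (Prod.fst ⁻¹' S) ≠ 0) : IsProbabilityMeasure (M.distOn S) :=
  cond_isProbabilityMeasure h

/-- Hoeffding's lemma for a variable with values in `[-1, 1]`, whose variance proxy is one. -/
theorem lintegral_exp_weighted_le [IsProbabilityMeasure M.dist] {φ : 𝒳 × ℤˣ → ℝ}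
    (hφ : Measurable φ) (hφ1 : ∀ q, |φ q| ≤ 1) {p : 𝒳 → ℝ} (hp : Measurable p)
    (hp1 : ∀ x, p x ≤ 1) (ν : Measure (𝒳 × ℤˣ)) [IsProbabilityMeasure ν] (l : ℝ) :
    ∫⁻ e : Sample 𝒳, ENNReal.ofReal (Real.exp
      (l * (weighted φ (p e.1.1) e - ∫ v, φ v ∂ν) - l ^ 2 / 2)) ∂(ν.prod volume) ≤ 1 := by
  set W : Sample 𝒳 → ℝ := fun e => weighted φ (p e.1.1) e
  have hW : Measurable W := (measurable_weighted hφ).comp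
    ((hp.comp (measurable_fst.comp measurable_fst)).prodMk measurable_id)
  have hW1 : ∀ e, W e ∈ Set.Icc (-1 : ℝ) 1 := fun e => abs_le.1 (abs_weighted_le_one hφ1 _ e)
  have hWint : Integrable W (ν.prod volume) :=
    Integrable.of_mem_Icc (-1) 1 hW.aemeasurable (Filter.Eventually.of_forall hW1)
  have hmean : ∫ e, W e ∂(ν.prod volume) = ∫ v, φ v ∂ν := by
    rw [integral_prod _ hWint]
    exact integral_congr_ae (Filter.Eventually.of_forall fun v => integral_weighted φ (hp1 v.1) v)
  have hsub := hasSubgaussianMGF_of_mem_Icc (μ := ν.prod volume) hW.aemeasurable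
    (Filter.Eventually.of_forall hW1)
  rw [hmean] at hsub
  have hmgf := hsub.mgf_le l
  have hc : (((‖(1 : ℝ) - -1‖₊ / 2) ^ 2 : ℝ≥0) : ℝ) = 1 := by
    push_cast
    norm_num
  rw [hc, one_mul] at hmgf
  have hint := hsub.integrable_exp_mul l
  have heq : ∀ e : Sample 𝒳, Real.exp (l * (W e - ∫ v, φ v ∂ν) - l ^ 2 / 2) =
      Real.exp (l * (W e - ∫ v, φ v ∂ν)) * Real.exp (-(l ^ 2 / 2)) := by
    intro e; rw [← Real.exp_add]; ring_nf
  have heq' : ∀ e : Sample 𝒳, Real.exp (l * (weighted φ (p e.1.1) e - ∫ v, φ v ∂ν) - l ^ 2 / 2) =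
      Real.exp (l * (W e - ∫ v, φ v ∂ν)) * Real.exp (-(l ^ 2 / 2)) := heq
  simp only [heq']
  rw [← ofReal_integral_eq_lintegral_ofReal (hint.mul_const _)
    (Filter.Eventually.of_forall fun e => by positivity), integral_mul_const]
  refine ENNReal.ofReal_le_one.2 ?_
  calc _ ≤ Real.exp (l ^ 2 / 2) * Real.exp (-(l ^ 2 / 2)) :=
        mul_le_mul_of_nonneg_right hmgf (Real.exp_pos _).le
    _ = 1 := by rw [← Real.exp_add]; simp

theorem restrict_prod_volume [IsProbabilityMeasure M.dist] (S : Set 𝒳) :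
    (M.dist.prod (volume : Measure unitInterval)).restrict {e | e.1.1 ∈ S} =
      M.dist (Prod.fst ⁻¹' S) • (M.distOn S).prod volume := by
  have h1 : {e : Sample 𝒳 | e.1.1 ∈ S} = (Prod.fst ⁻¹' S) ×ˢ Set.univ := by ext e; simp
  rw [h1, ← Measure.prod_restrict, Measure.restrict_univ, restrict_dist, Measure.prod_smul_left]

theorem prod_volume_apply [IsProbabilityMeasure M.dist] (S : Set 𝒳) :
    (M.dist.prod (volume : Measure unitInterval)) {e | e.1.1 ∈ S} = M.dist (Prod.fst ⁻¹' S) := by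
  have h1 : {e : Sample 𝒳 | e.1.1 ∈ S} = (Prod.fst ⁻¹' S) ×ˢ Set.univ := by ext e; simp
  rw [h1, Measure.prod_prod, measure_univ, mul_one]

theorem measurableSet_fst_fst {S : Set 𝒳} (hS : MeasurableSet S) :
    MeasurableSet {e : Sample 𝒳 | e.1.1 ∈ S} :=
  (measurable_fst.comp measurable_fst) hS

open Classical in
/-- The conditional exponential moment of one term of a deviation on the region `S`. -/
theorem lintegral_exp_deviation_le [IsProbabilityMeasure M.dist] {φ : 𝒳 × ℤˣ → ℝ}
    (hφ : Measurable φ) (hφ1 : ∀ q, |φ q| ≤ 1) {p : 𝒳 → ℝ} (hp : Measurable p)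
    (hp1 : ∀ x, p x ≤ 1) {S : Set 𝒳} (hS : MeasurableSet S) (l : ℝ) :
    ∫⁻ e : Sample 𝒳, ENNReal.ofReal (Real.exp (if e.1.1 ∈ S then
      l * (weighted φ (p e.1.1) e - ∫ v, φ v ∂(M.distOn S)) - l ^ 2 / 2 else 0))
      ∂(M.dist.prod volume) ≤ 1 := by
  have hS' := measurableSet_fst_fst hS
  rw [← lintegral_add_compl _ hS']
  have h1 : ∫⁻ e in {e : Sample 𝒳 | e.1.1 ∈ S}, ENNReal.ofReal (Real.exp (if e.1.1 ∈ S then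
      l * (weighted φ (p e.1.1) e - ∫ v, φ v ∂(M.distOn S)) - l ^ 2 / 2 else 0))
      ∂(M.dist.prod volume) ≤ M.dist.prod volume {e : Sample 𝒳 | e.1.1 ∈ S} := by
    rw [setLIntegral_congr_fun hS' (g := fun e : Sample 𝒳 => ENNReal.ofReal (Real.exp
      (l * (weighted φ (p e.1.1) e - ∫ v, φ v ∂(M.distOn S)) - l ^ 2 / 2)))
      (fun e he => by
        have he' : e.1.1 ∈ S := he
        simp only [if_pos he']),
      restrict_prod_volume, lintegral_smul_measure, prod_volume_apply]
    by_cases h0 : M.dist (Prod.fst ⁻¹' S) = 0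
    · simp [h0]
    · have := isProbabilityMeasure_distOn h0
      exact mul_le_of_le_one_right' (lintegral_exp_weighted_le (M := M) hφ hφ1 hp hp1 _ l)
  have h2 : ∫⁻ e in {e : Sample 𝒳 | e.1.1 ∈ S}ᶜ, ENNReal.ofReal (Real.exp (if e.1.1 ∈ S then
      l * (weighted φ (p e.1.1) e - ∫ v, φ v ∂(M.distOn S)) - l ^ 2 / 2 else 0))
      ∂(M.dist.prod volume) = M.dist.prod volume {e : Sample 𝒳 | e.1.1 ∈ S}ᶜ := by
    rw [setLIntegral_congr_fun hS'.compl (g := fun _ => 1)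
      (fun e he => by
        have he' : ¬ e.1.1 ∈ S := he
        simp only [if_neg he', Real.exp_zero, ENNReal.ofReal_one])]
    simp
  rw [h2]
  refine (add_le_add_left h1 _).trans ?_
  rw [measure_add_measure_compl hS', measure_univ]

open Classical in
/-- The exponential moment of one term of a count of visits to the region `S`. -/
theorem lintegral_exp_visit_le [IsProbabilityMeasure M.dist] {S : Set 𝒳} (hS : MeasurableSet S) :
    ∫⁻ e : Sample 𝒳, ENNReal.ofReal (Real.exp (63 / 100 * M.mass S - if e.1.1 ∈ S then 1 else 0))
      ∂(M.dist.prod volume) ≤ 1 := by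
  have hS' := measurableSet_fst_fst hS
  have hq := mass_eq M hS
  set q := M.mass S
  have hq0 : 0 ≤ q := measureReal_nonneg
  have hq1 : q ≤ 1 := by rw [hq]; exact measureReal_le_one
  have hμ : M.dist.prod volume {e : Sample 𝒳 | e.1.1 ∈ S} = ENNReal.ofReal q := by
    rw [prod_volume_apply, hq, ofReal_measureReal]
  have hμc : M.dist.prod volume {e : Sample 𝒳 | e.1.1 ∈ S}ᶜ = ENNReal.ofReal (1 - q) := by
    rw [prob_compl_eq_one_sub hS', hμ, ENNReal.ofReal_sub _ hq0, ENNReal.ofReal_one]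
  rw [← lintegral_add_compl _ hS',
    setLIntegral_congr_fun hS' (g := fun _ => ENNReal.ofReal (Real.exp (63 / 100 * q - 1)))
      (fun e he => by
        have he' : e.1.1 ∈ S := he
        simp only [if_pos he']),
    setLIntegral_congr_fun hS'.compl (g := fun _ => ENNReal.ofReal (Real.exp (63 / 100 * q)))
      (fun e he => by
        have he' : ¬ e.1.1 ∈ S := he
        simp only [if_neg he', sub_zero]),
    setLIntegral_const, setLIntegral_const, hμ, hμc,
    ← ENNReal.ofReal_mul (Real.exp_pos _).le, ← ENNReal.ofReal_mul (Real.exp_pos _).le,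
    ← ENNReal.ofReal_add (by positivity) (mul_nonneg (Real.exp_pos _).le (by linarith))]
  refine ENNReal.ofReal_le_one.2 ?_
  -- The factor `63 / 100` is a lower bound for `1 - exp (-1)`: it gives `exp (-1) q + 1 - q ≤ 1 -
  -- 63/100 q ≤ exp (-63/100 q)`.
  have he : Real.exp (-1) ≤ 37 / 100 := by
    rw [Real.exp_neg, inv_le_comm₀ (Real.exp_pos _) (by norm_num)]
    have := Real.exp_one_gt_d9
    norm_num at this ⊢
    linarith
  have h1 : Real.exp (63 / 100 * q - 1) = Real.exp (63 / 100 * q) * Real.exp (-1) := by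
    rw [← Real.exp_add]; ring_nf
  have h2 : 1 - 63 / 100 * q ≤ Real.exp (-(63 / 100 * q)) := by
    have := Real.add_one_le_exp (-(63 / 100 * q)); linarith
  calc _ = Real.exp (63 / 100 * q) * (Real.exp (-1) * q + (1 - q)) := by rw [h1]; ring
    _ ≤ Real.exp (63 / 100 * q) * Real.exp (-(63 / 100 * q)) := by
        refine mul_le_mul_of_nonneg_left (le_trans ?_ h2) (Real.exp_pos _).le
        nlinarith
    _ = 1 := by rw [← Real.exp_add]; simp

end OneStep

end ARBAL

/-! ### Tail bounds for deviations, visit counts and collisions in a cell -/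

namespace ARBAL

section Visits

variable {D : ℕ} {𝒳 : Set (Fin D → ℝ)}

open Classical in
theorem sum_visits (z : ℕ → Sample 𝒳) (t : ℕ) (S : Set 𝒳) (f : ℕ → ℝ) :
    ∑ s ∈ visits z t S, f s =
      ∑ s ∈ Finset.range t, if (z (s + 1)).1.1 ∈ S then f (s + 1) else 0 := by
  unfold visits
  rw [Finset.sum_filter]
  induction t with
  | zero => simp
  | succ t ih => rw [Finset.sum_Icc_succ_top (by omega), ih, Finset.sum_range_succ]

open Classical in
theorem card_visits (z : ℕ → Sample 𝒳) (t : ℕ) (S : Set 𝒳) :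
    ((visits z t S).card : ℝ) =
      ∑ s ∈ Finset.range t, if (z (s + 1)).1.1 ∈ S then (1 : ℝ) else 0 := by
  rw [← sum_visits z t S fun _ => 1]
  simp

theorem card_visits_le (z : ℕ → Sample 𝒳) (t : ℕ) (S : Set 𝒳) : (visits z t S).card ≤ t := by
  classical
  unfold visits
  exact (Finset.card_filter_le _ _).trans (by simp)

theorem card_visits_univ (z : ℕ → Sample 𝒳) (t : ℕ) : (visits z t Set.univ).card = t := by
  classical
  simp [visits]

/-- The deviation of the importance-weighted sum of the test function `φ` on the region `S` after
round `t` from its expectation given the number of visits. -/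
noncomputable def deviation (M : Problem 𝒳) (z : ℕ → Sample 𝒳) (p : ℕ → ℝ) (φ : 𝒳 × ℤˣ → ℝ)
    (t : ℕ) (S : Set 𝒳) : ℝ :=
  ∑ s ∈ visits z t S, (weighted φ (p s) (z s) - ∫ v, φ v ∂(M.distOn S))

end Visits

section Tails

variable {D : ℕ} {𝒳 : Set (Fin D → ℝ)} {M : Problem 𝒳} [IsProbabilityMeasure M.dist]
  {Ω : Type*} {mΩ : MeasurableSpace Ω} {P : Measure Ω} [IsProbabilityMeasure P]
  {Z : ℕ → Ω → Sample 𝒳}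

-- Once the number `n` of visits is fixed, the exponential parameter `l = √(2σ/n)` is deterministic
-- and optimal: `l √(2σn) - n l²/2 = σ`. Rounds outside `S` contribute the exponent zero.
open Classical in
theorem measure_deviation_le_of_card (hZ : ∀ t, Measurable (Z t)) (hind : iIndepFun Z P)
    (hlaw : ∀ t, P.map (Z t) = M.dist.prod volume)
    {r : ℕ → Ω → 𝒳 → ℝ}
    (hr : ∀ t, Measurable[(past Z t).prod inferInstance] fun q : Ω × 𝒳 => r t q.1 q.2)
    (hr1 : ∀ t ω x, r t ω x ≤ 1) {φ : 𝒳 × ℤˣ → ℝ} (hφ : Measurable φ) (hφ1 : ∀ q, |φ q| ≤ 1)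
    {S : Set 𝒳} (hS : MeasurableSet S) {σ : ℝ} (hσ : 0 ≤ σ) (t n : ℕ) (hn : n ≠ 0) :
    P {ω | (visits (fun s => Z s ω) t S).card = n ∧ √(2 * σ * n) ≤
      deviation M (fun s => Z s ω) (fun s => r (s - 1) ω (Z s ω).1.1) φ t S} ≤
      ENNReal.ofReal (Real.exp (-σ)) := by
  have hn' : (0 : ℝ) < n := by exact_mod_cast Nat.pos_of_ne_zero hn
  set l := √(2 * σ / n)
  have hl2 : l ^ 2 = 2 * σ / n := Real.sq_sqrt (by positivity)
  have hln : l * √(2 * σ * n) = 2 * σ := by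
    rw [← Real.sqrt_mul (by positivity), show 2 * σ / n * (2 * σ * n) = (2 * σ) ^ 2 by
      field_simp, Real.sqrt_sq (by positivity)]
  set X : ℕ → Ω × Sample 𝒳 → ℝ := fun t q => if q.2.1.1 ∈ S then
      l * (weighted φ (r t q.1 q.2.1.1) q.2 - ∫ v, φ v ∂(M.distOn S)) - l ^ 2 / 2 else 0
  have hX : ∀ t, Measurable[(past Z t).prod inferInstance] (X t) := by
    intro t
    let _ := past Z t
    have h1 : Measurable fun q : Ω × Sample 𝒳 => r t q.1 q.2.1.1 :=
      (hr t).comp (measurable_fst.prodMk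
        (measurable_fst.comp (measurable_fst.comp measurable_snd)))
    exact Measurable.ite ((measurable_fst.comp (measurable_fst.comp measurable_snd)) hS)
      (((((measurable_weighted hφ).comp (h1.prodMk measurable_snd)).sub_const _).const_mul
        l).sub_const _) measurable_const
  refine (measure_mono ?_).trans (measure_le_sum_le hZ hind hlaw hX
    (fun t ω => ?_) t σ)
  · rintro ω ⟨h1, h2⟩
    change σ ≤ ∑ s ∈ Finset.range t, X s (ω, Z (s + 1) ω)
    have h3 : ∑ s ∈ Finset.range t, X s (ω, Z (s + 1) ω) =
        l * deviation M (fun s => Z s ω) (fun s => r (s - 1) ω (Z s ω).1.1) φ t S -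
          l ^ 2 / 2 * n := by
      have h4 := card_visits (fun s => Z s ω) t S
      rw [h1] at h4
      rw [deviation, sum_visits, h4, Finset.mul_sum, Finset.mul_sum, ← Finset.sum_sub_distrib]
      refine Finset.sum_congr rfl fun s _ => ?_
      simp only [X, Nat.add_sub_cancel]
      split_ifs <;> ring
    rw [h3, hl2]
    have h5 : l * √(2 * σ * n) ≤ l * deviation M (fun s => Z s ω)
        (fun s => r (s - 1) ω (Z s ω).1.1) φ t S := mul_le_mul_of_nonneg_left h2 (Real.sqrt_nonneg _)
    have h6 : 2 * σ / n / 2 * n = σ := by field_simp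
    rw [h6]
    linarith
  · have h1 : Measurable fun x => r t ω x :=
      (hr t).comp (@measurable_prodMk_left _ _ (past Z t) _ ω)
    exact lintegral_exp_deviation_le hφ hφ1 h1 (hr1 t ω) hS l

/-- With high probability, the deviation of a test function on a region is at most `√(2 σ N)` in
every round, `N` being the number of visits. -/
theorem measure_deviation_le (hZ : ∀ t, Measurable (Z t)) (hind : iIndepFun Z P)
    (hlaw : ∀ t, P.map (Z t) = M.dist.prod volume)
    {r : ℕ → Ω → 𝒳 → ℝ}
    (hr : ∀ t, Measurable[(past Z t).prod inferInstance] fun q : Ω × 𝒳 => r t q.1 q.2)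
    (hr1 : ∀ t ω x, r t ω x ≤ 1) {φ : 𝒳 × ℤˣ → ℝ} (hφ : Measurable φ) (hφ1 : ∀ q, |φ q| ≤ 1)
    {S : Set 𝒳} (hS : MeasurableSet S) {σ : ℝ} (hσ : 0 ≤ σ) (T : ℕ) :
    P {ω | ∃ t ≤ T, √(2 * σ * (visits (fun s => Z s ω) t S).card) <
      deviation M (fun s => Z s ω) (fun s => r (s - 1) ω (Z s ω).1.1) φ t S} ≤
      T * (T * ENNReal.ofReal (Real.exp (-σ))) := by
  have hsub : {ω | ∃ t ≤ T, √(2 * σ * (visits (fun s => Z s ω) t S).card) <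
      deviation M (fun s => Z s ω) (fun s => r (s - 1) ω (Z s ω).1.1) φ t S} ⊆
      ⋃ t ∈ Finset.Icc 1 T, ⋃ n ∈ Finset.Icc 1 T,
        {ω | (visits (fun s => Z s ω) t S).card = n ∧ √(2 * σ * n) ≤
          deviation M (fun s => Z s ω) (fun s => r (s - 1) ω (Z s ω).1.1) φ t S} := by
    rintro ω ⟨t, htT, h⟩
    have hle := card_visits_le (fun s => Z s ω) t S
    -- Without visits the deviation is an empty sum, so `n = 0` never needs a bound.
    have hne : (visits (fun s => Z s ω) t S).card ≠ 0 := by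
      intro h0
      rw [Finset.card_eq_zero] at h0
      simp [deviation, h0] at h
    simp only [Set.mem_iUnion, Finset.mem_Icc]
    exact ⟨t, ⟨by omega, htT⟩, _, ⟨by omega, by omega⟩, rfl, h.le⟩
  refine (measure_mono hsub).trans ((measure_biUnion_finset_le _ _).trans ?_)
  refine (Finset.sum_le_card_nsmul _ _ (T * ENNReal.ofReal (Real.exp (-σ)))
    fun t _ => ?_).trans (by simp)
  refine (measure_biUnion_finset_le _ _).trans ?_
  refine (Finset.sum_le_card_nsmul _ _ (ENNReal.ofReal (Real.exp (-σ)))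
    fun n hn => ?_).trans (by simp)
  exact measure_deviation_le_of_card hZ hind hlaw hr hr1 hφ hφ1 hS hσ t n
    (by have := Finset.mem_Icc.1 hn; omega)

open Classical in
/-- With high probability, a region is visited often in the rounds `a + 1, …, b`. -/
theorem measure_visits_le (hZ : ∀ t, Measurable (Z t)) (hind : iIndepFun Z P)
    (hlaw : ∀ t, P.map (Z t) = M.dist.prod volume)
    {S : Set 𝒳} (hS : MeasurableSet S) (σ : ℝ) {a b : ℕ} (hab : a ≤ b) :
    P {ω | ((visits (fun s => Z s ω) b S).card : ℝ) - (visits (fun s => Z s ω) a S).card ≤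
      63 / 100 * M.mass S * (b - a) - σ} ≤ ENNReal.ofReal (Real.exp (-σ)) := by
  -- Rounds up to `a` get the exponent zero, so that one supermartingale over `b` rounds counts the
  -- visits in the window.
  set X : ℕ → Ω × Sample 𝒳 → ℝ := fun t q => if t < a then 0 else
    63 / 100 * M.mass S - if q.2.1.1 ∈ S then 1 else 0
  have hX : ∀ t, Measurable[(past Z t).prod inferInstance] (X t) := by
    intro t
    let _ := past Z t
    by_cases h : t < a
    · simp only [X, if_pos h]
      exact measurable_const
    · simp only [X, if_neg h]
      exact (Measurable.ite ((measurable_fst.comp (measurable_fst.comp measurable_snd)) hS)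
        measurable_const measurable_const).const_sub _
  refine (measure_mono ?_).trans (measure_le_sum_le hZ hind hlaw hX (fun t ω => ?_) b σ)
  · intro ω hω
    have hω' : ((visits (fun s => Z s ω) b S).card : ℝ) - (visits (fun s => Z s ω) a S).card ≤
      63 / 100 * M.mass S * (b - a) - σ := hω
    change σ ≤ ∑ s ∈ Finset.range b, X s (ω, Z (s + 1) ω)
    rw [card_visits, card_visits, ← Finset.sum_range_add_sum_Ico _ hab, add_sub_cancel_left] at hω'
    rw [← Finset.sum_range_add_sum_Ico _ hab]
    have h1 : ∑ s ∈ Finset.range a, X s (ω, Z (s + 1) ω) = 0 :=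
      Finset.sum_eq_zero fun s hs => if_pos (Finset.mem_range.1 hs)
    have h2 : ∑ s ∈ Finset.Ico a b, X s (ω, Z (s + 1) ω) = ∑ s ∈ Finset.Ico a b,
        (63 / 100 * M.mass S - if (Z (s + 1) ω).1.1 ∈ S then 1 else 0) :=
      Finset.sum_congr rfl fun s hs => if_neg (not_lt.2 (Finset.mem_Ico.1 hs).1)
    rw [h1, h2, Finset.sum_sub_distrib, Finset.sum_const, Nat.card_Ico, nsmul_eq_mul,
      Nat.cast_sub hab]
    linarith
  · by_cases h : t < a
    · simp only [X, if_pos h]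
      simp
    · simp only [X, if_neg h]
      exact lintegral_exp_visit_le hS

/-- With high probability, no two sample points lie in the same cell of a fine grid. -/
theorem measure_not_separates_le (hZ : ∀ t, Measurable (Z t)) (hind : iIndepFun Z P)
    (hlaw : ∀ t, P.map (Z t) = M.dist.prod volume) {G : Fin D → Finset ℝ} {η : ℝ}
    (hG : ∀ d a, M.marginal.real {x : 𝒳 | x.1 d ∈ cell (G d) a} ≤ η) (T : ℕ) :
    P {ω | ¬ Separates G (fun s => (Z s ω).1.1) T} ≤ D * (T * (T * ENNReal.ofReal η)) := by
  have := marginal_isProbabilityMeasure M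
  have hpair : ∀ d i j, i ≠ j → P {ω | (Z j ω).1.1.1 d ∈ cell (G d) ((Z i ω).1.1.1 d)} ≤
      ENNReal.ofReal η := by
    intro d i j hij
    have hc : Measurable fun e : Sample 𝒳 => e.1.1.1 d :=
      (measurable_coord d).comp (measurable_fst.comp measurable_fst)
    have hC : MeasurableSet {q : Sample 𝒳 × Sample 𝒳 | q.2.1.1.1 d ∈ cell (G d) (q.1.1.1.1 d)} :=
      ((hc.comp measurable_fst).prodMk (hc.comp measurable_snd)) (measurableSet_cell_prod (G d))
    have h1 := lintegral_indepFun (hZ i) (hZ j) (hind.indepFun hij)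
      ((measurable_const (a := (1 : ℝ≥0∞))).indicator hC)
    have h2 : ∫⁻ ω, Set.indicator {q : Sample 𝒳 × Sample 𝒳 |
        q.2.1.1.1 d ∈ cell (G d) (q.1.1.1.1 d)} (fun _ => (1 : ℝ≥0∞)) (Z i ω, Z j ω) ∂P =
        P {ω | (Z j ω).1.1.1 d ∈ cell (G d) ((Z i ω).1.1.1 d)} := by
      exact Eq.trans (lintegral_congr fun _ => rfl)
        (lintegral_indicator_one (((hZ i).prodMk (hZ j)) hC))
    rw [← h2, h1]
    refine (lintegral_mono (g := fun _ => ENNReal.ofReal η) fun ω => ?_).trans (by simp)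
    have h3 : ∫⁻ e, Set.indicator {q : Sample 𝒳 × Sample 𝒳 |
        q.2.1.1.1 d ∈ cell (G d) (q.1.1.1.1 d)} (fun _ => (1 : ℝ≥0∞)) (Z i ω, e) ∂(P.map (Z j)) =
        (M.dist.prod volume) {e : Sample 𝒳 | e.1.1 ∈ {x : 𝒳 | x.1 d ∈
          cell (G d) ((Z i ω).1.1.1 d)}} := by
      rw [hlaw]
      exact Eq.trans (lintegral_congr fun _ => rfl)
        (lintegral_indicator_one (s := {e : Sample 𝒳 | e.1.1 ∈ {x : 𝒳 | x.1 d ∈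
          cell (G d) ((Z i ω).1.1.1 d)}}) (hc (measurableSet_cell (G d) _)))
    simp only
    rw [h3, prod_volume_apply, ← ENNReal.ofReal_toReal (measure_ne_top M.dist _)]
    refine ENNReal.ofReal_le_ofReal ?_
    refine le_trans (le_of_eq ?_) (hG d ((Z i ω).1.1.1 d))
    exact (mass_eq M ((measurable_coord d) (measurableSet_cell (G d) _))).symm
  have hsub : {ω | ¬ Separates G (fun s => (Z s ω).1.1) T} ⊆
      ⋃ d ∈ (Finset.univ : Finset (Fin D)), ⋃ i ∈ Finset.Icc 1 T, ⋃ j ∈ Finset.Icc 1 T,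
        {ω | i ≠ j ∧ (Z j ω).1.1.1 d ∈ cell (G d) ((Z i ω).1.1.1 d)} := by
    intro ω hω
    have hω' : ¬ Separates G (fun s => (Z s ω).1.1) T := hω
    unfold Separates at hω'
    push Not at hω'
    obtain ⟨d, i, hi, j, hj, hij, h⟩ := hω'
    simp only [Set.mem_iUnion]
    exact ⟨d, Finset.mem_univ _, i, hi, j, hj, hij, h⟩
  refine (measure_mono hsub).trans ((measure_biUnion_finset_le _ _).trans ?_)
  refine (Finset.sum_le_card_nsmul _ _ (T * (T * ENNReal.ofReal η))
    fun d _ => ?_).trans (by simp)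
  refine (measure_biUnion_finset_le _ _).trans ?_
  refine (Finset.sum_le_card_nsmul _ _ (T * ENNReal.ofReal η) fun i _ => ?_).trans (by simp)
  refine (measure_biUnion_finset_le _ _).trans ?_
  refine (Finset.sum_le_card_nsmul _ _ (ENNReal.ofReal η) fun j _ => ?_).trans (by simp)
  by_cases hij : i = j
  · simp [hij]
  · simpa [hij] using hpair d i j hij

end Tails

end ARBAL

/-! ### Measurability of empirical risks, their minimizers and the gap -/

namespace ARBAL

section Measurability

/-- The discrete choices of the algorithm (a region index, a hypothesis, a coordinate) have
countably many outcomes; gluing over them reduces measurability to the case of fixed choices. -/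
theorem measurable_of_cover {ι α β : Type*} [Countable ι] [MeasurableSpace α] [MeasurableSpace β]
    {f : α → β} (C : ι → Set α) (g : ι → α → β) (hC : ∀ i, MeasurableSet (C i))
    (hg : ∀ i, Measurable (g i)) (hcover : ∀ x, ∃ i, x ∈ C i)
    (hfg : ∀ i, ∀ x ∈ C i, f x = g i x) : Measurable f := by
  intro t ht
  have : f ⁻¹' t = ⋃ i, C i ∩ g i ⁻¹' t := by
    ext x
    simp only [Set.mem_preimage, Set.mem_iUnion, Set.mem_inter_iff]
    constructor
    · intro h
      obtain ⟨i, hi⟩ := hcover x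
      exact ⟨i, hi, hfg i x hi ▸ h⟩
    · rintro ⟨i, hi, h⟩
      rw [hfg i x hi]
      exact h
  rw [this]
  exact MeasurableSet.iUnion fun i => (hC i).inter (hg i ht)

variable {D : ℕ} {𝒳 : Set (Fin D → ℝ)} {M : Problem 𝒳} {A : Params 𝒳}
  {Ω : Type*} [MeasurableSpace Ω]

/-- The losses of the hypotheses are measurable. -/
def Problem.MeasurableLoss (M : Problem 𝒳) : Prop :=
  ∀ h ∈ M.H, Measurable fun v : 𝒳 × ℤˣ => M.loss (h v.1) v.2

/-- A random region is measurable. -/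
def MeasurableRegion (S : Ω → Set 𝒳) : Prop := MeasurableSet {q : Ω × 𝒳 | q.2 ∈ S q.1}

/-- The loss of a random predictor is measurable. -/
def Problem.MeasurablePredictor (M : Problem 𝒳) (F : Ω → 𝒳 → ℝ) : Prop :=
  Measurable fun q : Ω × (𝒳 × ℤˣ) => M.loss (F q.1 q.2.1) q.2.2

theorem Problem.MeasurableLoss.const (hM : M.MeasurableLoss) {h : 𝒳 → ℝ} (hh : h ∈ M.H) :
    M.MeasurablePredictor fun _ : Ω => h := (hM h hh).comp measurable_snd

theorem MeasurableRegion.comp {S : Ω → Set 𝒳} (hS : MeasurableRegion S) {x : Ω → 𝒳}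
    (hx : Measurable x) : MeasurableSet {ω | x ω ∈ S ω} :=
  (measurable_id.prodMk hx) hS

theorem MeasurableRegion.mass [IsProbabilityMeasure M.dist] {S : Ω → Set 𝒳}
    (hS : MeasurableRegion S) : Measurable fun ω => M.mass (S ω) := by
  have := marginal_isProbabilityMeasure M
  exact (measurable_measure_prodMk_left (ν := M.marginal) hS).ennreal_toReal

theorem measurable_random_coord {d : Ω → Fin D} (hd : Measurable d) :
    Measurable fun q : Ω × 𝒳 => q.2.1 (d q.1) :=
  measurable_of_cover (fun i : Fin D => {q : Ω × 𝒳 | d q.1 = i}) (fun i q => q.2.1 i)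
    (fun i => (hd.comp measurable_fst) (measurableSet_singleton i))
    (fun i => (measurable_coord i).comp measurable_snd) (fun q => ⟨d q.1, rfl⟩)
    (fun i q hq => by rw [show d q.1 = i from hq])

theorem MeasurableRegion.leftPart {S : Ω → Set 𝒳} (hS : MeasurableRegion S) {d : Ω → Fin D}
    (hd : Measurable d) {c : Ω → ℝ} (hc : Measurable c) :
    MeasurableRegion fun ω => leftPart (S ω) (d ω) (c ω) :=
  hS.inter (measurableSet_le (measurable_random_coord hd) (hc.comp measurable_fst))

theorem MeasurableRegion.rightPart {S : Ω → Set 𝒳} (hS : MeasurableRegion S) {d : Ω → Fin D}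
    (hd : Measurable d) {c : Ω → ℝ} (hc : Measurable c) :
    MeasurableRegion fun ω => rightPart (S ω) (d ω) (c ω) :=
  hS.inter (measurableSet_lt (hc.comp measurable_fst) (measurable_random_coord hd))

theorem measurable_card_visits {z : ℕ → Ω → Sample 𝒳} {t : ℕ}
    (hz : ∀ s, 1 ≤ s → s ≤ t → Measurable (z s)) {S : Ω → Set 𝒳} (hS : MeasurableRegion S) :
    Measurable fun ω => ((visits (fun s => z s ω) t (S ω)).card : ℝ) := by
  classical
  simp only [card_visits]
  refine Finset.measurable_sum _ fun s hs => Measurable.ite (hS.comp ?_) measurable_const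
    measurable_const
  have hs' := Finset.mem_range.1 hs
  exact measurable_fst.comp (measurable_fst.comp (hz _ (by omega) (by omega)))

theorem measurable_empRisk {z : ℕ → Ω → Sample 𝒳} {t : ℕ}
    (hz : ∀ s, 1 ≤ s → s ≤ t → Measurable (z s)) {p : ℕ → Ω → ℝ} (hp : ∀ s, Measurable (p s))
    {S : Ω → Set 𝒳} (hS : MeasurableRegion S) {F : Ω → 𝒳 → ℝ} (hF : M.MeasurablePredictor F) :
    Measurable fun ω => empRisk M (fun s => z s ω) (fun s => p s ω) t (S ω) (F ω) := by
  classical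
  unfold empRisk
  refine Measurable.div ?_ (measurable_card_visits hz hS)
  simp only [sum_visits]
  refine Finset.measurable_sum _ fun s hs => ?_
  have hs' := Finset.mem_range.1 hs
  have hzs := hz (s + 1) (by omega) (by omega)
  refine Measurable.ite (hS.comp (measurable_fst.comp (measurable_fst.comp hzs))) ?_
    measurable_const
  refine Measurable.mul (Measurable.div ?_ (hp _)) ?_
  · unfold coin
    exact Measurable.ite (measurableSet_lt
      (measurable_subtype_coe.comp (measurable_snd.comp hzs)) (hp _)) measurable_const
      measurable_const
  · exact hF.comp (measurable_id.prodMk (measurable_fst.comp hzs))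

theorem combine_of_mem_left {S T : Set 𝒳} {f g : 𝒳 → ℝ} {x : 𝒳} (h : x ∈ S) (h' : x ∉ T) :
    combine S T f g x = f x := by simp [combine, h, h']

theorem combine_of_mem_right {S T : Set 𝒳} {f g : 𝒳 → ℝ} {x : 𝒳} (h : x ∉ S) (h' : x ∈ T) :
    combine S T f g x = g x := by simp [combine, h, h']

theorem measurablePredictor_combine (hM : M.MeasurableLoss) {S T : Ω → Set 𝒳}
    (hS : MeasurableRegion S) (hT : MeasurableRegion T) (hST : ∀ ω, Disjoint (S ω) (T ω))
    {f g : 𝒳 → ℝ} (hf : f ∈ M.H) (hg : g ∈ M.H) :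
    M.MeasurablePredictor fun ω => combine (S ω) (T ω) f g := by
  classical
  have hpr : Measurable fun q : Ω × (𝒳 × ℤˣ) => (q.1, q.2.1) :=
    measurable_fst.prodMk (measurable_fst.comp measurable_snd)
  have h0 : Measurable fun q : Ω × (𝒳 × ℤˣ) => M.loss 0 q.2.2 :=
    (measurable_of_countable fun y : ℤˣ => M.loss 0 y).comp (measurable_snd.comp measurable_snd)
  have h : Measurable fun q : Ω × (𝒳 × ℤˣ) => if q.2.1 ∈ S q.1 then M.loss (f q.2.1) q.2.2 else
      if q.2.1 ∈ T q.1 then M.loss (g q.2.1) q.2.2 else M.loss 0 q.2.2 :=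
    Measurable.ite (hpr hS) ((hM f hf).comp measurable_snd)
      (Measurable.ite (hpr hT) ((hM g hg).comp measurable_snd) h0)
  refine Eq.mp (congrArg (fun F : Ω × (𝒳 × ℤˣ) → ℝ => Measurable F) (funext fun q => ?_)) h
  have hd := Set.disjoint_left.1 (hST q.1)
  beta_reduce
  by_cases h1 : q.2.1 ∈ S q.1
  · have h2 : q.2.1 ∉ T q.1 := fun h2 => hd h1 h2
    rw [if_pos h1, combine_of_mem_left h1 h2]
  · by_cases h2 : q.2.1 ∈ T q.1
    · rw [if_neg h1, if_pos h2, combine_of_mem_right h1 h2]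
    · rw [if_neg h1, if_neg h2]
      simp [combine, h1, h2]

theorem erm_isERM (hne : M.H.Nonempty) (z : ℕ → Sample 𝒳) (p : ℕ → ℝ) (t : ℕ) (S : Set 𝒳) :
    IsERM M z p t M.H S (erm M z p t S) := by
  obtain ⟨h, hh, hmin⟩ := M.H.exists_min_image (empRisk M z p t S) hne
  exact Classical.epsilon_spec (p := IsERM M z p t M.H S) ⟨h, hh, hmin⟩

theorem measurableSet_isERM (hM : M.MeasurableLoss) {z : ℕ → Ω → Sample 𝒳} {t : ℕ}
    (hz : ∀ s, 1 ≤ s → s ≤ t → Measurable (z s)) {p : ℕ → Ω → ℝ} (hp : ∀ s, Measurable (p s))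
    {S : Ω → Set 𝒳} (hS : MeasurableRegion S) {h : 𝒳 → ℝ} (hh : h ∈ M.H) :
    MeasurableSet {ω | IsERM M (fun s => z s ω) (fun s => p s ω) t M.H (S ω) h} := by
  have : {ω | IsERM M (fun s => z s ω) (fun s => p s ω) t M.H (S ω) h} =
      ⋂ g ∈ M.H, {ω | empRisk M (fun s => z s ω) (fun s => p s ω) t (S ω) h ≤
        empRisk M (fun s => z s ω) (fun s => p s ω) t (S ω) g} := by
    ext ω
    simp [IsERM, hh]
  rw [this]
  exact Finset.measurableSet_biInter _ fun g hg => measurableSet_le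
    (measurable_empRisk hz hp hS (hM.const hh)) (measurable_empRisk hz hp hS (hM.const hg))

/-- The choice of the empirical risk minimizer depends on the set of all minimizers only. -/
theorem measurableSet_erm_eq (hM : M.MeasurableLoss)
    {z : ℕ → Ω → Sample 𝒳} {t : ℕ} (hz : ∀ s, 1 ≤ s → s ≤ t → Measurable (z s))
    {p : ℕ → Ω → ℝ} (hp : ∀ s, Measurable (p s)) {S : Ω → Set 𝒳} (hS : MeasurableRegion S)
    (h : 𝒳 → ℝ) :
    MeasurableSet {ω | erm M (fun s => z s ω) (fun s => p s ω) t (S ω) = h} := by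
  classical
  -- The set of minimizers is one of finitely many subsets `V` of `H`, and `Classical.epsilon` sees
  -- nothing but this set.
  have : {ω | erm M (fun s => z s ω) (fun s => p s ω) t (S ω) = h} =
      ⋃ V ∈ M.H.powerset.filter (fun V => Classical.epsilon (fun f => f ∈ V) = h),
        ⋂ g ∈ M.H, {ω | IsERM M (fun s => z s ω) (fun s => p s ω) t M.H (S ω) g ↔ g ∈ V} := by
    ext ω
    simp only [Set.mem_iUnion, Set.mem_iInter, Finset.mem_filter, Finset.mem_powerset,
      exists_prop]
    constructor
    · intro hω
      refine ⟨M.H.filter (IsERM M (fun s => z s ω) (fun s => p s ω) t M.H (S ω)),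
        ⟨Finset.filter_subset _ _, ?_⟩, fun g hg => ?_⟩
      · rw [← show erm M (fun s => z s ω) (fun s => p s ω) t (S ω) = h from hω]
        unfold erm
        congr 1
        ext f
        rw [Finset.mem_filter]
        exact ⟨fun hf => hf.2, fun hf => ⟨hf.1, hf⟩⟩
      · change _ ↔ _
        rw [Finset.mem_filter]
        exact ⟨fun hf => ⟨hg, hf⟩, fun hf => hf.2⟩
    · rintro ⟨V, ⟨hV, hVh⟩, hω⟩
      change erm M (fun s => z s ω) (fun s => p s ω) t (S ω) = h
      rw [← hVh]
      unfold erm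
      congr 1
      ext f
      exact ⟨fun hf => (hω f hf.1).1 hf, fun hf => (hω f (hV hf)).2 hf⟩
  rw [this]
  refine Finset.measurableSet_biUnion _ fun V _ => Finset.measurableSet_biInter _ fun g hg => ?_
  have h1 := measurableSet_isERM hM hz hp hS hg
  by_cases hgV : g ∈ V
  · simpa [hgV] using h1
  · convert h1.compl using 1
    ext ω
    exact iff_false_right hgV

theorem disjoint_leftPart_rightPart (S : Set 𝒳) (d : Fin D) (c : ℝ) :
    Disjoint (leftPart S d c) (rightPart S d c) :=
  Set.disjoint_left.2 fun _ h1 h2 => absurd h2.2 (not_lt.2 h1.2)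

theorem measurable_gap [IsProbabilityMeasure M.dist] (hM : M.MeasurableLoss)
    (hne : M.H.Nonempty) {z : ℕ → Ω → Sample 𝒳} {t : ℕ}
    (hz : ∀ s, 1 ≤ s → s ≤ t → Measurable (z s)) {p : ℕ → Ω → ℝ} (hp : ∀ s, Measurable (p s))
    {S : Ω → Set 𝒳} (hS : MeasurableRegion S) {d : Ω → Fin D} (hd : Measurable d)
    {c : Ω → ℝ} (hc : Measurable c) :
    Measurable fun ω => gap M A (fun s => z s ω) (fun s => p s ω) t (S ω) (d ω) (c ω) := by
  have hL := hS.leftPart hd hc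
  have hR := hS.rightPart hd hc
  unfold gap
  refine hS.mass.mul (Measurable.sub (Measurable.sub ?_ ?_) ?_)
  · exact measurable_of_cover
      (fun h : M.H => {ω | erm M (fun s => z s ω) (fun s => p s ω) t (S ω) = h.1})
      (fun h ω => empRisk M (fun s => z s ω) (fun s => p s ω) t (S ω) h.1)
      (fun h => measurableSet_erm_eq hM hz hp hS h.1)
      (fun h => measurable_empRisk hz hp hS (hM.const h.2))
      (fun ω => ⟨⟨_, (erm_isERM hne _ _ _ _).1⟩, rfl⟩)
      (fun h ω hω => by rw [show _ = h.1 from hω])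
  · refine measurable_of_cover
      (fun h : M.H × M.H =>
        {ω | erm M (fun s => z s ω) (fun s => p s ω) t (ARBAL.leftPart (S ω) (d ω) (c ω)) = h.1.1} ∩
        {ω | erm M (fun s => z s ω) (fun s => p s ω) t (ARBAL.rightPart (S ω) (d ω) (c ω)) = h.2.1})
      (fun h ω => empRisk M (fun s => z s ω) (fun s => p s ω) t (S ω)
        (combine (ARBAL.leftPart (S ω) (d ω) (c ω)) (ARBAL.rightPart (S ω) (d ω) (c ω)) h.1.1 h.2.1))
      (fun h => (measurableSet_erm_eq hM hz hp hL h.1.1).inter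
        (measurableSet_erm_eq hM hz hp hR h.2.1))
      (fun h => measurable_empRisk hz hp hS (measurablePredictor_combine hM hL hR
        (fun _ => disjoint_leftPart_rightPart _ _ _) h.1.2 h.2.2))
      (fun ω => ⟨(⟨_, (erm_isERM hne _ _ _ _).1⟩, ⟨_, (erm_isERM hne _ _ _ _).1⟩), rfl, rfl⟩)
      (fun h ω hω => ?_)
    rw [show _ = h.1.1 from hω.1, show _ = h.2.1 from hω.2]
  · exact ((measurable_card_visits hz hS).const_div _).sqrt

end Measurability

end ARBAL

/-! ### Measurability of the run with respect to its past -/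

namespace ARBAL

section MeasurableRun

variable {D : ℕ} {𝒳 : Set (Fin D → ℝ)} {M : Problem 𝒳} {A : Params 𝒳}
  {Ω : Type*} [MeasurableSpace Ω]

/-- A random state is measurable, and its regions form a partition. -/
structure MeasurableState (M : Problem 𝒳) (st : Ω → State 𝒳) : Prop where
  K : Measurable fun ω => (st ω).K
  region : ∀ k, MeasurableRegion fun ω => (st ω).region k
  hyp : ∀ k h, MeasurableSet {ω | h ∈ (st ω).hyp k}
  p : ∀ s, Measurable fun ω => (st ω).p s
  partition : ∀ ω, (st ω).Partition
  subset : ∀ ω k, (st ω).hyp k ⊆ M.H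

theorem measurableRegion_random {R : Ω → ℕ → Set 𝒳} (hR : ∀ k, MeasurableRegion fun ω => R ω k)
    {j : Ω → ℕ} (hj : Measurable j) : MeasurableRegion fun ω => R ω (j ω) := by
  have : {q : Ω × 𝒳 | q.2 ∈ R q.1 (j q.1)} =
      ⋃ k, {q : Ω × 𝒳 | j q.1 = k} ∩ {q : Ω × 𝒳 | q.2 ∈ R q.1 k} := by
    ext q
    simp only [Set.mem_iUnion, Set.mem_inter_iff]
    constructor
    · intro h
      exact ⟨j q.1, rfl, h⟩
    · rintro ⟨k, rfl, h⟩
      exact h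
  unfold MeasurableRegion
  rw [this]
  exact MeasurableSet.iUnion fun k =>
    ((hj.comp measurable_fst) (measurableSet_singleton k)).inter (hR k)

theorem MeasurableState.index {st : Ω → State 𝒳} (h : MeasurableState M st) :
    Measurable fun q : Ω × 𝒳 => (st q.1).index q.2 := by
  refine measurable_to_countable' fun k => ?_
  have : (fun q : Ω × 𝒳 => (st q.1).index q.2) ⁻¹' {k} =
      {q : Ω × 𝒳 | k < (st q.1).K} ∩ {q : Ω × 𝒳 | q.2 ∈ (st q.1).region k} := by
    ext q
    simp only [Set.mem_preimage, Set.mem_singleton_iff, Set.mem_inter_iff]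
    constructor
    · rintro rfl
      exact (h.partition q.1).index_spec q.2
    · rintro ⟨h1, h2⟩
      exact (h.partition q.1).index_eq h1 h2
  rw [this]
  exact (measurableSet_lt measurable_const (h.K.comp measurable_fst)).inter (h.region k)

theorem MeasurableState.hyp_eq {st : Ω → State 𝒳} (h : MeasurableState M st) (k : ℕ)
    (V : Finset (𝒳 → ℝ)) : MeasurableSet {ω | (st ω).hyp k = V} := by
  classical
  have : {ω | (st ω).hyp k = V} = ⋂ f ∈ M.H ∪ V, {ω | f ∈ (st ω).hyp k ↔ f ∈ V} := by
    ext ω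
    simp only [Set.mem_iInter]
    constructor
    · intro hω f _
      change _ ↔ _
      rw [show (st ω).hyp k = V from hω]
    · intro hω
      change (st ω).hyp k = V
      ext f
      by_cases hf : f ∈ M.H ∪ V
      · exact hω f hf
      · rw [Finset.mem_union, not_or] at hf
        exact iff_of_false (fun h' => hf.1 (h.subset ω k h')) hf.2
  rw [this]
  refine Finset.measurableSet_biInter _ fun f _ => ?_
  by_cases hf : f ∈ V
  · simpa [hf] using h.hyp k f
  · convert (h.hyp k f).compl using 1
    ext ω
    exact iff_false_right hf

theorem measurable_reqProb (hM : M.MeasurableLoss) {V : Finset (𝒳 → ℝ)} (hV : V ⊆ M.H) :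
    Measurable (M.reqProb V) := by
  unfold Problem.reqProb
  refine Measurable.iSup fun q => ?_
  exact ((hM _ (hV q.1.2)).comp (measurable_id.prodMk measurable_const)).sub
    ((hM _ (hV q.2.1.2)).comp (measurable_id.prodMk measurable_const))

theorem MeasurableState.reqProb (hM : M.MeasurableLoss) {st : Ω → State 𝒳}
    (h : MeasurableState M st) : Measurable fun q : Ω × 𝒳 => (st q.1).reqProb M q.2 := by
  refine measurable_of_cover
    (fun i : ℕ × M.H.powerset => {q : Ω × 𝒳 | (st q.1).index q.2 = i.1} ∩
      {q : Ω × 𝒳 | (st q.1).hyp i.1 = i.2.1}) (fun i q => M.reqProb i.2.1 q.2) (fun i => ?_)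
    (fun i => (measurable_reqProb hM (Finset.mem_powerset.1 i.2.2)).comp measurable_snd)
    (fun q => ⟨((st q.1).index q.2, ⟨_, Finset.mem_powerset.2 (h.subset q.1 _)⟩), rfl, rfl⟩)
    (fun i q hq => ?_)
  · exact (h.index (measurableSet_singleton i.1)).inter (measurable_fst (h.hyp_eq i.1 i.2.1))
  · unfold State.reqProb
    rw [show (st q.1).index q.2 = i.1 from hq.1, show (st q.1).hyp i.1 = i.2.1 from hq.2]

theorem MeasurableState.ite {st st' : Ω → State 𝒳} (h : MeasurableState M st)
    (h' : MeasurableState M st') {C : Set Ω} (hC : MeasurableSet C) [DecidablePred (· ∈ C)] :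
    MeasurableState M fun ω => if ω ∈ C then st ω else st' ω := by
  have hC' : MeasurableSet {q : Ω × 𝒳 | q.1 ∈ C} := measurable_fst hC
  refine ⟨?_, fun k => ?_, fun k f => ?_, fun s => ?_, fun ω => ?_, fun ω => ?_⟩
  · simp only [apply_ite State.K]
    exact Measurable.ite hC h.K h'.K
  · have : {q : Ω × 𝒳 | q.2 ∈ (if q.1 ∈ C then st q.1 else st' q.1).region k} =
        ({q | q.1 ∈ C} ∩ {q | q.2 ∈ (st q.1).region k}) ∪
        ({q | q.1 ∈ C}ᶜ ∩ {q | q.2 ∈ (st' q.1).region k}) := by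
      ext q
      by_cases hq : q.1 ∈ C <;> simp [hq]
    unfold MeasurableRegion
    rw [this]
    exact (hC'.inter (h.region k)).union (hC'.compl.inter (h'.region k))
  · have : {ω | f ∈ (if ω ∈ C then st ω else st' ω).hyp k} =
        (C ∩ {ω | f ∈ (st ω).hyp k}) ∪ (Cᶜ ∩ {ω | f ∈ (st' ω).hyp k}) := by
      ext ω
      by_cases hω : ω ∈ C <;> simp [hω]
    rw [this]
    exact (hC.inter (h.hyp k f)).union (hC.compl.inter (h'.hyp k f))
  · have : (fun ω => (if ω ∈ C then st ω else st' ω).p s) =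
        fun ω => if ω ∈ C then (st ω).p s else (st' ω).p s := by
      ext ω
      split_ifs <;> rfl
    rw [this]
    exact Measurable.ite hC (h.p s) (h'.p s)
  · split_ifs
    · exact h.partition ω
    · exact h'.partition ω
  · split_ifs
    · exact h.subset ω
    · exact h'.subset ω

variable {z : ℕ → Ω → Sample 𝒳} {t : ℕ}

theorem MeasurableState.observe (hM : M.MeasurableLoss) {st : Ω → State 𝒳}
    (h : MeasurableState M st) (hz : Measurable (z t)) :
    MeasurableState M fun ω => (st ω).observe M (fun s => z s ω) t := by
  refine ⟨h.K, h.region, h.hyp, fun s => ?_, h.partition, h.subset⟩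
  simp only [State.observe, Function.update_apply]
  by_cases hs : s = t
  · simp only [if_pos hs]
    exact (h.reqProb hM).comp
      (measurable_id.prodMk (measurable_fst.comp (measurable_fst.comp hz)))
  · simp only [if_neg hs]
    exact h.p s

theorem MeasurableState.split {st : Ω → State 𝒳} (h : MeasurableState M st) {j : Ω → ℕ}
    (hj : Measurable j) (hjK : ∀ ω, j ω < (st ω).K) {c : Ω → Fin D × ℝ} (hc : Measurable c) :
    MeasurableState M fun ω => (st ω).split M (j ω) (c ω).1 (c ω).2 := by
  classical
  have hS := measurableRegion_random h.region hj
  have hKk : ∀ k, MeasurableSet {ω | k = (st ω).K} := fun k => by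
    convert h.K (measurableSet_singleton k) using 1
    ext ω
    exact eq_comm
  have hjk : ∀ k, MeasurableSet {ω | k = j ω} := fun k => by
    convert hj (measurableSet_singleton k) using 1
    ext ω
    exact eq_comm
  refine ⟨?_, fun k => ?_, fun k f => ?_, h.p, fun ω => (h.partition ω).split (hjK ω) M _ _,
    fun ω k => ?_⟩
  · exact (measurable_of_countable Nat.succ).comp h.K
  · have : {q : Ω × 𝒳 | q.2 ∈ ((st q.1).split M (j q.1) (c q.1).1 (c q.1).2).region k} =
        ({q | k = (st q.1).K} ∩ {q | q.2 ∈ rightPart ((st q.1).region (j q.1)) (c q.1).1 (c q.1).2}) ∪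
        ({q | k = (st q.1).K}ᶜ ∩ (({q | k = j q.1} ∩
          {q | q.2 ∈ leftPart ((st q.1).region (j q.1)) (c q.1).1 (c q.1).2}) ∪
          ({q | k = j q.1}ᶜ ∩ {q | q.2 ∈ (st q.1).region k}))) := by
      ext q
      simp only [State.split, Function.update_apply]
      by_cases h1 : k = (st q.1).K
      · simp [h1]
      · by_cases h2 : k = j q.1
        · simp [h2, (hjK q.1).ne]
        · simp [h1, h2]
    unfold MeasurableRegion
    rw [this]
    have h1 : MeasurableSet {q : Ω × 𝒳 | k = (st q.1).K} := measurable_fst (hKk k)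
    have h2 : MeasurableSet {q : Ω × 𝒳 | k = j q.1} := measurable_fst (hjk k)
    exact (h1.inter (hS.rightPart (measurable_fst.comp hc) (measurable_snd.comp hc))).union
      (h1.compl.inter ((h2.inter (hS.leftPart (measurable_fst.comp hc)
        (measurable_snd.comp hc))).union (h2.compl.inter (h.region k))))
  · have : {ω | f ∈ ((st ω).split M (j ω) (c ω).1 (c ω).2).hyp k} =
        (({ω | k = (st ω).K} ∪ {ω | k = j ω}) ∩ {_ω | f ∈ M.H}) ∪
        (({ω | k = (st ω).K} ∪ {ω | k = j ω})ᶜ ∩ {ω | f ∈ (st ω).hyp k}) := by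
      ext ω
      simp only [State.split, Function.update_apply]
      by_cases h1 : k = (st ω).K
      · simp [h1]
      · by_cases h2 : k = j ω
        · simp [h2]
        · simp [h1, h2]
    rw [this]
    have h1 := (hKk k).union (hjk k)
    exact (h1.inter (MeasurableSet.const _)).union (h1.compl.inter (h.hyp k f))
  · simp only [State.split, Function.update_apply]
    split_ifs
    · exact subset_rfl
    · exact subset_rfl
    · exact h.subset ω k

theorem MeasurableState.shrink (hM : M.MeasurableLoss) {st : Ω → State 𝒳}
    (h : MeasurableState M st) (hz : ∀ s, 1 ≤ s → s ≤ t → Measurable (z s)) {j : Ω → ℕ}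
    (hj : Measurable j) :
    MeasurableState M fun ω => (st ω).shrink M A (fun s => z s ω) t (j ω) := by
  classical
  have hsub : ∀ ω k, ((st ω).shrink M A (fun s => z s ω) t (j ω)).hyp k ⊆ (st ω).hyp k := by
    intro ω k
    simp only [State.shrink, Function.update_apply]
    split_ifs with hk
    · subst hk
      exact Finset.filter_subset _ _
    · exact subset_rfl
  refine ⟨h.K, h.region, fun k f => ?_, h.p, h.partition,
    fun ω k => (hsub ω k).trans (h.subset ω k)⟩
  by_cases hf : f ∈ M.H
  swap
  · have : {ω | f ∈ ((st ω).shrink M A (fun s => z s ω) t (j ω)).hyp k} = ∅ := by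
      ext ω
      exact iff_of_false (fun h' => hf (h.subset ω k (hsub ω k h'))) (Set.notMem_empty _)
    rw [this]
    exact MeasurableSet.empty
  set R : (𝒳 → ℝ) → Ω → ℝ := fun g ω =>
    empRisk M (fun s => z s ω) (st ω).p t ((st ω).region k) g
  have hR : ∀ g ∈ M.H, Measurable (R g) := fun g hg =>
    measurable_empRisk (p := fun s ω => (st ω).p s) hz h.p (h.region k) (hM.const hg)
  set N : Ω → ℝ := fun ω =>
    √(8 * slack M A / ((visits (fun s => z s ω) t ((st ω).region k)).card : ℝ))
  have hN : Measurable N := ((measurable_card_visits hz (h.region k)).const_div _).sqrt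
  have : {ω | f ∈ ((st ω).shrink M A (fun s => z s ω) t (j ω)).hyp k} =
      {ω | f ∈ (st ω).hyp k} ∩ ({ω | j ω = k}ᶜ ∪ ⋃ V ∈ M.H.powerset,
        {ω | (st ω).hyp k = V} ∩ {ω | R f ω ≤ (⨅ g : V, R g.1 ω) + N ω}) := by
    ext ω
    simp only [Set.mem_inter_iff, Set.mem_union, Set.mem_compl_iff, Set.mem_iUnion, exists_prop,
      Finset.mem_powerset, State.shrink, Function.update_apply]
    by_cases hk : k = j ω
    · subst hk
      simp only [if_true, Finset.mem_filter, R, N, Set.mem_ofPred_eq, not_true_eq_false, false_or]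
      refine and_congr Iff.rfl ⟨fun h' => ⟨_, h.subset ω _, rfl, h'⟩, ?_⟩
      rintro ⟨V, -, rfl, h'⟩
      exact h'
    · have hk' : ¬ j ω = k := fun h' => hk h'.symm
      simp [hk, hk']
  rw [this]
  refine (h.hyp k f).inter ((hj (measurableSet_singleton k)).compl.union
    (Finset.measurableSet_biUnion _ fun V hV => (h.hyp_eq k V).inter
      (measurableSet_le (hR f hf) (Measurable.add (Measurable.iInf fun g => ?_) hN))))
  exact hR g.1 (Finset.mem_powerset.1 hV g.2)

theorem MeasurableState.step [IsProbabilityMeasure M.dist] (hM : M.MeasurableLoss)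
    (hne : M.H.Nonempty) {ρ : ℝ} (hγ : A.γ = fun S => M.mass S * ρ / 2) (ht : 1 ≤ t)
    {st : Ω → State 𝒳} (h : MeasurableState M st)
    (hz : ∀ s, 1 ≤ s → s ≤ t → Measurable (z s)) {c : Ω → Fin D × ℝ} (hc : Measurable c) :
    MeasurableState M fun ω => step M A (fun s => z s ω) (c ω) t (st ω) := by
  classical
  have hzt := hz t ht le_rfl
  have hj : Measurable fun ω => (st ω).index (z t ω).1.1 :=
    h.index.comp (measurable_id.prodMk (measurable_fst.comp (measurable_fst.comp hzt)))
  have hobs := h.observe hM hzt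
  have hS := measurableRegion_random h.region hj
  have hC1 : MeasurableSet {ω | t ≤ A.τ ∧ (st ω).K < A.κ} :=
    (MeasurableSet.const _).inter (measurableSet_lt h.K measurable_const)
  have hC2 : MeasurableSet {ω | A.γ ((st ω).region ((st ω).index (z t ω).1.1)) ≤
      gap M A (fun s => z s ω) ((st ω).observe M (fun s => z s ω) t).p t
        ((st ω).region ((st ω).index (z t ω).1.1)) (c ω).1 (c ω).2} := by
    refine measurableSet_le ?_ (measurable_gap
      (p := fun s ω => ((st ω).observe M (fun s => z s ω) t).p s) hM hne hz hobs.p hS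
      (measurable_fst.comp hc) (measurable_snd.comp hc))
    rw [hγ]
    exact (hS.mass.mul_const _).div_const _
  have hidx : ∀ ω, (st ω).index (z t ω).1.1 < ((st ω).observe M (fun s => z s ω) t).K :=
    fun ω => ((h.partition ω).index_spec _).1
  exact MeasurableState.ite (MeasurableState.ite (hobs.split hj hidx hc) hobs hC2)
    (hobs.shrink (A := A) hM hz hj) hC1

end MeasurableRun

section MeasurablePast

variable {D : ℕ} {𝒳 : Set (Fin D → ℝ)} {M : Problem 𝒳} {A : Params 𝒳} {Ω : Type*}

theorem MeasurableState.mono {m m' : MeasurableSpace Ω} (hm : m ≤ m') {st : Ω → State 𝒳}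
    (h : @MeasurableState D 𝒳 Ω m M st) : @MeasurableState D 𝒳 Ω m' M st :=
  @MeasurableState.mk D 𝒳 Ω m' M st ((@MeasurableState.K D 𝒳 Ω m M st h).mono hm le_rfl)
    (fun k => sup_le_sup (MeasurableSpace.comap_mono hm) le_rfl _
      (@MeasurableState.region D 𝒳 Ω m M st h k))
    (fun k f => hm _ (@MeasurableState.hyp D 𝒳 Ω m M st h k f))
    (fun s => (@MeasurableState.p D 𝒳 Ω m M st h s).mono hm le_rfl)
    (@MeasurableState.partition D 𝒳 Ω m M st h) (@MeasurableState.subset D 𝒳 Ω m M st h)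

theorem measurableState_run [IsProbabilityMeasure M.dist] (hM : M.MeasurableLoss)
    (hne : M.H.Nonempty) {ρ : ℝ} (hγ : A.γ = fun S => M.mass S * ρ / 2)
    {Z : ℕ → Ω → Sample 𝒳} {cut : ℕ → Ω → Fin D × ℝ}
    (hcut : ∀ t, Measurable[past Z t] (cut t)) (t : ℕ) :
    @MeasurableState D 𝒳 Ω (past Z t) M
      fun ω => run M A (fun s => Z s ω) (fun s => cut s ω) t := by
  induction t with
  | zero =>
    let _ := past Z 0
    exact ⟨measurable_const, fun k => MeasurableSet.univ, fun k f => MeasurableSet.const (f ∈ M.H),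
      fun s => measurable_const, fun ω => run_partition M A _ (fun s => cut s ω) 0,
      fun ω k => subset_rfl⟩
  | succ t ih =>
    exact @MeasurableState.step D 𝒳 M A Ω (past Z (t + 1)) Z (t + 1) _ hM hne ρ hγ (by omega)
      _ (ih.mono (past_mono (Nat.le_succ t))) (fun s h1 h2 => measurable_past h1 h2) _ (hcut (t + 1))

/-- The cut of round `t` may use round `t` itself, yet the state after `t` rounds is a function of
the first `t` rounds. So the request probability of round `t + 1`, as a function of the point, is
settled before that point is drawn, which is what the supermartingale bound requires. -/
theorem measurable_run_reqProb [IsProbabilityMeasure M.dist] (hM : M.MeasurableLoss)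
    (hne : M.H.Nonempty) {ρ : ℝ} (hγ : A.γ = fun S => M.mass S * ρ / 2)
    {Z : ℕ → Ω → Sample 𝒳} {cut : ℕ → Ω → Fin D × ℝ}
    (hcut : ∀ t, Measurable[past Z t] (cut t)) (t : ℕ) :
    Measurable[(past Z t).prod inferInstance] fun q : Ω × 𝒳 =>
      (run M A (fun s => Z s q.1) (fun s => cut s q.1) t).reqProb M q.2 :=
  @MeasurableState.reqProb D 𝒳 M Ω (past Z t) hM _ (measurableState_run hM hne hγ hcut t)

end MeasurablePast

end ARBAL

/-! ### Losses on regions and the best-in-class loss of a partition -/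

namespace ARBAL

section Loss

variable {D : ℕ} {𝒳 : Set (Fin D → ℝ)} {M : Problem 𝒳} [IsProbabilityMeasure M.dist]

/-- The loss of `f` accumulated on the region `S`. -/
noncomputable def Problem.lossOn (M : Problem 𝒳) (S : Set 𝒳) (f : 𝒳 → ℝ) : ℝ :=
  ∫ v in Prod.fst ⁻¹' S, M.loss (f v.1) v.2 ∂M.dist

/-- The difference of the losses of two predictors. -/
def Problem.lossDiff (M : Problem 𝒳) (f g : 𝒳 → ℝ) (v : 𝒳 × ℤˣ) : ℝ :=
  M.loss (f v.1) v.2 - M.loss (g v.1) v.2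

theorem measurableSet_fst_preimage {S : Set 𝒳} (hS : MeasurableSet S) :
    MeasurableSet (Prod.fst ⁻¹' S : Set (𝒳 × ℤˣ)) := measurable_fst hS

theorem mass_univ (M : Problem 𝒳) [IsProbabilityMeasure M.dist] : M.mass Set.univ = 1 := by
  have := marginal_isProbabilityMeasure M
  simp [Problem.mass]

theorem mass_nonneg (M : Problem 𝒳) (S : Set 𝒳) : 0 ≤ M.mass S := measureReal_nonneg

theorem mass_le_one (M : Problem 𝒳) [IsProbabilityMeasure M.dist] (S : Set 𝒳) : M.mass S ≤ 1 := by
  have := marginal_isProbabilityMeasure M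
  exact measureReal_le_one

theorem setIntegral_dist {S : Set 𝒳} (hS : MeasurableSet S) (φ : 𝒳 × ℤˣ → ℝ) :
    ∫ v in Prod.fst ⁻¹' S, φ v ∂M.dist = M.mass S * ∫ v, φ v ∂(M.distOn S) := by
  rw [restrict_dist, integral_smul_measure, mass_eq M hS, measureReal_def, smul_eq_mul]

theorem lossOn_eq {S : Set 𝒳} (hS : MeasurableSet S) (f : 𝒳 → ℝ) :
    M.lossOn S f = M.mass S * M.riskOn S f := setIntegral_dist hS _

omit [IsProbabilityMeasure M.dist] in
theorem lossOn_univ (f : 𝒳 → ℝ) : M.lossOn Set.univ f = M.risk f := by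
  simp [Problem.lossOn, Problem.risk]

theorem distOn_univ : M.distOn Set.univ = M.dist := by
  simp [Problem.distOn]

theorem integrable_of_bounded {ν : Measure (𝒳 × ℤˣ)} [IsFiniteMeasure ν] {φ : 𝒳 × ℤˣ → ℝ}
    (hφ : Measurable φ) (hφ1 : ∀ v, |φ v| ≤ 1) : Integrable φ ν :=
  Integrable.of_mem_Icc (-1) 1 hφ.aemeasurable (Filter.Eventually.of_forall fun v => abs_le.1 (hφ1 v))

instance (S : Set 𝒳) : IsFiniteMeasure (M.distOn S) := by
  by_cases h : M.dist (Prod.fst ⁻¹' S) = 0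
  · have : M.distOn S = 0 := ProbabilityTheory.cond_eq_zero_of_meas_eq_zero h
    rw [this]
    infer_instance
  · have := isProbabilityMeasure_distOn h
    infer_instance

omit [IsProbabilityMeasure M.dist] in
theorem Problem.Bounded.abs_loss_le (hM : M.Bounded) {f : 𝒳 → ℝ} (hf : f ∈ M.H) (v : 𝒳 × ℤˣ) :
    |M.loss (f v.1) v.2| ≤ 1 := by
  have h := hM f hf v.1 v.2
  rw [abs_of_nonneg h.1]
  exact h.2

omit [IsProbabilityMeasure M.dist] in
theorem Problem.Bounded.integrable (hM : M.Bounded) (hm : M.MeasurableLoss) {f : 𝒳 → ℝ}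
    (hf : f ∈ M.H) (ν : Measure (𝒳 × ℤˣ)) [IsFiniteMeasure ν] :
    Integrable (fun v : 𝒳 × ℤˣ => M.loss (f v.1) v.2) ν :=
  integrable_of_bounded (hm f hf) (hM.abs_loss_le hf)

omit [IsProbabilityMeasure M.dist] in
theorem Problem.Bounded.lossOn_nonneg (hM : M.Bounded) {f : 𝒳 → ℝ} (hf : f ∈ M.H) (S : Set 𝒳) :
    0 ≤ M.lossOn S f := integral_nonneg fun v => (hM f hf v.1 v.2).1

omit [IsProbabilityMeasure M.dist] in
theorem Problem.Bounded.riskOn_nonneg (hM : M.Bounded) {f : 𝒳 → ℝ} (hf : f ∈ M.H) (S : Set 𝒳) :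
    0 ≤ M.riskOn S f := integral_nonneg fun v => (hM f hf v.1 v.2).1

theorem Problem.Bounded.lossOn_le_mass (hM : M.Bounded) (hm : M.MeasurableLoss) {f : 𝒳 → ℝ}
    (hf : f ∈ M.H) {S : Set 𝒳} (hS : MeasurableSet S) : M.lossOn S f ≤ M.mass S := by
  have h : M.lossOn S f ≤ ∫ _v in (Prod.fst ⁻¹' S : Set (𝒳 × ℤˣ)), (1 : ℝ) ∂M.dist :=
    integral_mono (hM.integrable hm hf _) (integrable_const _) fun v => (hM f hf v.1 v.2).2
  rw [setIntegral_const, smul_eq_mul, mul_one, ← mass_eq M hS] at h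
  exact h

theorem leftPart_union_rightPart (S : Set 𝒳) (d : Fin D) (a : ℝ) :
    leftPart S d a ∪ rightPart S d a = S := by
  ext x
  simp only [leftPart, rightPart, Set.mem_union, Set.mem_ofPred_eq]
  constructor
  · rintro (h | h) <;> exact h.1
  · intro h
    rcases le_or_gt (x.1 d) a with h' | h'
    · exact Or.inl ⟨h, h'⟩
    · exact Or.inr ⟨h, h'⟩

theorem lossOn_split (hM : M.Bounded) (hm : M.MeasurableLoss) {f : 𝒳 → ℝ} (hf : f ∈ M.H)
    {S : Set 𝒳} (hS : MeasurableSet S) (d : Fin D) (a : ℝ) :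
    M.lossOn S f = M.lossOn (leftPart S d a) f + M.lossOn (rightPart S d a) f := by
  have h := setIntegral_union (μ := M.dist) (f := fun v : 𝒳 × ℤˣ => M.loss (f v.1) v.2)
    ((disjoint_leftPart_rightPart S d a).preimage Prod.fst)
    (measurableSet_fst_preimage (measurableSet_rightPart hS d a))
    (hM.integrable hm hf _).integrableOn (hM.integrable hm hf _).integrableOn
  rw [← Set.preimage_union, leftPart_union_rightPart] at h
  exact h

theorem lossOn_combine (hM : M.Bounded) (hm : M.MeasurableLoss) {S T : Set 𝒳}
    (hS : MeasurableSet S) (hT : MeasurableSet T) (hST : Disjoint S T) {f g : 𝒳 → ℝ}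
    (hf : f ∈ M.H) (hg : g ∈ M.H) :
    M.lossOn (S ∪ T) (combine S T f g) = M.lossOn S f + M.lossOn T g := by
  have hS' := measurableSet_fst_preimage hS
  have hT' := measurableSet_fst_preimage hT
  have h1 : Set.EqOn (fun v : 𝒳 × ℤˣ => M.loss (combine S T f g v.1) v.2)
      (fun v => M.loss (f v.1) v.2) (Prod.fst ⁻¹' S) := fun v hv => by
    have hv' : v.1 ∈ S := hv
    beta_reduce
    rw [combine_of_mem_left hv' (Set.disjoint_left.1 hST hv')]
  have h2 : Set.EqOn (fun v : 𝒳 × ℤˣ => M.loss (combine S T f g v.1) v.2)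
      (fun v => M.loss (g v.1) v.2) (Prod.fst ⁻¹' T) := fun v hv => by
    have hv' : v.1 ∈ T := hv
    beta_reduce
    rw [combine_of_mem_right (Set.disjoint_right.1 hST hv') hv']
  have h := setIntegral_union (μ := M.dist)
    (f := fun v : 𝒳 × ℤˣ => M.loss (combine S T f g v.1) v.2) (hST.preimage Prod.fst) hT'
    ((hM.integrable hm hf _).integrableOn.congr_fun h1.symm hS')
    ((hM.integrable hm hg _).integrableOn.congr_fun h2.symm hT')
  rw [setIntegral_congr_fun hS' h1, setIntegral_congr_fun hT' h2] at h
  exact h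

variable {hstar : Set 𝒳 → 𝒳 → ℝ}

theorem lossOn_best_le (hbest : ∀ S, MeasurableSet S → M.IsBestOn S (hstar S)) {S : Set 𝒳}
    (hS : MeasurableSet S) {f : 𝒳 → ℝ} (hf : f ∈ M.H) :
    M.lossOn S (hstar S) ≤ M.lossOn S f := by
  rw [lossOn_eq hS, lossOn_eq hS]
  exact mul_le_mul_of_nonneg_left ((hbest S hS).2 f hf) (mass_nonneg M S)

/-- The best hypothesis of `S` competes on both parts. -/
theorem lossOn_best_split_le (hM : M.Bounded) (hm : M.MeasurableLoss)
    (hbest : ∀ S, MeasurableSet S → M.IsBestOn S (hstar S)) {S : Set 𝒳} (hS : MeasurableSet S)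
    (d : Fin D) (a : ℝ) :
    M.lossOn (leftPart S d a) (hstar (leftPart S d a)) +
      M.lossOn (rightPart S d a) (hstar (rightPart S d a)) ≤ M.lossOn S (hstar S) := by
  have hh := (hbest S hS).1
  rw [lossOn_split hM hm hh hS d a]
  exact add_le_add (lossOn_best_le hbest (measurableSet_leftPart hS d a) hh)
    (lossOn_best_le hbest (measurableSet_rightPart hS d a) hh)

/-- The sum over the regions of the best loss. -/
noncomputable def Problem.bestLoss (M : Problem 𝒳) (hstar : Set 𝒳 → 𝒳 → ℝ) (st : State 𝒳) : ℝ :=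
  ∑ k ∈ Finset.range st.K, M.lossOn (st.region k) (hstar (st.region k))

omit [IsProbabilityMeasure M.dist] in
theorem sum_split (st : State 𝒳) {j : ℕ} (hj : j < st.K) (d : Fin D) (a : ℝ) (F : Set 𝒳 → ℝ) :
    ∑ k ∈ Finset.range (st.split M j d a).K, F ((st.split M j d a).region k) =
      ∑ k ∈ Finset.range st.K, F (st.region k) - F (st.region j) +
        F (leftPart (st.region j) d a) + F (rightPart (st.region j) d a) := by
  have hK : (st.split M j d a).K = st.K + 1 := rfl
  rw [hK, Finset.sum_range_succ]
  have h1 : (st.split M j d a).region st.K = rightPart (st.region j) d a := by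
    simp [State.split]
  have h2 : ∑ k ∈ Finset.range st.K, F ((st.split M j d a).region k) =
      ∑ k ∈ Finset.range st.K, (F (st.region k) + if k = j then
        F (leftPart (st.region j) d a) - F (st.region j) else 0) := by
    refine Finset.sum_congr rfl fun k hk => ?_
    have hk' : k ≠ st.K := (Finset.mem_range.1 hk).ne
    simp only [State.split, Function.update_apply, if_neg hk']
    split_ifs with h
    · subst h; ring
    · ring
  rw [h1, h2, Finset.sum_add_distrib, Finset.sum_ite_eq' _ _ (fun _ =>
    F (leftPart (st.region j) d a) - F (st.region j)), if_pos (Finset.mem_range.2 hj)]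
  ring

omit [IsProbabilityMeasure M.dist] in
theorem observe_region (st : State 𝒳) (z : ℕ → Sample 𝒳) (t : ℕ) :
    (st.observe M z t).region = st.region := rfl

omit [IsProbabilityMeasure M.dist] in
theorem observe_K (st : State 𝒳) (z : ℕ → Sample 𝒳) (t : ℕ) : (st.observe M z t).K = st.K := rfl

variable {A : Params 𝒳} {z : ℕ → Sample 𝒳} {cut : ℕ → Fin D × ℝ}

theorem bestLoss_succ_le (hM : M.Bounded) (hm : M.MeasurableLoss)
    (hbest : ∀ S, MeasurableSet S → M.IsBestOn S (hstar S)) (t : ℕ) :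
    M.bestLoss hstar (run M A z cut (t + 1)) ≤ M.bestLoss hstar (run M A z cut t) := by
  rw [run]
  have hidx := ((run_partition M A z cut t).index_spec (z (t + 1)).1.1).1
  rcases step_cases M A z (cut (t + 1)) (t + 1) (run M A z cut t) with
    ⟨-, -, -, h⟩ | ⟨-, -, -, h⟩ | ⟨-, h⟩ <;> rw [h]
  · have h1 := sum_split (M := M) ((run M A z cut t).observe M z (t + 1)) hidx (cut (t + 1)).1
      (cut (t + 1)).2 (fun S => M.lossOn S (hstar S))
    have h2 := lossOn_best_split_le hM hm hbest (run_region_measurableSet (M := M) (A := A) t _ hidx)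
      (cut (t + 1)).1 (cut (t + 1)).2
    unfold Problem.bestLoss
    rw [h1]
    simp only [observe_region, observe_K]
    linarith
  · exact le_rfl
  · exact le_rfl

theorem bestLoss_antitone (hM : M.Bounded) (hm : M.MeasurableLoss)
    (hbest : ∀ S, MeasurableSet S → M.IsBestOn S (hstar S)) :
    Antitone fun t => M.bestLoss hstar (run M A z cut t) :=
  antitone_nat_of_succ_le (bestLoss_succ_le hM hm hbest)

omit [IsProbabilityMeasure M.dist] in
theorem region_eq_univ {st : State 𝒳} (h : st.Partition) (hK : st.K = 1) :
    st.region 0 = Set.univ := by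
  ext x
  simp only [Set.mem_univ, iff_true]
  obtain ⟨k, ⟨hk, hx⟩, -⟩ := h x
  have : k = 0 := by omega
  exact this ▸ hx

omit [IsProbabilityMeasure M.dist] in
theorem bestLoss_eq_of_one {t : ℕ} (hK : (run M A z cut t).K = 1) :
    M.bestLoss hstar (run M A z cut t) = M.risk (hstar Set.univ) := by
  unfold Problem.bestLoss
  rw [hK, Finset.sum_range_one, region_eq_univ (run_partition M A z cut t) hK, lossOn_univ]

/-- The risk of a piecewise predictor is the sum of the losses on the pieces. -/
theorem risk_predictor (hM : M.Bounded) (hm : M.MeasurableLoss) {st : State 𝒳}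
    (hst : st.Partition) (hmeas : ∀ k < st.K, MeasurableSet (st.region k)) {h : ℕ → 𝒳 → ℝ}
    (hh : ∀ k < st.K, h k ∈ M.H) :
    M.risk (st.predictor h) = ∑ k ∈ Finset.range st.K, M.lossOn (st.region k) (h k) := by
  have hval : ∀ k < st.K, ∀ x ∈ st.region k, st.predictor h x = h k x := by
    intro k hk x hx
    unfold State.predictor
    rw [Finset.sum_eq_single_of_mem k (Finset.mem_range.2 hk), Set.indicator_of_mem hx]
    intro j hj hjk
    refine Set.indicator_of_notMem (fun hxj => hjk ?_) _
    exact (hst.index_eq (Finset.mem_range.1 hj) hxj).symm.trans (hst.index_eq hk hx)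
  have heq : ∀ k < st.K, Set.EqOn (fun v : 𝒳 × ℤˣ => M.loss (st.predictor h v.1) v.2)
      (fun v => M.loss (h k v.1) v.2) (Prod.fst ⁻¹' st.region k) := fun k hk v hv => by
    beta_reduce
    rw [hval k hk v.1 hv]
  have hunion : (⋃ k ∈ Finset.range st.K, (Prod.fst ⁻¹' st.region k : Set (𝒳 × ℤˣ))) =
      Set.univ := by
    ext v
    simp only [Set.mem_iUnion, Set.mem_univ, iff_true]
    have := hst.index_spec v.1
    exact ⟨_, Finset.mem_range.2 this.1, this.2⟩
  have key := integral_biUnion_finset (μ := M.dist) (Finset.range st.K)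
    (f := fun v : 𝒳 × ℤˣ => M.loss (st.predictor h v.1) v.2)
    (s := fun k => (Prod.fst ⁻¹' st.region k : Set (𝒳 × ℤˣ)))
    (fun k hk => measurableSet_fst_preimage (hmeas k (Finset.mem_range.1 hk)))
    (fun i hi j hj hij => by
      refine Set.disjoint_left.2 fun v hvi hvj => hij ?_
      exact (hst.index_eq (Finset.mem_range.1 hi) hvi).symm.trans
        (hst.index_eq (Finset.mem_range.1 hj) hvj))
    (fun k hk => ((hM.integrable hm (hh k (Finset.mem_range.1 hk)) _).integrableOn).congr_fun
      (heq k (Finset.mem_range.1 hk)).symm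
      (measurableSet_fst_preimage (hmeas k (Finset.mem_range.1 hk))))
  rw [hunion, setIntegral_univ] at key
  unfold Problem.risk
  rw [key]
  refine Finset.sum_congr rfl fun k hk => ?_
  have hk' := Finset.mem_range.1 hk
  exact setIntegral_congr_fun (measurableSet_fst_preimage (hmeas k hk')) (heq k hk')

omit [IsProbabilityMeasure M.dist] in
/-- The difference of two importance-weighted empirical risks in terms of the deviation. -/
theorem card_mul_empRisk_sub {z : ℕ → Sample 𝒳} {p p' : ℕ → ℝ} {t : ℕ} {S : Set 𝒳} {f g : 𝒳 → ℝ}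
    (hp : ∀ s ∈ visits z t S, p s = p' s)
    (hφ : ∀ s ∈ visits z t S, ∀ y, |M.lossDiff f g ((z s).1.1, y)| ≤ p' s) :
    ((visits z t S).card : ℝ) * (empRisk M z p t S f - empRisk M z p t S g) =
      deviation M z p' (M.lossDiff f g) t S +
        (visits z t S).card * ∫ v, M.lossDiff f g v ∂(M.distOn S) := by
  unfold deviation empRisk
  rw [Finset.sum_sub_distrib, Finset.sum_const, nsmul_eq_mul, sub_add_cancel, ← sub_div,
    ← Finset.sum_sub_distrib]
  by_cases h0 : ((visits z t S).card : ℝ) = 0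
  · have h1 : visits z t S = ∅ := by simpa using h0
    simp [h1]
  · rw [mul_div_cancel₀ _ h0]
    refine Finset.sum_congr rfl fun s hs => ?_
    -- Under the domination hypothesis the plain branch of `weighted` does not occur, and the terms
    -- are those of the empirical risk.
    unfold weighted
    rw [if_pos (hφ s hs), hp s hs]
    unfold coin Problem.lossDiff
    rw [hp s hs]
    ring

end Loss

end ARBAL

/-! ### Typical runs and the survival of the best hypothesis -/

namespace ARBAL

section Typical

variable {D : ℕ} {𝒳 : Set (Fin D → ℝ)} {M : Problem 𝒳} {A : Params 𝒳} {z : ℕ → Sample 𝒳}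
  {cut : ℕ → Fin D × ℝ} {hstar : Set 𝒳 → 𝒳 → ℝ}

/-- The request probability of round `s`. -/
noncomputable def reqAt (M : Problem 𝒳) (A : Params 𝒳) (z : ℕ → Sample 𝒳) (cut : ℕ → Fin D × ℝ)
    (s : ℕ) : ℝ := (run M A z cut (s - 1)).reqProb M (z s).1.1

/-- The properties of a run that hold with high probability: the importance-weighted empirical
risks concentrate, every region is visited often enough, and so on.  `n` bounds the number of
splits, and `(d₀, a₀)` is a fixed split of the input space. -/
structure Typical (M : Problem 𝒳) (A : Params 𝒳) (z : ℕ → Sample 𝒳) (cut : ℕ → Fin D × ℝ)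
    (hstar : Set 𝒳 → 𝒳 → ℝ) (n : ℕ) (σ η : ℝ) (d₀ : Fin D) (a₀ : ℝ) : Prop where
  deviation_le : ∀ S, IsBox n S → 5 * σ ≤ M.mass S * A.T → ∀ f ∈ M.H, ∀ g ∈ M.H, ∀ t ≤ A.T,
    deviation M z (reqAt M A z cut) (M.lossDiff f g) t S ≤
      13 / 10 * √(2 * σ * (visits z t S).card)
  le_card : ∀ S, IsBox n S → ∀ t ≤ A.T,
    63 / 100 * M.mass S * t - 109 / 100 * σ ≤ (visits z t S).card
  le_card_sub : ∀ S, IsBox n S → ∀ t, A.τ ≤ t → t ≤ A.T →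
    63 / 100 * M.mass S * (t - A.τ) - 109 / 100 * σ ≤
      ((visits z t S).card : ℝ) - (visits z A.τ S).card
  deviation_split_le : 1 ≤ n → ∀ d a, ∀ f ∈ M.H, ∀ g ∈ M.H, ∀ t ≤ A.T,
    deviation M z (reqAt M A z cut) (M.lossDiff (hstar Set.univ)
      (combine (leftPart Set.univ d a) (rightPart Set.univ d a) f g)) t Set.univ ≤
      √(2 * σ * t) + t * η
  deviation_witness_le : ∀ g ∈ M.H, ∀ t ≤ A.T,
    deviation M z (reqAt M A z cut) (M.lossDiff
      (combine (leftPart Set.univ d₀ a₀) (rightPart Set.univ d₀ a₀)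
        (hstar (leftPart Set.univ d₀ a₀)) (hstar (rightPart Set.univ d₀ a₀))) g) t Set.univ ≤
      √(2 * σ * t)

theorem mem_visits {z : ℕ → Sample 𝒳} {t s : ℕ} {S : Set 𝒳} :
    s ∈ visits z t S ↔ (1 ≤ s ∧ s ≤ t) ∧ (z s).1.1 ∈ S := by
  classical
  simp [visits]

theorem visits_succ_of_notMem {z : ℕ → Sample 𝒳} {t : ℕ} {S : Set 𝒳} (h : (z (t + 1)).1.1 ∉ S) :
    visits z (t + 1) S = visits z t S := by
  ext s
  rw [mem_visits, mem_visits]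
  constructor
  · rintro ⟨⟨h1, h2⟩, h3⟩
    have : s ≠ t + 1 := by rintro rfl; exact h h3
    exact ⟨⟨h1, by omega⟩, h3⟩
  · rintro ⟨⟨h1, h2⟩, h3⟩
    exact ⟨⟨h1, by omega⟩, h3⟩

theorem run_p_eq_reqAt {t s : ℕ} (h1 : 1 ≤ s) (h2 : s ≤ t) :
    (run M A z cut t).p s = reqAt M A z cut s := by
  obtain ⟨s, rfl⟩ : ∃ r, s = r + 1 := ⟨s - 1, by omega⟩
  rw [run_p (by omega)]
  rfl

theorem IsBox.of_run {n t k : ℕ} (hn : A.κ ≤ n + 1) (hκ : 1 ≤ A.κ)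
    (hk : k < (run M A z cut t).K) : IsBox n ((run M A z cut t).region k) := by
  have h1 := run_K_le (M := M) (z := z) (cut := cut) hκ t
  exact (run_isBox t k hk).mono (by omega)

theorem integral_lossDiff (hM : M.Bounded) (hm : M.MeasurableLoss) [IsProbabilityMeasure M.dist]
    {f g : 𝒳 → ℝ} (hf : f ∈ M.H) (hg : g ∈ M.H) (S : Set 𝒳) :
    ∫ v, M.lossDiff f g v ∂(M.distOn S) = M.riskOn S f - M.riskOn S g :=
  integral_sub (hM.integrable hm hf _) (hM.integrable hm hg _)

/-- On a region of sufficient mass, the empirical risks determine the risks up to the confidence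
width. -/
theorem empRisk_sub_le [IsProbabilityMeasure M.dist] (hM : M.Bounded) (hm : M.MeasurableLoss)
    {z : ℕ → Sample 𝒳} {p p' : ℕ → ℝ} {t : ℕ} {S : Set 𝒳} {σ : ℝ}
    {f g : 𝒳 → ℝ} (hf : f ∈ M.H) (hg : g ∈ M.H)
    (hp : ∀ s ∈ visits z t S, p s = p' s)
    (hφ : ∀ s ∈ visits z t S, ∀ y, |M.lossDiff f g ((z s).1.1, y)| ≤ p' s)
    (hdev : deviation M z p' (M.lossDiff f g) t S ≤ 13 / 10 * √(2 * σ * (visits z t S).card))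
    (hN : (visits z t S).card ≠ 0) :
    empRisk M z p t S f - empRisk M z p t S g ≤
      M.riskOn S f - M.riskOn S g + 13 / 10 * √(2 * σ / (visits z t S).card) := by
  have h := card_mul_empRisk_sub hp hφ
  rw [integral_lossDiff hM hm hf hg] at h
  have hN' : (0 : ℝ) < (visits z t S).card := by exact_mod_cast Nat.pos_of_ne_zero hN
  set N : ℝ := ((visits z t S).card : ℝ)
  have hs : √(2 * σ * N) = N * √(2 * σ / N) := by
    rw [show 2 * σ * N = N ^ 2 * (2 * σ / N) by field_simp, Real.sqrt_mul (by positivity),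
      Real.sqrt_sq hN'.le]
  rw [hs] at hdev
  refine le_of_mul_le_mul_left ?_ hN'
  rw [h]
  linarith

theorem sqrt_eight_mul_div (σ N : ℝ) : √(8 * σ / N) = 2 * √(2 * σ / N) := by
  rw [show 8 * σ / N = 2 ^ 2 * (2 * σ / N) by ring, Real.sqrt_mul (by norm_num),
    Real.sqrt_sq (by norm_num)]

/-- In a typical run, the best hypothesis of a region of sufficient mass is never eliminated, and
after a visit all remaining hypotheses are almost as good. -/
theorem Typical.survival [IsProbabilityMeasure M.dist] (hM : M.Bounded) (hm : M.MeasurableLoss)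
    (hbest : ∀ S, MeasurableSet S → M.IsBestOn S (hstar S)) {n : ℕ} {σ η : ℝ} {d₀ : Fin D}
    {a₀ : ℝ} (hty : Typical M A z cut hstar n σ η d₀ a₀) (hn : A.κ ≤ n + 1) (hκ : 1 ≤ A.κ)
    (hσ : σ = slack M A) {t : ℕ} (htT : t ≤ A.T) :
    ∀ k < (run M A z cut t).K, 5 * σ ≤ M.mass ((run M A z cut t).region k) * A.T →
      hstar ((run M A z cut t).region k) ∈ (run M A z cut t).hyp k ∧
      ((∃ s, A.τ < s ∧ s ≤ t ∧ (z s).1.1 ∈ (run M A z cut t).region k) →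
        ∀ h ∈ (run M A z cut t).hyp k, M.riskOn ((run M A z cut t).region k) h ≤
          M.riskOn ((run M A z cut t).region k) (hstar ((run M A z cut t).region k)) +
            33 / 10 * √(2 * σ / (visits z t ((run M A z cut t).region k)).card)) := by
  classical
  induction t with
  | zero =>
    intro k _ _
    refine ⟨(hbest _ MeasurableSet.univ).1, ?_⟩
    rintro ⟨s, h1, h2, -⟩
    omega
  | succ t ih =>
    have ih' := ih (by omega)
    intro k hk hmass
    have hmeas := run_region_measurableSet (t + 1) k hk
    by_cases hph : Splitting M A z cut t
    · have hvac : ¬ ∃ s, A.τ < s ∧ s ≤ t + 1 ∧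
          (z s).1.1 ∈ (run M A z cut (t + 1)).region k := by
        rintro ⟨s, h1, h2, -⟩
        have := hph.1
        omega
      refine ⟨?_, fun h => absurd h hvac⟩
      have hhyp : (run M A z cut (t + 1)).hyp k = M.H := by
        rw [run]
        rcases step_cases M A z (cut (t + 1)) (t + 1) (run M A z cut t) with
          ⟨-, -, -, h1⟩ | ⟨-, -, -, h1⟩ | ⟨h0, -⟩
        · rw [h1]
          simp only [State.split, Function.update_apply]
          split_ifs
          · rfl
          · rfl
          · exact hph.hyp_eq k
        · rw [h1]
          exact hph.hyp_eq k
        · exact absurd hph h0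
      rw [hhyp]
      exact (hbest _ hmeas).1
    · have hpt : (run M A z cut (t + 1)).p = ((run M A z cut t).observe M z (t + 1)).p := by
        rw [run, step_p]
      obtain ⟨hK, hreg⟩ := run_eq_of_not_splitting hph
      have hp1 : ∀ s ∈ visits z (t + 1) ((run M A z cut t).region k),
          ((run M A z cut t).observe M z (t + 1)).p s = reqAt M A z cut s := by
        intro s hs
        rw [← hpt]
        exact run_p_eq_reqAt (mem_visits.1 hs).1.1 (mem_visits.1 hs).1.2
      have hbox : IsBox n ((run M A z cut t).region k) := by
        rw [← hreg]; exact IsBox.of_run hn hκ hk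
      rw [hreg] at hmass hmeas ⊢
      have hk' : k < (run M A z cut t).K := by rw [← hK]; exact hk
      have hIH := ih' k hk' hmass
      have hpart := run_partition M A z cut t
      have hstep : run M A z cut (t + 1) = ((run M A z cut t).observe M z (t + 1)).shrink M A z
          (t + 1) ((run M A z cut t).index (z (t + 1)).1.1) := by
        rw [run]
        rcases step_cases M A z (cut (t + 1)) (t + 1) (run M A z cut t) with
          ⟨h0, h0', -, -⟩ | ⟨h0, h0', -, -⟩ | ⟨-, h1⟩
        · exact absurd ⟨h0, h0'⟩ hph
        · exact absurd ⟨h0, h0'⟩ hph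
        · exact h1
      by_cases hki : (z (t + 1)).1.1 ∈ (run M A z cut t).region k
      · have hidx := hpart.index_eq hk' hki
        set S := (run M A z cut t).region k
        set p := ((run M A z cut t).observe M z (t + 1)).p
        set V := (run M A z cut t).hyp k
        have hVH : V ⊆ M.H := run_hyp_subset t k
        have hN : (visits z (t + 1) S).card ≠ 0 :=
          Finset.card_ne_zero_of_mem (mem_visits.2 ⟨⟨Nat.le_add_left 1 t, le_rfl⟩, hki⟩)
        -- All members of `V` took part in the request probabilities at every visit of `S`, so the
        -- weights are dominated and the deviation bound applies to any two of them.
        have hcmp : ∀ f ∈ V, ∀ g ∈ V, empRisk M z p (t + 1) S f - empRisk M z p (t + 1) S g ≤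
            M.riskOn S f - M.riskOn S g +
              13 / 10 * √(2 * σ / (visits z (t + 1) S).card) := by
          intro f hf g hg
          refine empRisk_sub_le hM hm (hVH hf) (hVH hg) hp1 (fun s hs y => ?_)
            (hty.deviation_le S hbox hmass f (hVH hf) g (hVH hg) _ htT) hN
          obtain ⟨⟨h1, h2⟩, h3⟩ := mem_visits.1 hs
          obtain ⟨s, rfl⟩ : ∃ r, s = r + 1 := ⟨s - 1, by omega⟩
          rcases Nat.lt_succ_iff_lt_or_eq.1 h2 with h4 | h4
          · exact loss_sub_le_run_p (by omega) hk' h3 hf hg y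
          · have h5 : s = t := by omega
            subst h5
            -- The current round is treated separately: its request probability comes from `V`
            -- itself, before the shrinking.
            have h6 : reqAt M A z cut (s + 1) = M.reqProb V (z (s + 1)).1.1 := by
              unfold reqAt State.reqProb
              rw [Nat.add_sub_cancel, hidx]
            rw [h6]
            exact M.le_reqProb hf hg _ y
        have hnew : ∀ h, h ∈ (run M A z cut (t + 1)).hyp k ↔ h ∈ V ∧
            empRisk M z p (t + 1) S h ≤ (⨅ g : V, empRisk M z p (t + 1) S g.1) +
              2 * √(2 * σ / (visits z (t + 1) S).card) := by
          intro h
          rw [hstep, hidx, ← sqrt_eight_mul_div, hσ]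
          simp only [State.shrink, Function.update_self, Finset.mem_filter]
          rfl
        have hs0 : 0 ≤ √(2 * σ / (visits z (t + 1) S).card) := Real.sqrt_nonneg _
        have hVne : Nonempty V := ⟨⟨_, hIH.1⟩⟩
        refine ⟨(hnew _).2 ⟨hIH.1, ?_⟩, fun _ h hh => ?_⟩
        · rw [← sub_le_iff_le_add]
          refine le_ciInf fun g => ?_
          -- The best hypothesis trails every competitor by at most `13/10` widths `√(2σ/N)`, while
          -- the elimination threshold `√(8σ/N)` allows two.
          have h1 := hcmp _ hIH.1 g.1 g.2
          have h2 := (hbest S hmeas).2 g.1 (hVH g.2)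
          linarith
        · obtain ⟨hhV, hle⟩ := (hnew h).1 hh
          have h1 := hcmp _ hIH.1 h hhV
          have h3 : (⨅ g : V, empRisk M z p (t + 1) S g.1) ≤ empRisk M z p (t + 1) S (hstar S) :=
            ciInf_le (Set.finite_range _).bddBelow (⟨_, hIH.1⟩ : V)
          have h4 := hcmp (hstar S) hIH.1 h hhV
          -- A survivor is empirically within two widths of the best hypothesis, and the passage to
          -- the true risks costs `13/10` more: `33/10` in all.
          have h5 : M.riskOn S h - M.riskOn S (hstar S) ≤ empRisk M z p (t + 1) S h -
              empRisk M z p (t + 1) S (hstar S) +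
                13 / 10 * √(2 * σ / (visits z (t + 1) S).card) := by linarith
          linarith
      · have hne : k ≠ (run M A z cut t).index (z (t + 1)).1.1 := fun h =>
          hki (h ▸ (hpart.index_spec (z (t + 1)).1.1).2)
        have hsame : (run M A z cut (t + 1)).hyp k = (run M A z cut t).hyp k := by
          rw [hstep]
          simp only [State.shrink, Function.update_of_ne hne]
          rfl
        rw [hsame, visits_succ_of_notMem hki]
        refine ⟨hIH.1, ?_⟩
        rintro ⟨s, h1, h2, h3⟩
        refine hIH.2 ⟨s, h1, ?_, h3⟩
        have : s ≠ t + 1 := by rintro rfl; exact hki h3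
        omega

end Typical

end ARBAL

/-! ### The gain of the first split -/

namespace ARBAL

section FirstSplit

variable {D : ℕ} {𝒳 : Set (Fin D → ℝ)} {M : Problem 𝒳} {A : Params 𝒳} {z : ℕ → Sample 𝒳}
  {cut : ℕ → Fin D × ℝ} {hstar : Set 𝒳 → 𝒳 → ℝ}

theorem combine_cases {S T : Set 𝒳} (hST : Disjoint S T) (hU : S ∪ T = Set.univ)
    (f g : 𝒳 → ℝ) (x : 𝒳) : combine S T f g x = f x ∨ combine S T f g x = g x := by
  have hx : x ∈ S ∪ T := hU ▸ Set.mem_univ x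
  rcases hx with hx | hx
  · exact Or.inl (combine_of_mem_left hx (Set.disjoint_left.1 hST hx))
  · exact Or.inr (combine_of_mem_right (Set.disjoint_right.1 hST hx) hx)

theorem measurable_loss_combine (hm : M.MeasurableLoss) {S T : Set 𝒳} (hS : MeasurableSet S)
    (hT : MeasurableSet T) (hST : Disjoint S T) {f g : 𝒳 → ℝ} (hf : f ∈ M.H) (hg : g ∈ M.H) :
    Measurable fun v : 𝒳 × ℤˣ => M.loss (combine S T f g v.1) v.2 :=
  (measurablePredictor_combine (Ω := Unit) hm (S := fun _ => S) (T := fun _ => T)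
    (measurable_snd hS) (measurable_snd hT) (fun _ => hST) hf hg).comp
    (measurable_prodMk_left (x := ()))

theorem loss_combine_mem (hM : M.Bounded) {S T : Set 𝒳} (hST : Disjoint S T)
    (hU : S ∪ T = Set.univ) {f g : 𝒳 → ℝ} (hf : f ∈ M.H) (hg : g ∈ M.H) (x : 𝒳) (y : ℤˣ) :
    M.loss (combine S T f g x) y ∈ Set.Icc (0 : ℝ) 1 := by
  rcases combine_cases hST hU f g x with h | h <;> rw [h]
  · exact hM f hf x y
  · exact hM g hg x y

theorem integrable_loss_combine (hM : M.Bounded) (hm : M.MeasurableLoss) {S T : Set 𝒳}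
    (hS : MeasurableSet S) (hT : MeasurableSet T) (hST : Disjoint S T) (hU : S ∪ T = Set.univ)
    {f g : 𝒳 → ℝ} (hf : f ∈ M.H) (hg : g ∈ M.H) (ν : Measure (𝒳 × ℤˣ)) [IsFiniteMeasure ν] :
    Integrable (fun v : 𝒳 × ℤˣ => M.loss (combine S T f g v.1) v.2) ν :=
  integrable_of_bounded (measurable_loss_combine hm hS hT hST hf hg) fun v => by
    have h := loss_combine_mem hM hST hU hf hg v.1 v.2
    rw [abs_of_nonneg h.1]
    exact h.2

theorem card_mul_empRisk (z : ℕ → Sample 𝒳) (p : ℕ → ℝ) (t : ℕ) (S : Set 𝒳) (f : 𝒳 → ℝ) :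
    ((visits z t S).card : ℝ) * empRisk M z p t S f =
      ∑ s ∈ visits z t S, coin z p s / p s * M.loss (f (z s).1.1) (z s).1.2 := by
  unfold empRisk
  by_cases h0 : ((visits z t S).card : ℝ) = 0
  · have h1 : visits z t S = ∅ := by simpa using h0
    simp [h1]
  · rw [mul_div_cancel₀ _ h0]

/-- The two sides separate, so minimizing on each side minimizes over all pairs of hypotheses. -/
theorem card_mul_empRisk_combine (z : ℕ → Sample 𝒳) (p : ℕ → ℝ) (t : ℕ) (d : Fin D) (a : ℝ)
    (f g : 𝒳 → ℝ) :
    ((visits z t Set.univ).card : ℝ) * empRisk M z p t Set.univ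
      (combine (leftPart Set.univ d a) (rightPart Set.univ d a) f g) =
    (visits z t (leftPart Set.univ d a)).card * empRisk M z p t (leftPart Set.univ d a) f +
    (visits z t (rightPart Set.univ d a)).card * empRisk M z p t (rightPart Set.univ d a) g := by
  classical
  have hd := disjoint_leftPart_rightPart (Set.univ : Set 𝒳) d a
  have hV : visits z t Set.univ =
      visits z t (leftPart Set.univ d a) ∪ visits z t (rightPart Set.univ d a) := by
    ext s
    rw [Finset.mem_union, mem_visits, mem_visits, mem_visits, ← and_or_left]
    have : (z s).1.1 ∈ leftPart Set.univ d a ∪ rightPart Set.univ d a := by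
      rw [leftPart_union_rightPart]; exact Set.mem_univ _
    exact and_congr_right fun _ => iff_of_true (Set.mem_univ _) this
  have hdisj : Disjoint (visits z t (leftPart Set.univ d a))
      (visits z t (rightPart Set.univ d a)) := by
    refine Finset.disjoint_left.2 fun s h1 h2 => ?_
    exact Set.disjoint_left.1 hd (mem_visits.1 h1).2 (mem_visits.1 h2).2
  rw [card_mul_empRisk, card_mul_empRisk, card_mul_empRisk, hV, Finset.sum_union hdisj]
  congr 1
  · refine Finset.sum_congr rfl fun s hs => ?_
    have hs' := (mem_visits.1 hs).2
    rw [combine_of_mem_left hs' (Set.disjoint_left.1 hd hs')]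
  · refine Finset.sum_congr rfl fun s hs => ?_
    have hs' := (mem_visits.1 hs).2
    rw [combine_of_mem_right (Set.disjoint_right.1 hd hs') hs']

/-- Since nothing has been eliminated yet, the request probability also dominates loss differences
of piecewise predictors built from `H`. -/
theorem reqAt_of_splitting {t s : ℕ} (h : Splitting M A z cut t) (hs : s ≤ t + 1) :
    reqAt M A z cut s = M.reqProb M.H (z s).1.1 := by
  unfold reqAt State.reqProb
  rw [(h.mono (by omega : s - 1 ≤ t)).hyp_eq]

theorem observe_p_eq_reqAt {t s : ℕ} (h1 : 1 ≤ s) (h2 : s ≤ t + 1) :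
    ((run M A z cut t).observe M z (t + 1)).p s = reqAt M A z cut s := by
  have hpt : (run M A z cut (t + 1)).p = ((run M A z cut t).observe M z (t + 1)).p := by
    rw [run, step_p]
  rw [← hpt]
  exact run_p_eq_reqAt h1 h2

theorem sqrt_mul_eq {σ N : ℝ} (hN : 0 < N) : √(2 * σ * N) = N * √(2 * σ / N) := by
  rw [show 2 * σ * N = N ^ 2 * (2 * σ / N) by field_simp, Real.sqrt_mul (by positivity),
    Real.sqrt_sq hN.le]

variable [IsProbabilityMeasure M.dist] {n : ℕ} {σ η ρ : ℝ} {d₀ : Fin D} {a₀ : ℝ}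

/-- A split of the whole input space improves the best-in-class loss by about `ρ / 2`. -/
theorem Typical.gain_of_gap_le (hM : M.Bounded) (hm : M.MeasurableLoss)
    (hne : M.H.Nonempty) (hbest : ∀ S, MeasurableSet S → M.IsBestOn S (hstar S))
    (hty : Typical M A z cut hstar n σ η d₀ a₀) (hn : 1 ≤ n) (hσ : σ = slack M A)
    {t : ℕ} (htT : t + 1 ≤ A.T) (hsp : Splitting M A z cut t) (d : Fin D) (a : ℝ)
    (hgap : ρ / 2 ≤ gap M A z ((run M A z cut t).observe M z (t + 1)).p (t + 1) Set.univ d a) :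
    M.lossOn (leftPart Set.univ d a) (hstar (leftPart Set.univ d a)) +
      M.lossOn (rightPart Set.univ d a) (hstar (rightPart Set.univ d a)) ≤
      M.risk (hstar Set.univ) - ρ / 2 + η := by
  unfold gap at hgap
  set p := ((run M A z cut t).observe M z (t + 1)).p
  set L := leftPart (Set.univ : Set 𝒳) d a
  set R := rightPart (Set.univ : Set 𝒳) d a
  have hL : MeasurableSet L := measurableSet_leftPart MeasurableSet.univ d a
  have hR : MeasurableSet R := measurableSet_rightPart MeasurableSet.univ d a
  have hLR : Disjoint L R := disjoint_leftPart_rightPart _ d a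
  have hU : L ∪ R = Set.univ := leftPart_union_rightPart _ d a
  set fl := erm M z p (t + 1) L
  set fr := erm M z p (t + 1) R
  have hfl : fl ∈ M.H := (erm_isERM hne z p (t + 1) L).1
  have hfr : fr ∈ M.H := (erm_isERM hne z p (t + 1) R).1
  have hh : hstar Set.univ ∈ M.H := (hbest _ MeasurableSet.univ).1
  have hp : ∀ s ∈ visits z (t + 1) Set.univ, p s = reqAt M A z cut s := fun s hs =>
    observe_p_eq_reqAt (mem_visits.1 hs).1.1 (mem_visits.1 hs).1.2
  have hφ : ∀ s ∈ visits z (t + 1) Set.univ, ∀ y,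
      |M.lossDiff (hstar Set.univ) (combine L R fl fr) ((z s).1.1, y)| ≤ reqAt M A z cut s := by
    intro s hs y
    rw [reqAt_of_splitting hsp (mem_visits.1 hs).1.2]
    unfold Problem.lossDiff
    rcases combine_cases hLR hU fl fr (z s).1.1 with h | h <;> simp only [h]
    · exact M.le_reqProb hh hfl _ y
    · exact M.le_reqProb hh hfr _ y
  have h1 := card_mul_empRisk_sub hp hφ
  have h2 := hty.deviation_split_le hn d a fl hfl fr hfr (t + 1) htT
  have h3 := (erm_isERM hne z p (t + 1) Set.univ).2 _ hh
  have hN : (0 : ℝ) < (t + 1 : ℕ) := by positivity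
  rw [sqrt_mul_eq hN] at h2
  rw [card_visits_univ] at h1 hgap
  rw [mass_univ, one_mul, ← hσ] at hgap
  have h4 : ∫ v, M.lossDiff (hstar Set.univ) (combine L R fl fr) v ∂(M.distOn Set.univ) =
      M.risk (hstar Set.univ) - M.risk (combine L R fl fr) := by
    rw [distOn_univ]
    exact integral_sub (hM.integrable hm hh _)
      (integrable_loss_combine hM hm hL hR hLR hU hfl hfr _)
  rw [h4] at h1
  have h5 : M.risk (combine L R fl fr) = M.lossOn L fl + M.lossOn R fr := by
    rw [← lossOn_combine hM hm hL hR hLR hfl hfr, hU, lossOn_univ]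
  have h6 := lossOn_best_le hbest hL hfl
  have h7 := lossOn_best_le hbest hR hfr
  set s := √(2 * σ / (t + 1 : ℕ))
  set e1 := empRisk M z p (t + 1) Set.univ (hstar Set.univ)
  set e2 := empRisk M z p (t + 1) Set.univ (combine L R fl fr)
  -- The width subtracted in the gap cancels exactly against the deviation, and only `η` remains.
  -- For this reason the deviation bound for splits carries no factor `13/10`.
  have h8 : ((t + 1 : ℕ) : ℝ) * (e1 - e2) ≤ ((t + 1 : ℕ) : ℝ) * (s + η +
      (M.risk (hstar Set.univ) - M.risk (combine L R fl fr))) := by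
    rw [h1]
    have h9 : deviation M z (reqAt M A z cut) (M.lossDiff (hstar Set.univ) (combine L R fl fr))
      (t + 1) Set.univ ≤ ((t + 1 : ℕ) : ℝ) * s + ((t + 1 : ℕ) : ℝ) * η := h2
    linarith
  have h9 := le_of_mul_le_mul_left h8 hN
  linarith

/-- If the whole input space is still one region at the end of the split phase, then it is split
now. -/
theorem Typical.gap_witness (hM : M.Bounded) (hm : M.MeasurableLoss)
    (hne : M.H.Nonempty) (hbest : ∀ S, MeasurableSet S → M.IsBestOn S (hstar S))
    (hty : Typical M A z cut hstar n σ η d₀ a₀) (hσ : σ = slack M A)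
    (hw : ρ ≤ M.riskOn Set.univ (hstar Set.univ) - M.riskOn Set.univ
      (combine (leftPart Set.univ d₀ a₀) (rightPart Set.univ d₀ a₀)
        (hstar (leftPart Set.univ d₀ a₀)) (hstar (rightPart Set.univ d₀ a₀))))
    {t : ℕ} (htT : t + 1 ≤ A.T) (hsp : Splitting M A z cut t)
    (hlarge : √(2 * σ / (t + 1 : ℕ)) ≤ ρ / 4) :
    ρ / 2 ≤ gap M A z ((run M A z cut t).observe M z (t + 1)).p (t + 1) Set.univ d₀ a₀ := by
  unfold gap
  set p := ((run M A z cut t).observe M z (t + 1)).p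
  have hcomb := fun f g => card_mul_empRisk_combine (M := M) z p (t + 1) d₀ a₀ f g
  set L := leftPart (Set.univ : Set 𝒳) d₀ a₀
  set R := rightPart (Set.univ : Set 𝒳) d₀ a₀
  have hL : MeasurableSet L := measurableSet_leftPart MeasurableSet.univ d₀ a₀
  have hR : MeasurableSet R := measurableSet_rightPart MeasurableSet.univ d₀ a₀
  have hLR : Disjoint L R := disjoint_leftPart_rightPart _ d₀ a₀
  have hU : L ∪ R = Set.univ := leftPart_union_rightPart _ d₀ a₀
  have hl : hstar L ∈ M.H := (hbest L hL).1
  have hr : hstar R ∈ M.H := (hbest R hR).1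
  have hN : (0 : ℝ) < (t + 1 : ℕ) := by positivity
  set fh := erm M z p (t + 1) Set.univ
  have hfh : fh ∈ M.H := (erm_isERM hne z p (t + 1) Set.univ).1
  have hp : ∀ s ∈ visits z (t + 1) Set.univ, p s = reqAt M A z cut s := fun s hs =>
    observe_p_eq_reqAt (mem_visits.1 hs).1.1 (mem_visits.1 hs).1.2
  have hφ : ∀ s ∈ visits z (t + 1) Set.univ, ∀ y,
      |M.lossDiff (combine L R (hstar L) (hstar R)) fh ((z s).1.1, y)| ≤ reqAt M A z cut s := by
    intro s hs y
    rw [reqAt_of_splitting hsp (mem_visits.1 hs).1.2]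
    unfold Problem.lossDiff
    rcases combine_cases hLR hU (hstar L) (hstar R) (z s).1.1 with h | h <;> simp only [h]
    · exact M.le_reqProb hl hfh _ y
    · exact M.le_reqProb hr hfh _ y
  have h1 := card_mul_empRisk_sub hp hφ
  have h2 := hty.deviation_witness_le fh hfh (t + 1) htT
  rw [sqrt_mul_eq hN] at h2
  rw [card_visits_univ] at h1 ⊢
  rw [mass_univ, one_mul, ← hσ]
  have h4 : ∫ v, M.lossDiff (combine L R (hstar L) (hstar R)) fh v ∂(M.distOn Set.univ) =
      M.riskOn Set.univ (combine L R (hstar L) (hstar R)) - M.riskOn Set.univ fh :=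
    integral_sub (integrable_loss_combine hM hm hL hR hLR hU hl hr _) (hM.integrable hm hfh _)
  rw [h4] at h1
  have h5 := (hbest _ MeasurableSet.univ).2 fh hfh
  -- The gap is computed with the minimizers of the two sides, which do at least as well empirically
  -- as the best hypotheses of the two sides.
  have h6 : empRisk M z p (t + 1) Set.univ (combine L R (erm M z p (t + 1) L)
      (erm M z p (t + 1) R)) ≤ empRisk M z p (t + 1) Set.univ (combine L R (hstar L) (hstar R)) := by
    refine le_of_mul_le_mul_left ?_ hN
    have e1 := hcomb (erm M z p (t + 1) L) (erm M z p (t + 1) R)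
    have e2 := hcomb (hstar L) (hstar R)
    rw [card_visits_univ] at e1 e2
    rw [e1, e2]
    exact add_le_add
      (mul_le_mul_of_nonneg_left ((erm_isERM hne z p (t + 1) L).2 _ hl) (Nat.cast_nonneg _))
      (mul_le_mul_of_nonneg_left ((erm_isERM hne z p (t + 1) R).2 _ hr) (Nat.cast_nonneg _))
  set s := √(2 * σ / (t + 1 : ℕ))
  set e1 := empRisk M z p (t + 1) Set.univ (combine L R (hstar L) (hstar R))
  set e2 := empRisk M z p (t + 1) Set.univ fh
  -- One width is lost to the deviation and one is subtracted in the gap; `ρ - 2 · ρ/4 = ρ/2` is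
  -- left.
  have h8 : ((t + 1 : ℕ) : ℝ) * (e1 - e2) ≤ ((t + 1 : ℕ) : ℝ) * (s +
      (M.riskOn Set.univ (combine L R (hstar L) (hstar R)) - M.riskOn Set.univ fh)) := by
    rw [h1]
    have h9 : deviation M z (reqAt M A z cut) (M.lossDiff (combine L R (hstar L) (hstar R)) fh)
      (t + 1) Set.univ ≤ ((t + 1 : ℕ) : ℝ) * s := h2
    linarith
  have h9 := le_of_mul_le_mul_left h8 hN
  linarith

/-- By the end of the split phase of a typical run, the best-in-class loss has improved by about
`ρ / 2`. -/
theorem Typical.bestLoss_le (hM : M.Bounded) (hm : M.MeasurableLoss)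
    (hne : M.H.Nonempty) (hbest : ∀ S, MeasurableSet S → M.IsBestOn S (hstar S))
    (hty : Typical M A z cut hstar n σ η d₀ a₀) (hn : 1 ≤ n) (hσ : σ = slack M A)
    (hκ : 2 ≤ A.κ) (hτ : 1 ≤ A.τ) (hτT : A.τ ≤ A.T)
    (hγ : A.γ = fun S => M.mass S * ρ / 2) (hmax : MaximizesGap M A z cut)
    (hw : ρ ≤ M.riskOn Set.univ (hstar Set.univ) - M.riskOn Set.univ
      (combine (leftPart Set.univ d₀ a₀) (rightPart Set.univ d₀ a₀)
        (hstar (leftPart Set.univ d₀ a₀)) (hstar (rightPart Set.univ d₀ a₀))))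
    (hlarge : √(2 * σ / A.τ) ≤ ρ / 4) :
    M.bestLoss hstar (run M A z cut A.τ) ≤ M.risk (hstar Set.univ) - ρ / 2 + η := by
  have hidx : ∀ t, (run M A z cut t).K = 1 →
      (run M A z cut t).region ((run M A z cut t).index (z (t + 1)).1.1) = Set.univ := by
    intro t hK
    have h1 := ((run_partition M A z cut t).index_spec (z (t + 1)).1.1).1
    rw [show (run M A z cut t).index (z (t + 1)).1.1 = 0 by omega]
    exact region_eq_univ (run_partition M A z cut t) hK
  have hγu : A.γ Set.univ = ρ / 2 := by rw [hγ]; beta_reduce; rw [mass_univ, one_mul]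
  have main : ∀ t, t + 1 ≤ A.τ → (run M A z cut t).K = 1 →
      A.γ ((run M A z cut t).region ((run M A z cut t).index (z (t + 1)).1.1)) ≤
        gap M A z ((run M A z cut t).observe M z (t + 1)).p (t + 1)
          ((run M A z cut t).region ((run M A z cut t).index (z (t + 1)).1.1))
          (cut (t + 1)).1 (cut (t + 1)).2 →
      run M A z cut (t + 1) = ((run M A z cut t).observe M z (t + 1)).split M
        ((run M A z cut t).index (z (t + 1)).1.1) (cut (t + 1)).1 (cut (t + 1)).2 →
      M.bestLoss hstar (run M A z cut A.τ) ≤ M.risk (hstar Set.univ) - ρ / 2 + η := by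
    intro t ht hK hgap hrun
    refine (bestLoss_antitone hM hm hbest ht).trans ?_
    have h1 := sum_split (M := M) ((run M A z cut t).observe M z (t + 1))
      ((run_partition M A z cut t).index_spec (z (t + 1)).1.1).1 (cut (t + 1)).1
      (cut (t + 1)).2 (fun S => M.lossOn S (hstar S))
    simp only [observe_region, observe_K] at h1
    have h2 := bestLoss_eq_of_one (M := M) (hstar := hstar) hK
    unfold Problem.bestLoss at h2
    beta_reduce
    rw [hrun]
    unfold Problem.bestLoss
    rw [h1, h2, hidx t hK, lossOn_univ]
    rw [hidx t hK, hγu] at hgap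
    have h3 := hty.gain_of_gap_le hM hm hne hbest hn hσ (by omega)
      ⟨ht, by omega⟩ (cut (t + 1)).1 (cut (t + 1)).2 hgap
    linarith
  -- Either the whole space is split in some round up to `τ`, and the executed split has passed the
  -- threshold, or it would have to survive unsplit through round `τ`.
  by_cases hex : ∃ t, t + 1 ≤ A.τ ∧ (run M A z cut t).K = 1 ∧ (run M A z cut (t + 1)).K ≠ 1
  · obtain ⟨t, ht, hK, hK'⟩ := hex
    have hsp : Splitting M A z cut t := ⟨ht, by omega⟩
    rcases step_cases M A z (cut (t + 1)) (t + 1) (run M A z cut t) with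
      ⟨-, -, h2, h⟩ | ⟨-, -, -, h⟩ | ⟨h0, -⟩
    · exact main t ht hK h2 (by rw [run]; exact h)
    · exact absurd (by rw [run, h]; exact hK) hK'
    · exact absurd hsp h0
  · push Not at hex
    have hall : ∀ t ≤ A.τ, (run M A z cut t).K = 1 := by
      intro t
      induction t with
      | zero => intro _; rfl
      | succ t ih => intro ht; exact hex t ht (ih (by omega))
    -- In round `τ` the witness has gap at least `ρ/2`, and the chosen cut has a gap at least as
    -- large, so a split happens after all.
    obtain ⟨t, ht⟩ : ∃ t, A.τ = t + 1 := ⟨A.τ - 1, by omega⟩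
    have hK := hall t (by omega)
    have hsp : Splitting M A z cut t := ⟨by omega, by omega⟩
    have h1 := hty.gap_witness hM hm hne hbest hσ hw (by omega) hsp (by rw [← ht]; exact hlarge)
    have h2 := hmax t hsp.1 hsp.2 d₀ a₀
    simp only at h2
    rcases step_cases M A z (cut (t + 1)) (t + 1) (run M A z cut t) with
      ⟨-, -, h3, h⟩ | ⟨-, -, h3, -⟩ | ⟨h0, -⟩
    · exact main t hsp.1 hK h3 (by rw [run]; exact h)
    · refine absurd ?_ h3
      refine le_trans ?_ h2
      rw [hidx t hK, hγu]
      exact h1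
    · exact absurd hsp h0

end FirstSplit

end ARBAL

/-! ### The generalization bound on typical runs -/

namespace ARBAL

section Risk

variable {D : ℕ} {𝒳 : Set (Fin D → ℝ)} {M : Problem 𝒳} {A : Params 𝒳} {z : ℕ → Sample 𝒳}
  {cut : ℕ → Fin D × ℝ} {hstar : Set 𝒳 → 𝒳 → ℝ}

theorem sum_mass_eq_one [IsProbabilityMeasure M.dist] {st : State 𝒳} (hst : st.Partition)
    (hmeas : ∀ k < st.K, MeasurableSet (st.region k)) :
    ∑ k ∈ Finset.range st.K, M.mass (st.region k) = 1 := by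
  have := marginal_isProbabilityMeasure M
  have hunion : (⋃ k ∈ Finset.range st.K, st.region k) = Set.univ := by
    ext x
    simp only [Set.mem_iUnion, Set.mem_univ, iff_true]
    have := hst.index_spec x
    exact ⟨_, Finset.mem_range.2 this.1, this.2⟩
  have h := measureReal_biUnion_finset (μ := M.marginal) (s := Finset.range st.K)
    (f := fun k => st.region k)
    (fun i hi j hj hij => Set.disjoint_left.2 fun x hxi hxj => hij
      ((hst.index_eq (Finset.mem_range.1 hi) hxi).symm.trans
        (hst.index_eq (Finset.mem_range.1 hj) hxj)))
    (fun k hk => hmeas k (Finset.mem_range.1 hk))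
  rw [hunion] at h
  exact h.symm.trans (mass_univ M)

theorem sum_sqrt_le {K : ℕ} {q : ℕ → ℝ} (hq : ∀ k < K, 0 ≤ q k)
    (hsum : ∑ k ∈ Finset.range K, q k = 1) : ∑ k ∈ Finset.range K, √(q k) ≤ √K := by
  refine Real.le_sqrt_of_sq_le ?_
  refine (sq_sum_le_card_mul_sum_sq).trans (le_of_eq ?_)
  rw [Finset.card_range, Finset.sum_congr rfl fun k hk => Real.sq_sqrt (hq k (Finset.mem_range.1 hk)),
    hsum, mul_one]

/-- A width in terms of visits, weighted by the mass `q`, becomes a width in terms of rounds. The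
factor `412/1000` is `63/100 - (109/100)/5`, what the visit bound leaves when `5σ ≤ q t`. -/
theorem mul_sqrt_le_of_card {q σ N t a b : ℝ} (hq : 0 ≤ q) (hσ : 0 ≤ σ) (ht : 0 < t)
    (hb : 0 ≤ b)
    (hN : 412 / 1000 * q * t ≤ N) (hN' : 0 < N) (hab : 2 * a ^ 2 ≤ 412 / 1000 * b ^ 2) :
    q * (a * √(2 * σ / N)) ≤ b * √(σ * q / t) := by
  refine le_of_sq_le_sq ?_ (by positivity)
  rw [mul_pow, mul_pow, mul_pow, Real.sq_sqrt (by positivity), Real.sq_sqrt (by positivity)]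
  rw [show q ^ 2 * (a ^ 2 * (2 * σ / N)) = q ^ 2 * (a ^ 2 * (2 * σ)) / N by ring,
    show b ^ 2 * (σ * q / t) = b ^ 2 * (σ * q) / t by ring, div_le_div_iff₀ hN' ht]
  have h1 : (b ^ 2 * (σ * q)) * (412 / 1000 * q * t) ≤ b ^ 2 * (σ * q) * N :=
    mul_le_mul_of_nonneg_left hN (by positivity)
  have h2 : (2 * a ^ 2) * (q ^ 2 * σ * t) ≤ (412 / 1000 * b ^ 2) * (q ^ 2 * σ * t) :=
    mul_le_mul_of_nonneg_right hab (by positivity)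
  linarith

variable [IsProbabilityMeasure M.dist] {n : ℕ} {σ η ρ : ℝ} {d₀ : Fin D} {a₀ : ℝ}

/-- The best-in-class loss on the final regions of a typical run. -/
theorem Typical.bestLoss_final_le (hM : M.Bounded) (hm : M.MeasurableLoss)
    (hne : M.H.Nonempty) (hbest : ∀ S, MeasurableSet S → M.IsBestOn S (hstar S))
    (hty : Typical M A z cut hstar n σ η d₀ a₀) (hn : A.κ ≤ n + 1) (hσ : σ = slack M A)
    (hσ0 : 0 < σ) (hτ : 1 ≤ A.τ) (hτT : A.τ ≤ A.T)
    (hγ : A.γ = fun S => M.mass S * ρ / 2) (hmax : MaximizesGap M A z cut) (hρ : 0 < ρ)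
    {c : ℝ} (hc : 0 < c) (hc' : c < 1 / 2)
    (hlog : Real.logb (1 / c) (A.τ / (2 * σ * (4 / ρ + 1) ^ 2)) ≤ A.κ - 1)
    (hη : η * A.T ≤ σ)
    (hw : ρ ≤ M.riskOn Set.univ (hstar Set.univ) - M.riskOn Set.univ
      (combine (leftPart Set.univ d₀ a₀) (rightPart Set.univ d₀ a₀)
        (hstar (leftPart Set.univ d₀ a₀)) (hstar (rightPart Set.univ d₀ a₀)))) :
    M.bestLoss hstar (run M A z cut A.T) ≤ M.risk (hstar Set.univ) -
      ρ * c / (2 * (1 - c)) * (1 - 2 * σ * (4 / ρ + 1) ^ 2 / A.τ) := by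
  have hτ0 : (0 : ℝ) < A.τ := by exact_mod_cast hτ
  have hT0 : (A.τ : ℝ) ≤ A.T := by exact_mod_cast hτT
  set u := (4 / ρ + 1) ^ 2 with hu
  have hu0 : 0 < u := by positivity
  -- From `(x + 1)² ≥ 4x` with `x = 4/ρ`. This bound absorbs `η`, and the next one makes the
  -- confidence width at round `τ` small.
  have hu1 : 16 / ρ ≤ u := by
    have h := sq_nonneg (4 / ρ - 1)
    have e : 16 / ρ = 4 * (4 / ρ) := by ring
    rw [hu, e]
    nlinarith
  have hu2 : 16 / ρ ^ 2 ≤ u := by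
    have h : 0 ≤ 4 / ρ := by positivity
    have e : 16 / ρ ^ 2 = (4 / ρ) ^ 2 := by ring
    rw [hu, e]
    nlinarith
  have hC : 0 ≤ ρ * c / (2 * (1 - c)) := by
    have : 0 < 1 - c := by linarith
    positivity
  -- Because `c ≤ 1 - c`, the gain of one split covers the whole claimed improvement.
  have hC' : ρ * c / (2 * (1 - c)) ≤ ρ / 2 := by
    rw [div_le_div_iff₀ (by linarith) two_pos]
    nlinarith
  -- In the first case the claimed gain is nonpositive, and monotonicity of the best loss suffices.
  by_cases hβ : 1 ≤ 2 * σ * u / A.τ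
  · have h1 := bestLoss_antitone (A := A) (z := z) (cut := cut) hM hm hbest (Nat.zero_le A.T)
    have h2 : M.bestLoss hstar (run M A z cut 0) = M.risk (hstar Set.univ) :=
      bestLoss_eq_of_one rfl
    simp only [h2] at h1
    have h3 : ρ * c / (2 * (1 - c)) * (1 - 2 * σ * u / A.τ) ≤ 0 :=
      mul_nonpos_of_nonneg_of_nonpos hC (by linarith)
    linarith
  · rw [not_le] at hβ
    have h2σ : 2 * σ * u < A.τ := by rwa [div_lt_one hτ0] at hβ
    -- The logarithm is positive here, so its bound `κ - 1` is positive and the first split is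
    -- permitted.
    have hκ : 2 ≤ A.κ := by
      have h1 : 0 < Real.logb (1 / c) (A.τ / (2 * σ * u)) := by
        refine Real.logb_pos ?_ ?_
        · rw [lt_div_iff₀ hc]; linarith
        · rw [lt_div_iff₀ (by positivity)]; linarith
      have h2 : (1 : ℝ) < A.κ := by linarith
      exact_mod_cast h2
    have hlarge : √(2 * σ / A.τ) ≤ ρ / 4 := by
      refine Real.sqrt_le_iff.2 ⟨by positivity, ?_⟩
      rw [div_le_iff₀ hτ0]
      have h1 : 2 * σ * (16 / ρ ^ 2) ≤ A.τ :=
        (mul_le_mul_of_nonneg_left hu2 (by positivity)).trans h2σ.le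
      calc 2 * σ = (2 * σ * (16 / ρ ^ 2)) * (ρ ^ 2 / 16) := by field_simp
        _ ≤ A.τ * (ρ ^ 2 / 16) := mul_le_mul_of_nonneg_right h1 (by positivity)
        _ = (ρ / 4) ^ 2 * A.τ := by ring
    have h1 := hty.bestLoss_le hM hm hne hbest (by omega) hσ hκ hτ hτT hγ hmax hw hlarge
    have h2 := bestLoss_antitone (A := A) (z := z) (cut := cut) hM hm hbest hτT
    simp only at h2
    have h3 : ρ * c / (2 * (1 - c)) * (1 - 2 * σ * u / A.τ) ≤ ρ / 2 * (1 - 2 * σ * u / A.τ) :=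
      mul_le_mul_of_nonneg_right hC' (by linarith)
    -- The factor `1 - 2σu/τ` leaves the room `ρσu/τ ≥ 16σ/τ`, far more than the discretization
    -- error, since `η T ≤ σ`.
    have h4 : η ≤ ρ / 2 * (2 * σ * u / A.τ) := by
      have h5 : η * A.τ ≤ ρ * σ * u := by
        have h6 : ρ * σ * (16 / ρ) ≤ ρ * σ * u := mul_le_mul_of_nonneg_left hu1 (by positivity)
        have h7 : ρ * σ * (16 / ρ) = 16 * σ := by field_simp
        rcases le_total 0 η with h | h
        · have := mul_le_mul_of_nonneg_left hT0 h
          linarith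
        · have := mul_nonpos_of_nonpos_of_nonneg h hτ0.le
          linarith
      rw [show ρ / 2 * (2 * σ * u / A.τ) = ρ * σ * u / A.τ by ring, le_div_iff₀ hτ0]
      exact h5
    linarith

/-- In a typical run, empirical risk minimization on the final regions is almost optimal. -/
theorem Typical.risk_predictor_le (hM : M.Bounded) (hm : M.MeasurableLoss)
    (hbest : ∀ S, MeasurableSet S → M.IsBestOn S (hstar S))
    (hty : Typical M A z cut hstar n σ η d₀ a₀) (hn : A.κ ≤ n + 1) (hκ : 1 ≤ A.κ)
    (hσ : σ = slack M A) (hσ0 : 0 < σ) (hT : 1 ≤ A.T) {hhat : ℕ → 𝒳 → ℝ}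
    (hhat_erm : ∀ k < (run M A z cut A.T).K, IsERM M z (run M A z cut A.T).p A.T
      ((run M A z cut A.T).hyp k) ((run M A z cut A.T).region k) (hhat k)) :
    M.risk ((run M A z cut A.T).predictor hhat) ≤ M.bestLoss hstar (run M A z cut A.T) +
      2 * √(8 * (run M A z cut A.T).K * σ / A.T) + 16 * (run M A z cut A.T).K * σ / A.T := by
  have hsurv := hty.survival hM hm hbest hn hκ hσ le_rfl
  have hpart := run_partition M A z cut A.T
  have hmeas := run_region_measurableSet (M := M) (A := A) (z := z) (cut := cut) A.T
  have hsub := run_hyp_subset (M := M) (A := A) (z := z) (cut := cut) A.T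
  have hT0 : (0 : ℝ) < A.T := by exact_mod_cast hT
  rw [risk_predictor hM hm hpart hmeas fun k hk => hsub k (hhat_erm k hk).1]
  set st := run M A z cut A.T with hst
  -- Heavy regions are charged through concentration, light ones through their mass, which is below
  -- `5σ/T`.
  have hloc : ∀ k < st.K, M.lossOn (st.region k) (hhat k) ≤
      M.lossOn (st.region k) (hstar (st.region k)) + 3 * √(σ / A.T) * √(M.mass (st.region k)) +
        5 * σ / A.T := by
    intro k hk
    have hq := mass_nonneg M (st.region k)
    have hh := hsub k (hhat_erm k hk).1
    have h5 : 0 ≤ 5 * σ / A.T := by positivity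
    have h3 : 0 ≤ 3 * √(σ / A.T) * √(M.mass (st.region k)) := by positivity
    by_cases hgood : 5 * σ ≤ M.mass (st.region k) * A.T
    · obtain ⟨hmem, -⟩ := hsurv k hk hgood
      have hbox : IsBox n (st.region k) := IsBox.of_run hn hκ hk
      have hcard := hty.le_card _ hbox A.T le_rfl
      set N : ℝ := ((visits z A.T (st.region k)).card : ℝ) with hN
      have hN1 : 412 / 1000 * M.mass (st.region k) * A.T ≤ N := by linarith
      have hN0 : 0 < N := by linarith
      have hcmp := empRisk_sub_le hM hm (f := hstar (st.region k)) (g := hhat k)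
        (hbest _ (hmeas k hk)).1 hh (p := st.p) (p' := reqAt M A z cut) (t := A.T)
        (S := st.region k) (σ := σ)
        (fun s hs => run_p_eq_reqAt (mem_visits.1 hs).1.1 (mem_visits.1 hs).1.2)
        (fun s hs y => by
          obtain ⟨⟨h1, h2⟩, h3⟩ := mem_visits.1 hs
          obtain ⟨s, rfl⟩ : ∃ r, s = r + 1 := ⟨s - 1, by omega⟩
          exact loss_sub_le_run_p (by omega) hk h3 hmem (hhat_erm k hk).1 y)
        (hty.deviation_le _ hbox hgood _ (hbest _ (hmeas k hk)).1 _ hh _ le_rfl)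
        (by rw [hN] at hN0; exact_mod_cast hN0.ne')
      have herm := (hhat_erm k hk).2 _ hmem
      have hr : M.riskOn (st.region k) (hhat k) ≤ M.riskOn (st.region k) (hstar (st.region k)) +
          13 / 10 * √(2 * σ / N) := by linarith
      have hr' := mul_le_mul_of_nonneg_left hr hq
      rw [mul_add, ← lossOn_eq (hmeas k hk), ← lossOn_eq (hmeas k hk)] at hr'
      -- The numbers fit because `2 · (13/10)² = 3.38` is below `0.412 · 3² = 3.708`.
      have h6 := mul_sqrt_le_of_card (a := 13 / 10) (b := 3) hq hσ0.le hT0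
        (by norm_num) hN1 hN0 (by norm_num)
      rw [show σ * M.mass (st.region k) / A.T = σ / A.T * M.mass (st.region k) by ring,
        Real.sqrt_mul (by positivity), ← mul_assoc] at h6
      linarith
    · have h1 := hM.lossOn_le_mass hm hh (hmeas k hk)
      have h2 := hM.lossOn_nonneg (hbest _ (hmeas k hk)).1 (st.region k)
      have h4 : M.mass (st.region k) ≤ 5 * σ / A.T := by
        rw [le_div_iff₀ hT0]; linarith
      linarith
  refine (Finset.sum_le_sum fun k hk => hloc k (Finset.mem_range.1 hk)).trans ?_
  rw [Finset.sum_add_distrib, Finset.sum_add_distrib, ← Finset.mul_sum, Finset.sum_const,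
    Finset.card_range, nsmul_eq_mul]
  have h1 := sum_sqrt_le (fun k _ => mass_nonneg M (st.region k)) (sum_mass_eq_one hpart hmeas)
  -- Cauchy–Schwarz replaces the sum of `√q` by `√K`, and `3 ≤ 2√8`.
  have h2 : 3 * √(σ / A.T) * ∑ k ∈ Finset.range st.K, √(M.mass (st.region k)) ≤
      2 * √(8 * st.K * σ / A.T) := by
    have e : √(8 * st.K * σ / A.T) = √8 * (√(σ / A.T) * √st.K) := by
      rw [← Real.sqrt_mul (by positivity), ← Real.sqrt_mul (by norm_num)]
      congr 1; ring
    have h8 : 3 / 2 ≤ √8 := Real.le_sqrt_of_sq_le (by norm_num)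
    have h9 : 0 ≤ √(σ / A.T) * √st.K := by positivity
    have h10 := mul_le_mul_of_nonneg_left h1 (show 0 ≤ 3 * √(σ / A.T) by positivity)
    have h11 := mul_le_mul_of_nonneg_right h8 h9
    rw [e]
    linarith
  have h3 : (st.K : ℝ) * (5 * σ / A.T) ≤ 16 * st.K * σ / A.T := by
    rw [← mul_div_assoc]
    refine div_le_div_of_nonneg_right ?_ hT0.le
    have : 0 ≤ (st.K : ℝ) * σ := by positivity
    linarith
  unfold Problem.bestLoss
  linarith

end Risk

end ARBAL

/-! ### Disagreement and the expected number of labels -/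

namespace ARBAL

section Disagreement

variable {D : ℕ} {𝒳 : Set (Fin D → ℝ)} {M : Problem 𝒳}

/-- The infimum in the disagreement coefficient is attained: dividing by `r` turns each constraint
into a lower bound for `θ`. -/
theorem lintegral_le_disagreementCoeff_mul (ν : Measure (𝒳 × ℤˣ)) (h₀ : 𝒳 → ℝ) {r : ℝ}
    (hr : 0 < r) :
    ∫⁻ x, (⨆ h ∈ M.H, ⨆ (_ : M.rho ν h h₀ ≤ r), ⨆ y : ℤˣ,
      ENNReal.ofReal |M.loss (h x) y - M.loss (h₀ x) y|) ∂(ν.map Prod.fst) ≤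
        M.disagreementCoeff ν h₀ * ENNReal.ofReal r := by
  have hr0 : ENNReal.ofReal r ≠ 0 := (ENNReal.ofReal_pos.2 hr).ne'
  rw [← ENNReal.div_le_iff hr0 ENNReal.ofReal_ne_top]
  refine le_sInf fun θ hθ => ?_
  rw [ENNReal.div_le_iff hr0 ENNReal.ofReal_ne_top]
  exact hθ r hr

/-- The triangle inequality through `h₀` compares two members of `V`, whence the factor two. -/
theorem ofReal_reqProb_le {ν : Measure (𝒳 × ℤˣ)} {V : Finset (𝒳 → ℝ)} {h₀ : 𝒳 → ℝ} {r : ℝ}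
    (hV : V ⊆ M.H) (hVr : ∀ h ∈ V, M.rho ν h h₀ ≤ r) (x : 𝒳) :
    ENNReal.ofReal (M.reqProb V x) ≤ 2 * ⨆ h ∈ M.H, ⨆ (_ : M.rho ν h h₀ ≤ r), ⨆ y : ℤˣ,
      ENNReal.ofReal |M.loss (h x) y - M.loss (h₀ x) y| := by
  set B : ℝ≥0∞ := ⨆ h ∈ M.H, ⨆ (_ : M.rho ν h h₀ ≤ r), ⨆ y : ℤˣ,
      ENNReal.ofReal |M.loss (h x) y - M.loss (h₀ x) y| with hB
  have hle : ∀ h ∈ V, ∀ y, ENNReal.ofReal |M.loss (h x) y - M.loss (h₀ x) y| ≤ B := by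
    intro h hh y
    rw [hB]
    exact le_iSup₂_of_le h (hV hh) (le_iSup₂_of_le (hVr h hh) y le_rfl)
  by_cases htop : B = ⊤
  · rw [htop]; simp
  have hle' : ∀ h ∈ V, ∀ y, |M.loss (h x) y - M.loss (h₀ x) y| ≤ B.toReal := fun h hh y =>
    (ENNReal.ofReal_le_iff_le_toReal htop).1 (hle h hh y)
  refine (ENNReal.ofReal_le_ofReal (M.reqProb_le (c := 2 * B.toReal) (by positivity)
    fun f hf g hg y => ?_)).trans (le_of_eq ?_)
  · have h1 := abs_le.1 (hle' f hf y)
    have h2 := abs_le.1 (hle' g hg y)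
    linarith [h1.2, h2.1]
  · rw [ENNReal.ofReal_mul (by norm_num), ENNReal.ofReal_toReal htop, ENNReal.ofReal_ofNat]

variable [IsProbabilityMeasure M.dist]

theorem marginal_restrict {S : Set 𝒳} (hS : MeasurableSet S) :
    M.marginal.restrict S = ENNReal.ofReal (M.mass S) • (M.distOn S).map Prod.fst := by
  unfold Problem.marginal
  rw [Measure.restrict_map measurable_fst hS, restrict_dist, Measure.map_smul, mass_eq M hS,
    measureReal_def, ENNReal.ofReal_toReal (measure_ne_top _ _)]

theorem lintegral_reqProb_le {S : Set 𝒳} (hS : MeasurableSet S) {V : Finset (𝒳 → ℝ)}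
    {h₀ : 𝒳 → ℝ} {r : ℝ} (hr : 0 < r) (hV : V ⊆ M.H)
    (hVr : ∀ h ∈ V, M.rho (M.distOn S) h h₀ ≤ r) :
    ∫⁻ x in S, ENNReal.ofReal (M.reqProb V x) ∂M.marginal ≤
      M.disagreementCoeff (M.distOn S) h₀ * ENNReal.ofReal (2 * (M.mass S * r)) := by
  rw [marginal_restrict hS, lintegral_smul_measure, smul_eq_mul]
  have h1 := lintegral_mono (μ := (M.distOn S).map Prod.fst)
    fun x => ofReal_reqProb_le (ν := M.distOn S) hV hVr x
  rw [lintegral_const_mul' _ _ (by norm_num)] at h1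
  have h2 := lintegral_le_disagreementCoeff_mul (M := M) (M.distOn S) h₀ hr
  refine (mul_le_mul_right (h1.trans (mul_le_mul_right h2 2)) _).trans (le_of_eq ?_)
  rw [ENNReal.ofReal_mul (by norm_num), ENNReal.ofReal_mul (mass_nonneg M S), ENNReal.ofReal_ofNat]
  ring

/-- Losses are nonnegative, so `|a - b| ≤ a + b`; thus near-optimal hypotheses of small risk are
close to each other. -/
theorem rho_le (hM : M.Bounded) (hm : M.MeasurableLoss) {f g : 𝒳 → ℝ} (hf : f ∈ M.H)
    (hg : g ∈ M.H) (S : Set 𝒳) : M.rho (M.distOn S) f g ≤ M.riskOn S f + M.riskOn S g := by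
  unfold Problem.rho Problem.riskOn
  rw [← integral_add (hM.integrable hm hf _) (hM.integrable hm hg _)]
  refine integral_mono ((hM.integrable hm hf _).sub (hM.integrable hm hg _)).abs
    ((hM.integrable hm hf _).add (hM.integrable hm hg _)) fun v => ?_
  have h1 := (hM f hf v.1 v.2).1
  have h2 := (hM g hg v.1 v.2).1
  exact abs_sub_le_iff.2 ⟨by linarith, by linarith⟩

/-- A good split of the whole space forces some hypothesis to differ from `h*`. This makes the
radius `r_0` positive, so that the disagreement coefficient can be applied at it. -/
theorem riskOn_sub_combine_le (hM : M.Bounded) (hm : M.MeasurableLoss) {f g h : 𝒳 → ℝ}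
    (hf : f ∈ M.H) (hg : g ∈ M.H) (hh : h ∈ M.H) (d : Fin D) (a : ℝ) :
    M.riskOn Set.univ h - M.riskOn Set.univ
      (combine (leftPart Set.univ d a) (rightPart Set.univ d a) f g) ≤
      M.rho M.dist f h + M.rho M.dist g h := by
  have hLR := disjoint_leftPart_rightPart (Set.univ : Set 𝒳) d a
  have hU := leftPart_union_rightPart (Set.univ : Set 𝒳) d a
  have hic := integrable_loss_combine hM hm (measurableSet_leftPart MeasurableSet.univ d a)
    (measurableSet_rightPart MeasurableSet.univ d a) hLR hU hf hg M.dist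
  have hif := hM.integrable hm hf M.dist
  have hig := hM.integrable hm hg M.dist
  have hih := hM.integrable hm hh M.dist
  unfold Problem.riskOn Problem.rho
  rw [distOn_univ, ← integral_sub hih hic, ← integral_add (f := fun v : 𝒳 × ℤˣ => |M.loss (f v.1) v.2 - M.loss (h v.1) v.2|)
    (g := fun v : 𝒳 × ℤˣ => |M.loss (g v.1) v.2 - M.loss (h v.1) v.2|) (hif.sub hih).abs (hig.sub hih).abs]
  refine integral_mono (hih.sub hic) ((hif.sub hih).abs.add (hig.sub hih).abs) fun v => ?_
  have h1 := neg_abs_le (M.loss (f v.1) v.2 - M.loss (h v.1) v.2)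
  have h2 := neg_abs_le (M.loss (g v.1) v.2 - M.loss (h v.1) v.2)
  have h3 := abs_nonneg (M.loss (f v.1) v.2 - M.loss (h v.1) v.2)
  have h4 := abs_nonneg (M.loss (g v.1) v.2 - M.loss (h v.1) v.2)
  beta_reduce
  rcases combine_cases hLR hU f g v.1 with e | e <;> rw [e] <;> linarith

omit [IsProbabilityMeasure M.dist] in
theorem rho_le_iSup (M : Problem 𝒳) (ν : Measure (𝒳 × ℤˣ)) {h : 𝒳 → ℝ} (hh : h ∈ M.H)
    (h₀ : 𝒳 → ℝ) : M.rho ν h h₀ ≤ ⨆ h : M.H, M.rho ν h.1 h₀ :=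
  le_ciSup (f := fun h : M.H => M.rho ν h.1 h₀) (Set.finite_range _).bddAbove ⟨h, hh⟩

theorem lintegral_reqProb_univ_le {V : Finset (𝒳 → ℝ)} (hV : V ⊆ M.H) {h₀ : 𝒳 → ℝ}
    (hr : 0 < ⨆ h : M.H, M.rho M.dist h.1 h₀) :
    ∫⁻ x, ENNReal.ofReal (M.reqProb V x) ∂M.marginal ≤ 2 * M.disagreementCoeff M.dist h₀ *
      ENNReal.ofReal (⨆ h : M.H, M.rho M.dist h.1 h₀) := by
  have h := lintegral_reqProb_le (M := M) MeasurableSet.univ hr hV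
    (h₀ := h₀) (fun h hh => by rw [distOn_univ]; exact rho_le_iSup M _ (hV hh) h₀)
  rw [setLIntegral_univ, distOn_univ, mass_univ, one_mul, ENNReal.ofReal_mul (by norm_num),
    ENNReal.ofReal_ofNat, ← mul_assoc, mul_comm _ (2 : ℝ≥0∞)] at h
  exact h

end Disagreement

section Sums

/-- Telescoping: `1 / √(n + 1) ≤ 2 (√(n + 1) - √n)`. -/
theorem sum_inv_sqrt_le (n : ℕ) : ∑ j ∈ Finset.range n, 1 / √((j : ℝ) + 1) ≤ 2 * √n := by
  induction n with
  | zero => simp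
  | succ n ih =>
    rw [Finset.sum_range_succ]
    have h1 : √((n + 1 : ℕ) : ℝ) = √((n : ℝ) + 1) := by push_cast; rfl
    rw [h1]
    set a := √(n : ℝ)
    set b := √((n : ℝ) + 1)
    have hb : 0 < b := Real.sqrt_pos.2 (by positivity)
    have ha2 : a ^ 2 = n := Real.sq_sqrt (by positivity)
    have hb2 : b ^ 2 = n + 1 := Real.sq_sqrt (by positivity)
    have h2 : 1 / b ≤ 2 * b - 2 * a := by
      rw [div_le_iff₀ hb]
      nlinarith [sq_nonneg (a - b)]
    linarith

/-- For `q > 0` there are at most `u / q + 1` indices with `q j < u`, and each costs `q`. -/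
theorem sum_ite_mul_lt_le {q u : ℝ} (hq : 0 ≤ q) (hu : 0 ≤ u) (n : ℕ) :
    ∑ j ∈ Finset.range n, (if q * j < u then q else 0) ≤ u + q := by
  have hn : ∀ n : ℕ, ∑ j ∈ Finset.range n, (if q * j < u then q else 0) ≤ q * n := by
    intro n
    refine (Finset.sum_le_card_nsmul _ _ q fun j _ => ?_).trans (by simp [mul_comm])
    split_ifs
    · exact le_rfl
    · exact hq
  induction n with
  | zero => simpa using by linarith
  | succ n ih =>
    rw [Finset.sum_range_succ]
    split_ifs with h
    · linarith [hn n]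
    · linarith

end Sums

section Labels

variable {D : ℕ} {𝒳 : Set (Fin D → ℝ)} {M : Problem 𝒳} {A : Params 𝒳} {z : ℕ → Sample 𝒳}
  {cut : ℕ → Fin D × ℝ} {hstar : Set 𝒳 → 𝒳 → ℝ}

variable [IsProbabilityMeasure M.dist]

omit [IsProbabilityMeasure M.dist] in
theorem integral_reqProb_nonneg (st : State 𝒳) : 0 ≤ ∫ x, st.reqProb M x ∂M.marginal :=
  integral_nonneg fun x => M.reqProb_nonneg _ x

omit [IsProbabilityMeasure M.dist] in
theorem lintegral_state_reqProb {st : State 𝒳} (hst : st.Partition)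
    (hmeas : ∀ k < st.K, MeasurableSet (st.region k)) :
    ∫⁻ x, ENNReal.ofReal (st.reqProb M x) ∂M.marginal =
      ∑ k ∈ Finset.range st.K,
        ∫⁻ x in st.region k, ENNReal.ofReal (M.reqProb (st.hyp k) x) ∂M.marginal := by
  have hunion : (⋃ k ∈ Finset.range st.K, st.region k) = Set.univ := by
    ext x
    simp only [Set.mem_iUnion, Set.mem_univ, iff_true]
    have := hst.index_spec x
    exact ⟨_, Finset.mem_range.2 this.1, this.2⟩
  rw [← setLIntegral_univ, ← hunion, lintegral_biUnion_finset
    (fun i hi j hj hij => Set.disjoint_left.2 fun x hxi hxj => hij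
      ((hst.index_eq (Finset.mem_range.1 hi) hxi).symm.trans
        (hst.index_eq (Finset.mem_range.1 hj) hxj)))
    (fun k hk => hmeas k (Finset.mem_range.1 hk))]
  refine Finset.sum_congr rfl fun k hk => ?_
  have hk' := Finset.mem_range.1 hk
  refine setLIntegral_congr_fun (hmeas k hk') fun x hx => ?_
  unfold State.reqProb
  rw [hst.index_eq hk' hx]

omit [IsProbabilityMeasure M.dist] in
theorem ofReal_integral_reqProb_le (st : State 𝒳) :
    ENNReal.ofReal (∫ x, st.reqProb M x ∂M.marginal) ≤
      ∫⁻ x, ENNReal.ofReal (st.reqProb M x) ∂M.marginal := by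
  have h := enorm_integral_le_lintegral_enorm (μ := M.marginal) fun x => st.reqProb M x
  have h0 : ∀ x, 0 ≤ st.reqProb M x := fun x => M.reqProb_nonneg _ x
  rw [Real.enorm_of_nonneg (integral_nonneg h0)] at h
  refine h.trans (le_of_eq (lintegral_congr fun x => Real.enorm_of_nonneg (h0 x)))

theorem setLIntegral_reqProb_le_mass (hM : M.Bounded) {V : Finset (𝒳 → ℝ)} (hV : V ⊆ M.H)
    (S : Set 𝒳) :
    ∫⁻ x in S, ENNReal.ofReal (M.reqProb V x) ∂M.marginal ≤ ENNReal.ofReal (M.mass S) := by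
  have := marginal_isProbabilityMeasure M
  refine (lintegral_mono fun x => (ENNReal.ofReal_le_one.2 (M.reqProb_le_one hM hV x))).trans ?_
  rw [setLIntegral_const, one_mul, Problem.mass, measureReal_def,
    ENNReal.ofReal_toReal (measure_ne_top _ _)]

variable {n : ℕ} {σ η ρ : ℝ} {d₀ : Fin D} {a₀ : ℝ}

/-- The expected number of requested labels in one round, on one region, after the split phase of
a typical run. -/
theorem Typical.setLIntegral_reqProb_le (hM : M.Bounded) (hm : M.MeasurableLoss)
    (hbest : ∀ S, MeasurableSet S → M.IsBestOn S (hstar S))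
    (hty : Typical M A z cut hstar n σ η d₀ a₀) (hn : A.κ ≤ n + 1) (hκ : 1 ≤ A.κ)
    (hσ : σ = slack M A) (hσ0 : 0 < σ) (hτ : 1 ≤ A.τ) {j : ℕ} (hj : A.τ + j ≤ A.T) {k : ℕ}
    (hk : k < (run M A z cut (A.τ + j)).K) {S : Set 𝒳}
    (hS : (run M A z cut (A.τ + j)).region k = S) :
    ∫⁻ x in S, ENNReal.ofReal (M.reqProb ((run M A z cut (A.τ + j)).hyp k) x) ∂M.marginal ≤
      ENNReal.ofReal (if M.mass S * j < 5 * σ then M.mass S else 0) +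
        M.disagreementCoeff (M.distOn S) (hstar S) *
          ENNReal.ofReal (4 * M.lossOn S (hstar S) +
            15 * √(σ * M.mass S) * (1 / √((j : ℝ) + 1))) := by
  have hmeas := run_region_measurableSet (M := M) (A := A) (z := z) (cut := cut) _ k hk
  have hbox : IsBox n ((run M A z cut (A.τ + j)).region k) := IsBox.of_run hn hκ hk
  have hsub := run_hyp_subset (M := M) (A := A) (z := z) (cut := cut) (A.τ + j) k
  have hsurv := hty.survival hM hm hbest hn hκ hσ hj k hk
  rw [hS] at hmeas hbox hsurv
  split_ifs with hbad
  -- While too few visits are guaranteed since round `τ`, the request probability is bounded by one.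
  · exact (setLIntegral_reqProb_le_mass hM hsub S).trans le_self_add
  rw [not_lt] at hbad
  have hq := mass_nonneg M S
  have hτ1 : (1 : ℝ) ≤ A.τ := by exact_mod_cast hτ
  have hj' : (A.τ : ℝ) + j ≤ A.T := by exact_mod_cast hj
  have hj0 : (0 : ℝ) ≤ j := Nat.cast_nonneg j
  have hgood : 5 * σ ≤ M.mass S * A.T :=
    hbad.trans (mul_le_mul_of_nonneg_left (by linarith) hq)
  obtain ⟨-, hnear⟩ := hsurv hgood
  have h1 := hty.le_card_sub S hbox (A.τ + j) (Nat.le_add_right _ _) hj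
  have h2 := hty.le_card S hbox (A.τ + j) hj
  push_cast at h1 h2
  rw [add_sub_cancel_left] at h1
  set N : ℝ := ((visits z (A.τ + j) S).card : ℝ) with hN
  -- With `M.mass S * j ≥ 5σ` the guaranteed number of visits after round `τ` is positive, so the
  -- hypothesis set of `S` has been shrunk at least once.
  have hvis : ∃ s, A.τ < s ∧ s ≤ A.τ + j ∧ (z s).1.1 ∈ S := by
    by_contra hno
    push Not at hno
    have hle : (visits z (A.τ + j) S).card ≤ (visits z A.τ S).card := by
      refine Finset.card_le_card fun s hs => ?_
      obtain ⟨⟨h3, h4⟩, h5⟩ := mem_visits.1 hs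
      refine mem_visits.2 ⟨⟨h3, ?_⟩, h5⟩
      by_contra h6
      exact hno s (not_le.1 h6) h4 h5
    have hle' : N ≤ (visits z A.τ S).card := by rw [hN]; exact_mod_cast hle
    linarith
  have hnear' := hnear hvis
  have hqt : M.mass S * j ≤ M.mass S * (A.τ + j) := mul_le_mul_of_nonneg_left (by linarith) hq
  have hN1 : 412 / 1000 * M.mass S * (A.τ + j) ≤ N := by linarith
  -- Since `τ ≥ 1`, the count `j + 1` is at most `τ + j`; it keeps the later `1 / √(j + 1)` finite
  -- at `j = 0`.
  have hN2 : 412 / 1000 * M.mass S * (j + 1) ≤ N := by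
    refine le_trans ?_ hN1
    exact mul_le_mul_of_nonneg_left (by linarith) (by positivity)
  have hN0 : 0 < N := by linarith
  have hl := hM.riskOn_nonneg (hbest S hmeas).1 S
  -- The radius comes from `rho_le`: a survivor has risk at most that of the best hypothesis plus
  -- `33/10` widths.
  have hr : 0 < 2 * M.riskOn S (hstar S) + 33 / 10 * √(2 * σ / N) := by positivity
  have h3 := lintegral_reqProb_le (M := M) hmeas hr hsub (h₀ := hstar S) (fun h hh => by
    have h4 := rho_le hM hm (hsub hh) (hbest S hmeas).1 S
    have h5 := hnear' h hh
    linarith)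
  rw [ENNReal.ofReal_zero, zero_add]
  refine h3.trans (mul_le_mul_right (ENNReal.ofReal_le_ofReal ?_) _)
  -- Here `2 · (33/10)² = 21.78` is below `0.412 · (15/2)² = 23.175`. The factor two from the
  -- triangle inequality turns `15/2` into `15`, and `2 R_S(h*_S)` into `4 R_S(h*_S)`.
  have h6 := mul_sqrt_le_of_card (a := 33 / 10) (b := 15 / 2) hq hσ0.le
    (show (0 : ℝ) < j + 1 by positivity) (by norm_num) hN2 hN0 (by norm_num)
  rw [Real.sqrt_div (mul_nonneg hσ0.le hq)] at h6
  rw [lossOn_eq hmeas]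
  have e : 15 * √(σ * M.mass S) * (1 / √((j : ℝ) + 1)) =
      2 * (15 / 2 * (√(σ * M.mass S) / √((j : ℝ) + 1))) := by ring
  rw [e]
  linarith

/-- The labels requested in the split phase. -/
theorem ofReal_sum_split_phase_le (hM : M.Bounded) {h₀ : 𝒳 → ℝ}
    (hr : 0 < ⨆ h : M.H, M.rho M.dist h.1 h₀) (t : ℕ) :
    ENNReal.ofReal (∑ s ∈ Finset.range t, ∫ x, (run M A z cut s).reqProb M x ∂M.marginal) ≤
      min (2 * M.disagreementCoeff M.dist h₀ *
        ENNReal.ofReal (⨆ h : M.H, M.rho M.dist h.1 h₀)) 1 * (t : ℝ≥0∞) := by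
  have := marginal_isProbabilityMeasure M
  rw [ENNReal.ofReal_sum_of_nonneg fun s _ => integral_reqProb_nonneg _]
  refine (Finset.sum_le_card_nsmul _ _ _ fun s _ => ?_).trans (le_of_eq (by
    rw [Finset.card_range, nsmul_eq_mul, mul_comm]))
  refine (ofReal_integral_reqProb_le _).trans (le_min ?_ ?_)
  · refine le_trans (lintegral_mono fun x => ENNReal.ofReal_le_ofReal ?_)
      (lintegral_reqProb_univ_le (V := M.H) subset_rfl hr)
    exact M.reqProb_mono (run_hyp_subset s _) x
  · refine (lintegral_mono fun x => ENNReal.ofReal_le_one.2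
      (M.reqProb_le_one hM (run_hyp_subset s _) x)).trans ?_
    simp

/-- The labels requested after the split phase of a typical run. -/
theorem Typical.ofReal_sum_le (hM : M.Bounded) (hm : M.MeasurableLoss)
    (hbest : ∀ S, MeasurableSet S → M.IsBestOn S (hstar S))
    (hty : Typical M A z cut hstar n σ η d₀ a₀) (hn : A.κ ≤ n + 1) (hκ : 1 ≤ A.κ)
    (hσ : σ = slack M A) (hσ2 : 2 ≤ σ) (hτ : 1 ≤ A.τ) {m : ℕ} (hmT : A.τ + m = A.T) {RU : ℝ}
    (hRU : M.bestLoss hstar (run M A z cut A.T) ≤ RU) :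
    ENNReal.ofReal (∑ j ∈ Finset.range m,
        ∫ x, (run M A z cut (A.τ + j)).reqProb M x ∂M.marginal) ≤
      4 * (⨆ k ∈ Finset.range (run M A z cut A.T).K,
        M.disagreementCoeff (M.distOn ((run M A z cut A.T).region k))
          (hstar ((run M A z cut A.T).region k))) *
        ENNReal.ofReal (m * (RU + 8 * √((run M A z cut A.T).K * σ / m))) +
      ENNReal.ofReal (√32 * (run M A z cut A.T).K * σ) := by
  have hσ0 : 0 < σ := by linarith
  have hpart := run_partition M A z cut A.T
  have hmeas := run_region_measurableSet (M := M) (A := A) (z := z) (cut := cut) A.T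
  set st := run M A z cut A.T with hst
  set Θ := ⨆ k ∈ Finset.range st.K, M.disagreementCoeff (M.distOn (st.region k))
    (hstar (st.region k)) with hΘ
  set q : ℕ → ℝ := fun k => M.mass (st.region k) with hq
  set l : ℕ → ℝ := fun k => M.lossOn (st.region k) (hstar (st.region k)) with hl
  have hq0 : ∀ k, 0 ≤ q k := fun k => mass_nonneg M _
  have hl0 : ∀ k < st.K, 0 ≤ l k := fun k hk => hM.lossOn_nonneg (hbest _ (hmeas k hk)).1 _
  have hround : ∀ j ∈ Finset.range m,
      ENNReal.ofReal (∫ x, (run M A z cut (A.τ + j)).reqProb M x ∂M.marginal) ≤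
      ∑ k ∈ Finset.range st.K, (ENNReal.ofReal (if q k * j < 5 * σ then q k else 0) +
        Θ * ENNReal.ofReal (4 * l k + 15 * √(σ * q k) * (1 / √((j : ℝ) + 1)))) := by
    intro j hj
    have hj' : A.τ + j ≤ A.T := by have := Finset.mem_range.1 hj; omega
    -- The regions no longer change after round `τ`, so each round can be decomposed over the final
    -- ones.
    obtain ⟨hK, hreg⟩ := run_eq_of_le (M := M) (z := z) (cut := cut)
      (Nat.le_add_right A.τ j) hj'
    refine (ofReal_integral_reqProb_le _).trans ?_
    rw [lintegral_state_reqProb (run_partition M A z cut _) (run_region_measurableSet _), ← hK]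
    refine Finset.sum_le_sum fun k hk => ?_
    have hk' := Finset.mem_range.1 hk
    have hS : (run M A z cut (A.τ + j)).region k = st.region k := by rw [hst, hreg]
    rw [hS]
    refine (hty.setLIntegral_reqProb_le hM hm hbest hn hκ hσ hσ0 hτ hj' (hK ▸ hk') hS).trans ?_
    refine add_le_add le_rfl (mul_le_mul_left ?_ _)
    exact le_iSup₂_of_le (f := fun k (_ : k ∈ Finset.range st.K) =>
      M.disagreementCoeff (M.distOn (st.region k)) (hstar (st.region k))) k hk le_rfl
  have hb0 : ∀ k (j : ℕ), 0 ≤ (if q k * (j : ℝ) < 5 * σ then q k else 0) := fun k j => by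
    split_ifs
    · exact hq0 k
    · exact le_rfl
  have hg0 : ∀ k < st.K, ∀ j : ℕ, 0 ≤ 4 * l k + 15 * √(σ * q k) * (1 / √((j : ℝ) + 1)) := by
    intro k hk j
    have := hl0 k hk
    positivity
  rw [ENNReal.ofReal_sum_of_nonneg fun s _ => integral_reqProb_nonneg _]
  refine (Finset.sum_le_sum hround).trans ?_
  rw [Finset.sum_comm]
  simp only [Finset.sum_add_distrib]
  rw [add_comm]
  refine add_le_add ?_ ?_
  · simp only [← Finset.mul_sum]
    have e1 : ∀ k ∈ Finset.range st.K, ∑ j ∈ Finset.range m,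
        ENNReal.ofReal (4 * l k + 15 * √(σ * q k) * (1 / √((j : ℝ) + 1))) =
        ENNReal.ofReal (∑ j ∈ Finset.range m,
          (4 * l k + 15 * √(σ * q k) * (1 / √((j : ℝ) + 1)))) := fun k hk =>
      (ENNReal.ofReal_sum_of_nonneg fun j _ => hg0 k (Finset.mem_range.1 hk) j).symm
    rw [Finset.sum_congr rfl e1, ← ENNReal.ofReal_sum_of_nonneg fun k hk =>
      Finset.sum_nonneg fun j _ => hg0 k (Finset.mem_range.1 hk) j]
    rw [mul_comm (4 : ℝ≥0∞) Θ, mul_assoc, ← ENNReal.ofReal_ofNat, ← ENNReal.ofReal_mul (by norm_num)]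
    refine mul_le_mul_right (ENNReal.ofReal_le_ofReal ?_) _
    have h1 : ∀ k ∈ Finset.range st.K, ∑ j ∈ Finset.range m,
        (4 * l k + 15 * √(σ * q k) * (1 / √((j : ℝ) + 1))) ≤
        4 * m * l k + 30 * √(σ * m) * √(q k) := by
      intro k _
      rw [Finset.sum_add_distrib, ← Finset.mul_sum, Finset.sum_const, Finset.card_range,
        nsmul_eq_mul]
      have h2 := mul_le_mul_of_nonneg_left (sum_inv_sqrt_le m)
        (show 0 ≤ 15 * √(σ * q k) by positivity)
      rw [Finset.mul_sum, Real.sqrt_mul hσ0.le] at h2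
      rw [Real.sqrt_mul hσ0.le, Real.sqrt_mul hσ0.le]
      linarith
    refine (Finset.sum_le_sum h1).trans ?_
    rw [Finset.sum_add_distrib, ← Finset.mul_sum, ← Finset.mul_sum]
    have h2 := sum_sqrt_le (fun k _ => hq0 k) (sum_mass_eq_one hpart hmeas)
    have h3 : (4 * m : ℝ) * ∑ k ∈ Finset.range st.K, l k ≤ 4 * m * RU :=
      mul_le_mul_of_nonneg_left hRU (by positivity)
    have h4 : 30 * √(σ * m) * ∑ k ∈ Finset.range st.K, √(q k) ≤ 30 * √(σ * m) * √st.K :=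
      mul_le_mul_of_nonneg_left h2 (by positivity)
    have h5 : (m : ℝ) * √(st.K * σ / m) = √(σ * m) * √st.K := by
      rcases Nat.eq_zero_or_pos m with h0 | h0
      · subst h0; simp
      · have h0' : (0 : ℝ) < m := by exact_mod_cast h0
        rw [← Real.sqrt_mul (by positivity), show σ * m * st.K = (m : ℝ) ^ 2 * (st.K * σ / m) by
          field_simp, Real.sqrt_mul (by positivity), Real.sqrt_sq h0'.le]
    have h6 : 0 ≤ √(σ * m) * √st.K := by positivity
    -- The coefficient `30 = 15 · 2` of the accumulated widths fits under `4 · 8 = 32`.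
    have h7 : 4 * (m * (RU + 8 * √(st.K * σ / m))) =
        4 * m * RU + 32 * (√(σ * m) * √st.K) := by
      rw [← h5]; ring
    rw [h7]
    linarith
  · have e1 : ∀ k ∈ Finset.range st.K, ∑ j ∈ Finset.range m,
        ENNReal.ofReal (if q k * (j : ℝ) < 5 * σ then q k else 0) ≤
        ENNReal.ofReal (√32 * σ) := by
      intro k _
      rw [← ENNReal.ofReal_sum_of_nonneg fun j _ => hb0 k j]
      refine ENNReal.ofReal_le_ofReal ?_
      have h1 := sum_ite_mul_lt_le (hq0 k) (show 0 ≤ 5 * σ by positivity) m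
      have h2 : q k ≤ 1 := mass_le_one M _
      -- The rounds with too few visits cost `5σ + q`, which is at most `11/2 σ` because `q ≤ 1 ≤
      -- σ/2`.
      have h3 : 11 / 2 ≤ √32 := Real.le_sqrt_of_sq_le (by norm_num)
      have h4 := mul_le_mul_of_nonneg_right h3 hσ0.le
      linarith
    refine (Finset.sum_le_card_nsmul _ _ _ e1).trans (le_of_eq ?_)
    rw [Finset.card_range, nsmul_eq_mul, ← ENNReal.ofReal_natCast, ← ENNReal.ofReal_mul (by positivity)]
    congr 1
    ring

/-- The label bound for a typical run. -/
theorem Typical.expectedLabels_le (hM : M.Bounded) (hm : M.MeasurableLoss)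
    (hbest : ∀ S, MeasurableSet S → M.IsBestOn S (hstar S))
    (hty : Typical M A z cut hstar n σ η d₀ a₀) (hn : A.κ ≤ n + 1) (hκ : 1 ≤ A.κ)
    (hσ : σ = slack M A) (hσ2 : 2 ≤ σ) (hτ : 1 ≤ A.τ) (hτT : A.τ ≤ A.T) (hρ : 0 < ρ)
    (hw : ρ ≤ M.riskOn Set.univ (hstar Set.univ) - M.riskOn Set.univ
      (combine (leftPart Set.univ d₀ a₀) (rightPart Set.univ d₀ a₀)
        (hstar (leftPart Set.univ d₀ a₀)) (hstar (rightPart Set.univ d₀ a₀)))) {RU : ℝ}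
    (hRU : M.bestLoss hstar (run M A z cut A.T) ≤ RU) :
    ENNReal.ofReal (expectedLabels M A z cut) ≤
      min (2 * M.disagreementCoeff M.dist (hstar Set.univ) *
          ENNReal.ofReal (⨆ h : M.H, M.rho M.dist h.1 (hstar Set.univ))) 1 * (A.τ : ℝ≥0∞) +
        4 * (⨆ k ∈ Finset.range (run M A z cut A.T).K,
            M.disagreementCoeff (M.distOn ((run M A z cut A.T).region k))
              (hstar ((run M A z cut A.T).region k))) *
          ENNReal.ofReal (((A.T : ℝ) - A.τ) *
            (RU + 8 * √((run M A z cut A.T).K * σ / ((A.T : ℝ) - A.τ)))) +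
        ENNReal.ofReal (√32 * (run M A z cut A.T).K * σ) := by
  obtain ⟨m, hmT⟩ := Nat.exists_eq_add_of_le hτT
  have hm' : (A.T : ℝ) - A.τ = m := by rw [hmT]; push_cast; ring
  have hf := (hbest _ (measurableSet_leftPart (MeasurableSet.univ : MeasurableSet
    (Set.univ : Set 𝒳)) d₀ a₀)).1
  have hg := (hbest _ (measurableSet_rightPart (MeasurableSet.univ : MeasurableSet
    (Set.univ : Set 𝒳)) d₀ a₀)).1
  -- The gain `ρ > 0` of the witness split is at most twice the radius, which is therefore positive.
  have hr : 0 < ⨆ h : M.H, M.rho M.dist h.1 (hstar Set.univ) := by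
    have h1 := riskOn_sub_combine_le hM hm hf hg (hbest _ MeasurableSet.univ).1 d₀ a₀
    have h2 := rho_le_iSup M M.dist hf (hstar Set.univ)
    have h3 := rho_le_iSup M M.dist hg (hstar Set.univ)
    linarith
  unfold expectedLabels
  rw [hm', show Finset.range A.T = Finset.range (A.τ + m) by rw [hmT], Finset.sum_range_add,
    ENNReal.ofReal_add (Finset.sum_nonneg fun s _ => integral_reqProb_nonneg _)
      (Finset.sum_nonneg fun s _ => integral_reqProb_nonneg _),
    add_assoc]
  exact add_le_add (ofReal_sum_split_phase_le hM hr A.τ)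
    (hty.ofReal_sum_le hM hm hbest hn hκ hσ hσ2 hτ hmT.symm hRU)

end Labels

end ARBAL

/-! ### Transfer of the deviation bounds from grid regions to boxes -/

namespace ARBAL

section Transfer

variable {D : ℕ} {𝒳 : Set (Fin D → ℝ)} {M : Problem 𝒳} {A : Params 𝒳} {z : ℕ → Sample 𝒳}
  {cut : ℕ → Fin D × ℝ} {hstar : Set 𝒳 → 𝒳 → ℝ} {T : ℕ} {η : ℝ} {S S' : Set 𝒳}

theorem Problem.Approx.visits_eq (h : M.Approx (fun s => (z s).1.1) T η S S') {t : ℕ}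
    (ht : t ≤ T) : visits z t S = visits z t S' := by
  ext s
  rw [mem_visits, mem_visits]
  exact and_congr_right fun hs => h.1 s (Finset.mem_Icc.2 ⟨hs.1, hs.2.trans ht⟩)

theorem abs_setIntegral_sub_le [IsProbabilityMeasure M.dist] {φ : 𝒳 × ℤˣ → ℝ}
    (hφ : Measurable φ) (hφ1 : ∀ v, |φ v| ≤ 1) (hS : MeasurableSet S) (hS' : MeasurableSet S') :
    |∫ v in Prod.fst ⁻¹' S, φ v ∂M.dist - ∫ v in Prod.fst ⁻¹' S', φ v ∂M.dist| ≤
      M.mass (symmDiff S S') := by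
  have hi : Integrable φ M.dist := integrable_of_bounded hφ hφ1
  have h1 := measurableSet_fst_preimage hS
  have h2 := measurableSet_fst_preimage hS'
  have h3 : MeasurableSet (symmDiff S S') := (hS.diff hS').union (hS'.diff hS)
  have h4 := measurableSet_fst_preimage h3
  rw [← integral_indicator h1, ← integral_indicator h2,
    ← integral_sub (hi.indicator h1) (hi.indicator h2), mass_eq M h3, ← integral_indicator_one h4]
  have hg : Integrable ((Prod.fst ⁻¹' symmDiff S S').indicator (1 : 𝒳 × ℤˣ → ℝ)) M.dist :=
    (integrable_const (1 : ℝ)).indicator h4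
  rw [← Real.norm_eq_abs]
  refine norm_integral_le_of_norm_le hg (Filter.Eventually.of_forall fun v => ?_)
  have h0 : (0 : ℝ) ≤ 1 := zero_le_one
  have h5 := hφ1 v
  by_cases hv : v.1 ∈ S <;> by_cases hv' : v.1 ∈ S' <;>
    simp [Set.indicator, Set.mem_symmDiff, hv, hv', h5]

/-- The sample sums coincide, so only the conditional means differ. These are comparable after
multiplication by the mass: one `η` comes from the integral over the region and one from the
normalization. -/
theorem Problem.Approx.deviation_le [IsProbabilityMeasure M.dist]
    (h : M.Approx (fun s => (z s).1.1) T η S S') {φ : 𝒳 × ℤˣ → ℝ}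
    (hφ : Measurable φ) (hφ1 : ∀ v, |φ v| ≤ 1) (hS : MeasurableSet S) (hS' : MeasurableSet S')
    (p : ℕ → ℝ) {t : ℕ} (ht : t ≤ T) :
    M.mass S * deviation M z p φ t S ≤
      M.mass S * deviation M z p φ t S' + 2 * η * (visits z t S).card := by
  have := marginal_isProbabilityMeasure M
  unfold deviation
  rw [h.visits_eq ht, Finset.sum_sub_distrib, Finset.sum_sub_distrib, Finset.sum_const,
    Finset.sum_const, nsmul_eq_mul, nsmul_eq_mul]
  have h1 := (abs_setIntegral_sub_le hφ hφ1 hS hS').trans h.2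
  rw [setIntegral_dist hS, setIntegral_dist hS'] at h1
  have h2 : |M.mass S - M.mass S'| ≤ η :=
    (abs_measureReal_sub_le_measureReal_symmDiff hS.nullMeasurableSet
      hS'.nullMeasurableSet).trans h.2
  set I := ∫ v, φ v ∂(M.distOn S)
  set I' := ∫ v, φ v ∂(M.distOn S')
  have hI' : |I'| ≤ 1 := by
    by_cases h0 : M.dist (Prod.fst ⁻¹' S') = 0
    · have h5 : M.distOn S' = 0 := ProbabilityTheory.cond_eq_zero_of_meas_eq_zero h0
      simp [I', h5]
    · have := isProbabilityMeasure_distOn h0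
      refine (norm_integral_le_of_norm_le_const (μ := M.distOn S') (f := φ) (C := 1)
        (Filter.Eventually.of_forall fun v => hφ1 v)).trans ?_
      simp
  have h3 : M.mass S * (I' - I) ≤ 2 * η := by
    have h4 : |(M.mass S - M.mass S') * I'| ≤ η := by
      rw [abs_mul]
      exact (mul_le_of_le_one_right (abs_nonneg _) hI').trans h2
    have h5 := (abs_le.1 h1).1
    have h6 := (abs_le.1 h4).2
    linarith
  have h7 := mul_le_mul_of_nonneg_right h3 (Nat.cast_nonneg (α := ℝ) (visits z t S').card)
  linarith

theorem weighted_congr {φ ψ : 𝒳 × ℤˣ → ℝ} {w : Sample 𝒳} (h : ∀ y, φ (w.1.1, y) = ψ (w.1.1, y))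
    (p : ℝ) : weighted φ p w = weighted ψ p w := by
  unfold weighted
  simp only [h]

theorem combine_congr {L R L' R' : Set 𝒳} {x : 𝒳} (hL : x ∈ L ↔ x ∈ L') (hR : x ∈ R ↔ x ∈ R')
    (f g : 𝒳 → ℝ) : combine L R f g x = combine L' R' f g x := by
  classical
  simp only [combine, Set.indicator_apply, hL, hR]

theorem abs_lossDiff_combine_le_one (hM : M.Bounded) {L R : Set 𝒳} (hLR : Disjoint L R)
    (hU : L ∪ R = Set.univ) {f g h : 𝒳 → ℝ} (hf : f ∈ M.H) (hg : g ∈ M.H) (hh : h ∈ M.H)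
    (v : 𝒳 × ℤˣ) : |M.lossDiff h (combine L R f g) v| ≤ 1 := by
  have h1 := loss_combine_mem hM hLR hU hf hg v.1 v.2
  have h2 := hM h hh v.1 v.2
  unfold Problem.lossDiff
  exact abs_sub_le_iff.2 ⟨by linarith [h1.1, h2.2], by linarith [h1.2, h2.1]⟩

theorem lossDiff_comm (f g : 𝒳 → ℝ) (v : 𝒳 × ℤˣ) :
    |M.lossDiff f g v| = |M.lossDiff g f v| := abs_sub_comm _ _

theorem abs_lossDiff_le_one (hM : M.Bounded) {f g : 𝒳 → ℝ} (hf : f ∈ M.H) (hg : g ∈ M.H)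
    (v : 𝒳 × ℤˣ) : |M.lossDiff f g v| ≤ 1 := by
  have h1 := hM f hf v.1 v.2
  have h2 := hM g hg v.1 v.2
  unfold Problem.lossDiff
  exact abs_sub_le_iff.2 ⟨by linarith [h1.2, h2.1], by linarith [h1.1, h2.2]⟩

/-- The two piecewise predictors agree on the sample and differ only on the symmetric difference of
the left sides, where the losses differ by at most one. On the whole space there is no
normalization, so `η` enters once per visit. -/
theorem Problem.Approx.deviation_combine_le [IsProbabilityMeasure M.dist] (hM : M.Bounded)
    (hm : M.MeasurableLoss) {d : Fin D} {a : ℝ}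
    (h : M.Approx (fun s => (z s).1.1) T η (leftPart Set.univ d a) S')
    (hS' : MeasurableSet S') {f g h₀ : 𝒳 → ℝ} (hf : f ∈ M.H) (hg : g ∈ M.H) (hh : h₀ ∈ M.H)
    (p : ℕ → ℝ) {t : ℕ} (ht : t ≤ T) :
    deviation M z p (M.lossDiff h₀
      (combine (leftPart Set.univ d a) (rightPart Set.univ d a) f g)) t Set.univ ≤
      deviation M z p (M.lossDiff h₀ (combine S' S'ᶜ f g)) t Set.univ + t * η := by
  set L := leftPart (Set.univ : Set 𝒳) d a
  have hR : rightPart (Set.univ : Set 𝒳) d a = Lᶜ := by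
    ext x; simp [L, leftPart, rightPart]
  rw [hR]
  have hL : MeasurableSet L := measurableSet_leftPart MeasurableSet.univ d a
  unfold deviation
  rw [Finset.sum_sub_distrib, Finset.sum_sub_distrib, Finset.sum_const, Finset.sum_const,
    nsmul_eq_mul, nsmul_eq_mul, card_visits_univ, distOn_univ]
  have h1 : ∑ s ∈ visits z t Set.univ, weighted (M.lossDiff h₀ (combine L Lᶜ f g)) (p s) (z s) =
      ∑ s ∈ visits z t Set.univ, weighted (M.lossDiff h₀ (combine S' S'ᶜ f g)) (p s) (z s) := by
    refine Finset.sum_congr rfl fun s hs => weighted_congr (fun y => ?_) _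
    obtain ⟨⟨h2, h3⟩, -⟩ := mem_visits.1 hs
    have h4 : (z s).1.1 ∈ L ↔ (z s).1.1 ∈ S' := h.1 s (Finset.mem_Icc.2 ⟨h2, h3.trans ht⟩)
    unfold Problem.lossDiff
    simp only [combine_congr (R := Lᶜ) (R' := S'ᶜ) h4 (not_congr h4) f g]
  rw [h1]
  have hi : ∀ {U : Set 𝒳}, MeasurableSet U →
      Integrable (M.lossDiff h₀ (combine U Uᶜ f g)) M.dist := fun {U} hU =>
    integrable_of_bounded ((hm h₀ hh).sub (measurable_loss_combine hm hU hU.compl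
      disjoint_compl_right hf hg)) (abs_lossDiff_combine_le_one hM disjoint_compl_right
      (Set.union_compl_self U) hf hg hh)
  have h5 : ∫ v, M.lossDiff h₀ (combine S' S'ᶜ f g) v ∂M.dist -
      ∫ v, M.lossDiff h₀ (combine L Lᶜ f g) v ∂M.dist ≤ η := by
    have h3 : MeasurableSet (symmDiff L S') := (hL.diff hS').union (hS'.diff hL)
    have h4 := measurableSet_fst_preimage h3
    rw [← integral_sub (hi hS') (hi hL)]
    refine le_trans ?_ h.2
    change _ ≤ M.mass (symmDiff L S')
    rw [mass_eq M h3, ← integral_indicator_one h4]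
    refine integral_mono ((hi hS').sub (hi hL)) ((integrable_const (1 : ℝ)).indicator h4)
      fun v => ?_
    have h6 := abs_le.1 (abs_lossDiff_le_one hM hf hg v)
    unfold Problem.lossDiff at h6 ⊢
    by_cases hv : v.1 ∈ L <;> by_cases hv' : v.1 ∈ S' <;>
      simp [combine, Set.indicator, Set.mem_symmDiff, hv, hv'] <;> linarith
  have h7 := mul_le_mul_of_nonneg_left h5 (Nat.cast_nonneg (α := ℝ) t)
  linarith

variable [IsProbabilityMeasure M.dist] {n m : ℕ} {σ : ℝ} {d₀ : Fin D} {a₀ : ℝ}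

/-- It suffices to control the deviations on the regions of a grid. -/
theorem Typical.of_grid (hM : M.Bounded) (hm : M.MeasurableLoss)
    (hbest : ∀ S, MeasurableSet S → M.IsBestOn S (hstar S)) {G : Fin D → Finset ℝ}
    (hmass : ∀ d a, M.marginal.real {x : 𝒳 | x.1 d ∈ cell (G d) a} ≤ 1 / m)
    (hsep : Separates G (fun s => (z s).1.1) A.T) (hT : 1 ≤ A.T) (hσ2 : 2 ≤ σ)
    (hη : 7 * (n / m : ℝ) * A.T ^ 2 ≤ σ)
    (hdev : ∀ S ∈ gridRegions (𝒳 := 𝒳) G n, ∀ f ∈ M.H, ∀ g ∈ M.H, ∀ t ≤ A.T,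
      deviation M z (reqAt M A z cut) (M.lossDiff f g) t S ≤ √(2 * σ * (visits z t S).card))
    (hcard : ∀ S ∈ gridRegions (𝒳 := 𝒳) G n, ∀ a b, (a = 0 ∨ a = A.τ) → a ≤ b → b ≤ A.T →
      63 / 100 * M.mass S * (b - a) - σ ≤ ((visits z b S).card : ℝ) - (visits z a S).card)
    (hsplit : ∀ S ∈ gridRegions (𝒳 := 𝒳) G n, ∀ f ∈ M.H, ∀ g ∈ M.H, ∀ t ≤ A.T,
      deviation M z (reqAt M A z cut) (M.lossDiff (hstar Set.univ) (combine S Sᶜ f g)) t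
        Set.univ ≤ √(2 * σ * (visits z t Set.univ).card))
    (hwit : ∀ g ∈ M.H, ∀ t ≤ A.T, deviation M z (reqAt M A z cut) (M.lossDiff
      (combine (leftPart Set.univ d₀ a₀) (rightPart Set.univ d₀ a₀)
        (hstar (leftPart Set.univ d₀ a₀)) (hstar (rightPart Set.univ d₀ a₀))) g) t Set.univ ≤
      √(2 * σ * (visits z t Set.univ).card)) :
    Typical M A z cut hstar n σ (n / m) d₀ a₀ := by
  have := marginal_isProbabilityMeasure M
  have happ : ∀ {S : Set 𝒳}, IsBox n S → ∃ S' ∈ gridRegions G n,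
      M.Approx (fun s => (z s).1.1) A.T (n / m) S S' := fun h =>
    h.exists_approx ⟨d₀⟩ hmass hsep
  have hT1 : (1 : ℝ) ≤ A.T := by exact_mod_cast hT
  set η : ℝ := n / m with hηdef
  have hη0 : 0 ≤ η := by positivity
  have hηT : 7 * η * A.T ≤ σ := by
    refine le_trans ?_ hη
    have : (A.T : ℝ) ≤ A.T ^ 2 := by nlinarith
    exact mul_le_mul_of_nonneg_left this (by positivity)
  -- The excess `9/100` over `σ` is `63/100 · 1/7`, from `7 η T ≤ σ`.
  have hcard' : ∀ S, IsBox n S → ∀ a b, (a = 0 ∨ a = A.τ) → a ≤ b → b ≤ A.T →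
      63 / 100 * M.mass S * (b - a) - 109 / 100 * σ ≤
        ((visits z b S).card : ℝ) - (visits z a S).card := by
    intro S hS a b ha hab hb
    obtain ⟨S', hS', happ'⟩ := happ hS
    have hmeas' := measurableSet_of_mem_gridRegions hS'
    have h1 := hcard S' hS' a b ha hab hb
    rw [← happ'.visits_eq hb, ← happ'.visits_eq (hab.trans hb)] at h1
    have h2 : |M.mass S - M.mass S'| ≤ η :=
      (abs_measureReal_sub_le_measureReal_symmDiff hS.measurableSet.nullMeasurableSet
        hmeas'.nullMeasurableSet).trans happ'.2
    have h3 := (abs_le.1 h2).2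
    have hab' : (0 : ℝ) ≤ b - a := by
      have : (a : ℝ) ≤ b := by exact_mod_cast hab
      linarith
    have hbT : (b : ℝ) - a ≤ A.T := by
      have h4 : (b : ℝ) ≤ A.T := by exact_mod_cast hb
      have h5 : (0 : ℝ) ≤ a := Nat.cast_nonneg a
      linarith
    have h6 := mul_le_mul_of_nonneg_right h3 hab'
    have h7 := mul_le_mul_of_nonneg_left hbT hη0
    linarith
  refine ⟨?_, ?_, ?_, ?_, ?_⟩
  · intro S hS hgood f hf g hg t ht
    obtain ⟨S', hS', happ'⟩ := happ hS
    have hmeas' := measurableSet_of_mem_gridRegions hS'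
    have h1 := happ'.deviation_le (φ := M.lossDiff f g) ((hm f hf).sub (hm g hg)) (abs_lossDiff_le_one hM hf hg)
      hS.measurableSet hmeas' (reqAt M A z cut) ht
    have h2 := hdev S' hS' f hf g hg t ht
    rw [← happ'.visits_eq ht] at h2
    have hNt : ((visits z t S).card : ℝ) ≤ A.T := by
      exact_mod_cast (card_visits_le z t S).trans ht
    set N : ℝ := ((visits z t S).card : ℝ) with hN
    have hN0 : 0 ≤ N := Nat.cast_nonneg _
    have hq : 0 < M.mass S := by
      rcases (mass_nonneg M S).eq_or_lt with h | h
      · rw [← h, zero_mul] at hgood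
        linarith
      · exact h
    -- The discretization error is absorbed into `3/10` of a width. This needs a heavy region: `η T²
    -- ≤ σ/7`, while `M.mass S * T ≥ 5σ`.
    have h3 : 2 * η * N ≤ M.mass S * (3 / 10 * √(2 * σ * N)) := by
      have h4 : √N * √N = N := Real.mul_self_sqrt hN0
      have h5 : √(2 * σ * N) = √(2 * σ) * √N := Real.sqrt_mul (by positivity) _
      have h6 : 2 ≤ √(2 * σ) := Real.le_sqrt_of_sq_le (by linarith)
      have h7 : √N ≤ A.T := by
        refine Real.sqrt_le_iff.2 ⟨by positivity, ?_⟩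
        nlinarith
      have h8 : η * √N ≤ M.mass S * (3 / 10) := by
        refine le_of_mul_le_mul_right ?_ (show (0 : ℝ) < A.T by linarith)
        have h9 : η * √N * A.T ≤ η * A.T * A.T :=
          mul_le_mul_of_nonneg_right (mul_le_mul_of_nonneg_left h7 hη0) (by linarith)
        have h10 : η * A.T * A.T = η * A.T ^ 2 := by ring
        have h11 : 0 ≤ η * (A.T : ℝ) ^ 2 := by positivity
        linarith
      have h12 := mul_le_mul_of_nonneg_right h8 (Real.sqrt_nonneg N)
      have h13 : M.mass S * (3 / 10) * √N * 2 ≤ M.mass S * (3 / 10) * √N * √(2 * σ) :=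
        mul_le_mul_of_nonneg_left h6 (by positivity)
      have h14 : 2 * η * N = 2 * (η * √N * √N) := by rw [mul_assoc η, h4]; ring
      rw [h5, h14]
      linarith
    refine le_of_mul_le_mul_left ?_ hq
    have h4 := mul_le_mul_of_nonneg_left h2 hq.le
    linarith
  · intro S hS t ht
    have h1 := hcard' S hS 0 t (Or.inl rfl) (Nat.zero_le t) ht
    have h2 : (0 : ℝ) ≤ (visits z 0 S).card := Nat.cast_nonneg _
    push_cast at h1
    rw [sub_zero] at h1
    linarith
  · intro S hS t ht ht'
    exact hcard' S hS A.τ t (Or.inr rfl) ht ht'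
  · intro hn d a f hf g hg t ht
    obtain ⟨S', hS', happ'⟩ := happ ((IsBox.left d a IsBox.univ).mono hn)
    have hmeas' := measurableSet_of_mem_gridRegions hS'
    refine (happ'.deviation_combine_le hM hm hmeas' hf hg (hbest _ MeasurableSet.univ).1
      (reqAt M A z cut) ht).trans (add_le_add ?_ le_rfl)
    have h1 := hsplit S' hS' f hf g hg t ht
    rwa [card_visits_univ] at h1
  · intro g hg t ht
    have h1 := hwit g hg t ht
    rwa [card_visits_univ] at h1

end Transfer

end ARBAL

/-! ### Constants and the probability of a typical run -/

namespace ARBAL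

theorem measure_biUnion_le_card_mul {Ω ι : Type*} [MeasurableSpace Ω] {P : Measure Ω}
    (s : Finset ι) (U : ι → Set Ω) (c : ℝ≥0∞) (h : ∀ i ∈ s, P (U i) ≤ c) :
    P (⋃ i ∈ s, U i) ≤ s.card * c :=
  (measure_biUnion_finset_le _ _).trans
    ((Finset.sum_le_card_nsmul _ _ c h).trans (by rw [nsmul_eq_mul]))

section Constants

theorem seven_thirds_le_log {B : ℝ} (hB : 12 ≤ B) : 7 / 3 ≤ Real.log B := by
  rw [Real.le_log_iff_exp_le (by linarith)]
  refine le_trans ?_ hB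
  -- After cubing, the claim is `e⁷ ≤ 12³ = 1728`.
  refine le_of_pow_le_pow_left₀ (n := 3) (by norm_num) (by norm_num) ?_
  rw [← Real.exp_nat_mul, show ((3 : ℕ) : ℝ) * (7 / 3) = (7 : ℕ) * 1 by norm_num, Real.exp_nat_mul]
  refine (pow_le_pow_left₀ (Real.exp_pos 1).le (Real.exp_one_lt_d9.le) 7).trans ?_
  norm_num

variable {T h κ D m : ℕ} {δ B σ : ℝ}

theorem twelve_le (hT : 1 ≤ T) (hh : 1 ≤ h) (hκ : 1 ≤ κ) (hD : 1 ≤ D) (hδ : 0 < δ)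
    (hδ' : δ ≤ 2 / 3) : 12 ≤ 8 * (T : ℝ) ^ 3 * (h : ℝ) ^ 3 * κ * D / δ := by
  have hT' : (1 : ℝ) ≤ T := by exact_mod_cast hT
  have hh' : (1 : ℝ) ≤ h := by exact_mod_cast hh
  have hκ' : (1 : ℝ) ≤ κ := by exact_mod_cast hκ
  have hD' : (1 : ℝ) ≤ D := by exact_mod_cast hD
  have h1 : (1 : ℝ) ≤ (T : ℝ) ^ 3 * (h : ℝ) ^ 3 * κ * D :=
    one_le_mul_of_one_le_of_one_le (one_le_mul_of_one_le_of_one_le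
      (one_le_mul_of_one_le_of_one_le (one_le_pow₀ hT') (one_le_pow₀ hh')) hκ') hD'
  rw [le_div_iff₀ hδ]
  linarith

/-- The number of grid regions does not exceed `B ^ (D (κ - 1))`. -/
theorem gridRegions_count_le (hT : 1 ≤ T) (hh : 1 ≤ h) (hκ : 1 ≤ κ) (hD : 1 ≤ D) (hδ : 0 < δ)
    (hδ' : δ ≤ 2 / 3) (hB : B = 8 * (T : ℝ) ^ 3 * (h : ℝ) ^ 3 * κ * D / δ)
    (hm : (m : ℝ) ≤ 2 * D * T ^ 2 / δ + 1) :
    (((D * (4 * m + 4)) ^ (κ - 1) : ℕ) : ℝ) ≤ B ^ (D * (κ - 1)) := by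
  rcases hκ.eq_or_lt with rfl | hκ2
  · simp
  have hB12 : 12 ≤ B := hB ▸ twelve_le hT hh hκ hD hδ hδ'
  have hT' : (1 : ℝ) ≤ T := by exact_mod_cast hT
  have hh' : (1 : ℝ) ≤ h := by exact_mod_cast hh
  have hκ' : (2 : ℝ) ≤ κ := by exact_mod_cast hκ2
  have hD' : (1 : ℝ) ≤ D := by exact_mod_cast hD
  -- Here `m ≤ 2w + 1`, so `4m + 4 ≤ 8w + 8 ≤ 16w` by `w ≥ 3/2`. One region needs no cut; with `κ ≥
  -- 2`, also `16w ≤ B`. The remaining factor `D` is at most `2 ^ (D - 1)`.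
  set w : ℝ := D * T ^ 2 / δ with hw
  have hw1 : 3 / 2 ≤ w := by
    rw [hw, le_div_iff₀ hδ]
    have : (1 : ℝ) ≤ D * T ^ 2 := one_le_mul_of_one_le_of_one_le hD' (one_le_pow₀ hT')
    linarith
  have hwB : 16 * w ≤ B := by
    have h1 : (T : ℝ) ^ 2 * 1 * 2 ≤ T ^ 3 * h ^ 3 * κ := by
      have h2 : (T : ℝ) ^ 2 ≤ T ^ 3 := pow_le_pow_right₀ hT' (by norm_num)
      have h3 : (1 : ℝ) ≤ h ^ 3 := one_le_pow₀ hh'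
      gcongr
    have h4 : 16 * w = (8 * D / δ) * ((T : ℝ) ^ 2 * 1 * 2) := by rw [hw]; ring
    have h5 : B = (8 * D / δ) * ((T : ℝ) ^ 3 * h ^ 3 * κ) := by rw [hB]; ring
    rw [h4, h5]
    exact mul_le_mul_of_nonneg_left h1 (by positivity)
  have hX : (D : ℝ) * (4 * m + 4) ≤ B ^ D := by
    have h1 : (4 : ℝ) * m + 4 ≤ B := by
      have : 2 * D * (T : ℝ) ^ 2 / δ = 2 * w := by rw [hw]; ring
      linarith
    have h2 : (D : ℝ) ≤ B ^ (D - 1) := by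
      have h3 : (D : ℝ) ≤ 2 ^ (D - 1) := by
        have h4 := Nat.lt_two_pow_self (n := D - 1)
        have h5 : D ≤ 2 ^ (D - 1) := by omega
        exact_mod_cast h5
      exact h3.trans (pow_le_pow_left₀ (by norm_num) (by linarith) _)
    calc (D : ℝ) * (4 * m + 4) ≤ B ^ (D - 1) * B := by gcongr
      _ = B ^ D := by rw [← pow_succ, Nat.sub_add_cancel hD]
  push_cast
  rw [pow_mul]
  exact pow_le_pow_left₀ (by positivity) hX _

/-- Since `exp (-σ) = B ^ (-κ D)`, the union over the grid regions leaves `B ^ (-D)`, at most `1 /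
B`. -/
theorem mul_exp_neg_le {R : ℝ} (hκ : 1 ≤ κ) (hD : 1 ≤ D) (hB : 1 ≤ B)
    (hσ : σ = κ * D * Real.log B) (hR : R ≤ B ^ (D * (κ - 1))) : R * Real.exp (-σ) ≤ 1 / B := by
  have hB0 : 0 < B := by linarith
  have he : Real.exp σ = B ^ (κ * D) := by
    rw [hσ, ← Nat.cast_mul, Real.exp_nat_mul, Real.exp_log hB0]
  rw [Real.exp_neg, he, ← div_eq_mul_inv, div_le_div_iff₀ (by positivity) hB0, one_mul]
  calc R * B ≤ B ^ (D * (κ - 1)) * B := by gcongr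
    _ = B ^ (D * (κ - 1) + 1) := (pow_succ _ _).symm
    _ ≤ B ^ (κ * D) := pow_le_pow_right₀ hB (by
        obtain ⟨k, rfl⟩ := Nat.exists_eq_add_of_le hκ
        rw [Nat.add_sub_cancel_left, Nat.add_mul, Nat.mul_comm k D, one_mul]
        omega)

/-- The five failures cost `δ/2`, `δ/8`, `δ/2`, `δ/8` and `δ/8`, in total `11δ/8`. The cubes of `T`
and `|H|` in `B` pay for the union over rounds, visit counts and pairs of hypotheses. -/
theorem failure_probability_le (hT : 1 ≤ T) (hh : 1 ≤ h) (hκ : 1 ≤ κ) (hD : 1 ≤ D) (hδ : 0 < δ)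
    {R e : ℝ} (he0 : 0 ≤ e)
    (hB : B = 8 * (T : ℝ) ^ 3 * (h : ℝ) ^ 3 * κ * D / δ)
    (hRe : R * e ≤ 1 / B) (he : e ≤ 1 / B) (hm : 2 * D * T ^ 2 / δ ≤ m) (hm0 : 0 < m) :
    D * (T * (T * (1 / m : ℝ))) + (R * (h * (h * (T * (T * e)))) + (R * (2 * ((T + 1) * e)) +
      (R * (h * (h * (T * (T * e)))) + h * (T * (T * e))))) ≤ 3 * δ / 2 := by
  have hT' : (1 : ℝ) ≤ T := by exact_mod_cast hT
  have hh' : (1 : ℝ) ≤ h := by exact_mod_cast hh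
  have hκ' : (1 : ℝ) ≤ κ := by exact_mod_cast hκ
  have hD' : (1 : ℝ) ≤ D := by exact_mod_cast hD
  have hm' : (0 : ℝ) < m := by exact_mod_cast hm0
  have h1 : D * (T * (T * (1 / m : ℝ))) ≤ δ / 2 := by
    rw [show D * (T * (T * (1 / m : ℝ))) = D * T ^ 2 / m by ring, div_le_iff₀ hm']
    rw [div_le_iff₀ hδ] at hm
    linarith
  set b := 1 / B with hb
  have hb0 : 0 ≤ b := he0.trans he
  have hpow : 1 ≤ (T : ℝ) ^ 3 * h ^ 3 :=
    one_le_mul_of_one_le_of_one_le (one_le_pow₀ hT') (one_le_pow₀ hh')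
  have hb1 : b * ((T : ℝ) ^ 3 * h ^ 3) ≤ δ / 8 := by
    have h2 : B * δ = 8 * ((T : ℝ) ^ 3 * h ^ 3) * (κ * D) := by
      rw [hB]; field_simp
    have h3 : (1 : ℝ) ≤ κ * D := one_le_mul_of_one_le_of_one_le hκ' hD'
    have hB0 : 0 < B := by rw [hB]; positivity
    rw [hb, one_div_mul_eq_div, div_le_iff₀ hB0]
    nlinarith
  have hP : (h : ℝ) ^ 2 * T ^ 2 ≤ T ^ 3 * h ^ 3 := by
    have h2 : (T : ℝ) ^ 2 ≤ T ^ 3 := pow_le_pow_right₀ hT' (by norm_num)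
    have h3 : (h : ℝ) ^ 2 ≤ h ^ 3 := pow_le_pow_right₀ hh' (by norm_num)
    rw [mul_comm]
    gcongr
  have hP1 : (h : ℝ) * T ^ 2 ≤ T ^ 3 * h ^ 3 := by
    have h2 : (T : ℝ) ^ 2 ≤ T ^ 3 := pow_le_pow_right₀ hT' (by norm_num)
    have h3 : (h : ℝ) ≤ h ^ 3 := le_self_pow₀ hh' (by norm_num)
    rw [mul_comm]
    gcongr
  have hP2 : (T : ℝ) ≤ T ^ 3 * h ^ 3 := by
    have h2 : (T : ℝ) ≤ T ^ 3 := le_self_pow₀ hT' (by norm_num)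
    have h3 : (1 : ℝ) ≤ h ^ 3 := one_le_pow₀ hh'
    nlinarith
  have k1 : R * (h * (h * (T * (T * e)))) ≤ δ / 8 := by
    calc R * (h * (h * (T * (T * e)))) = (R * e) * (h ^ 2 * T ^ 2) := by ring
      _ ≤ b * (T ^ 3 * h ^ 3) := mul_le_mul hRe hP (by positivity) hb0
      _ ≤ δ / 8 := hb1
  have k2 : R * (2 * ((T + 1) * e)) ≤ δ / 2 := by
    calc R * (2 * ((T + 1) * e)) = (R * e) * (2 * T + 2) := by ring
      _ ≤ b * (4 * (T ^ 3 * h ^ 3)) := mul_le_mul hRe (by linarith) (by positivity) hb0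
      _ ≤ δ / 2 := by linarith
  have k3 : h * (T * (T * e)) ≤ δ / 8 := by
    calc h * (T * (T * e)) = e * (h * T ^ 2) := by ring
      _ ≤ b * (T ^ 3 * h ^ 3) := mul_le_mul he hP1 (by positivity) hb0
      _ ≤ δ / 8 := hb1
  linarith

end Constants

section Main

variable {D : ℕ} {𝒳 : Set (Fin D → ℝ)} {M : Problem 𝒳} [IsProbabilityMeasure M.dist]
  {A : Params 𝒳} {hstar : Set 𝒳 → 𝒳 → ℝ}
  {Ω : Type*} {mΩ : MeasurableSpace Ω} {P : Measure Ω} [IsProbabilityMeasure P]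
  {Z : ℕ → Ω → Sample 𝒳} {cut : ℕ → Ω → Fin D × ℝ} {n m : ℕ} {σ : ℝ} {d₀ : Fin D} {a₀ : ℝ}

/-- A union bound over five failures: colliding sample points; deviations of hypothesis pairs on
grid regions; too few visits, counted from the start or from round `τ`; deviations of piecewise
predictors on the whole space; and deviations of the witness split, which is fixed in advance and
needs no grid. -/
theorem measure_not_typical_le (hM : M.Bounded) (hm : M.MeasurableLoss) (hne : M.H.Nonempty)
    (hbest : ∀ S, MeasurableSet S → M.IsBestOn S (hstar S)) {ρ : ℝ}
    (hγ : A.γ = fun S => M.mass S * ρ / 2)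
    (hZ : ∀ t, Measurable (Z t)) (hind : iIndepFun Z P)
    (hlaw : ∀ t, P.map (Z t) = M.dist.prod volume)
    (hcut : ∀ t, Measurable[past Z t] (cut t)) {G : Fin D → Finset ℝ}
    (hmass : ∀ d a, M.marginal.real {x : 𝒳 | x.1 d ∈ cell (G d) a} ≤ 1 / m)
    (hT : 1 ≤ A.T) (hσ2 : 2 ≤ σ) (hη : 7 * (n / m : ℝ) * A.T ^ 2 ≤ σ) :
    P {ω | ¬ Typical M A (fun t => Z t ω) (fun t => cut t ω) hstar n σ (n / m) d₀ a₀} ≤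
      D * (A.T * (A.T * ENNReal.ofReal (1 / m))) +
      ((gridRegions (𝒳 := 𝒳) G n).card * (M.H.card * (M.H.card *
        (A.T * (A.T * ENNReal.ofReal (Real.exp (-σ)))))) +
      ((gridRegions (𝒳 := 𝒳) G n).card * (2 * ((A.T + 1) * ENNReal.ofReal (Real.exp (-σ)))) +
      ((gridRegions (𝒳 := 𝒳) G n).card * (M.H.card * (M.H.card *
        (A.T * (A.T * ENNReal.ofReal (Real.exp (-σ)))))) +
      M.H.card * (A.T * (A.T * ENNReal.ofReal (Real.exp (-σ))))))) := by
  have hσ0 : 0 ≤ σ := by linarith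
  set r : ℕ → Ω → 𝒳 → ℝ := fun t ω x =>
    (run M A (fun s => Z s ω) (fun s => cut s ω) t).reqProb M x with hr
  have hrm : ∀ t, Measurable[(past Z t).prod inferInstance] fun q : Ω × 𝒳 => r t q.1 q.2 :=
    measurable_run_reqProb hm hne hγ hcut
  have hr1 : ∀ t ω x, r t ω x ≤ 1 := fun t ω x => M.reqProb_le_one hM (run_hyp_subset t _) x
  set bad : (𝒳 × ℤˣ → ℝ) → Set 𝒳 → Set Ω := fun φ S =>
    {ω | ∃ t ≤ A.T, √(2 * σ * (visits (fun s => Z s ω) t S).card) <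
      deviation M (fun s => Z s ω) (fun s => r (s - 1) ω (Z s ω).1.1) φ t S} with hbad
  set few : Set 𝒳 → ℕ → ℕ → Set Ω := fun S a b =>
    {ω | ((visits (fun s => Z s ω) b S).card : ℝ) - (visits (fun s => Z s ω) a S).card ≤
      63 / 100 * M.mass S * (b - a) - σ} with hfew
  set wit := combine (leftPart Set.univ d₀ a₀) (rightPart Set.univ d₀ a₀)
    (hstar (leftPart Set.univ d₀ a₀)) (hstar (rightPart Set.univ d₀ a₀)) with hwit
  set R := gridRegions (𝒳 := 𝒳) G n with hR
  have hL : MeasurableSet (leftPart (Set.univ : Set 𝒳) d₀ a₀) :=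
    measurableSet_leftPart MeasurableSet.univ d₀ a₀
  have hRt : MeasurableSet (rightPart (Set.univ : Set 𝒳) d₀ a₀) :=
    measurableSet_rightPart MeasurableSet.univ d₀ a₀
  have hLR := disjoint_leftPart_rightPart (Set.univ : Set 𝒳) d₀ a₀
  have hU := leftPart_union_rightPart (Set.univ : Set 𝒳) d₀ a₀
  have hh := (hbest _ MeasurableSet.univ).1
  have hsub : {ω | ¬ Typical M A (fun t => Z t ω) (fun t => cut t ω) hstar n σ (n / m) d₀ a₀} ⊆
      {ω | ¬ Separates G (fun s => (Z s ω).1.1) A.T} ∪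
      ((⋃ S ∈ R, ⋃ f ∈ M.H, ⋃ g ∈ M.H, bad (M.lossDiff f g) S) ∪
      ((⋃ S ∈ R, (⋃ b ∈ Finset.range (A.T + 1), few S 0 b) ∪
        ⋃ b ∈ Finset.Icc A.τ A.T, few S A.τ b) ∪
      ((⋃ S ∈ R, ⋃ f ∈ M.H, ⋃ g ∈ M.H,
        bad (M.lossDiff (hstar Set.univ) (combine S Sᶜ f g)) Set.univ) ∪
      ⋃ g ∈ M.H, bad (M.lossDiff wit g) Set.univ))) := by
    intro ω hω
    by_contra hno
    simp only [Set.mem_union, Set.mem_iUnion, not_or, not_exists] at hno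
    obtain ⟨h1, h2, h3, h4, h5⟩ := hno
    refine hω (Typical.of_grid hM hm hbest hmass (not_not.1 h1) hT hσ2 hη
      (fun S hS f hf g hg t ht => ?_) (fun S hS a b ha hab hb => ?_)
      (fun S hS f hf g hg t ht => ?_) (fun g hg t ht => ?_))
    · exact not_lt.1 fun hlt => h2 S hS f hf g hg ⟨t, ht, hlt⟩
    · refine (not_le.1 fun hle => ?_).le
      rcases ha with rfl | rfl
      · exact (h3 S hS).1 b (Finset.mem_range.2 (by omega)) hle
      · exact (h3 S hS).2 b (Finset.mem_Icc.2 ⟨hab, hb⟩) hle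
    · exact not_lt.1 fun hlt => h4 S hS f hf g hg ⟨t, ht, hlt⟩
    · exact not_lt.1 fun hlt => h5 g hg ⟨t, ht, hlt⟩
  have hbad_le : ∀ {φ : 𝒳 × ℤˣ → ℝ}, Measurable φ → (∀ v, |φ v| ≤ 1) → ∀ {S : Set 𝒳},
      MeasurableSet S → P (bad φ S) ≤ A.T * (A.T * ENNReal.ofReal (Real.exp (-σ))) :=
    fun hφ hφ1 _ hS => measure_deviation_le hZ hind hlaw hrm hr1 hφ hφ1 hS hσ0 A.T
  refine (measure_mono hsub).trans ((measure_union_le _ _).trans (add_le_add ?_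
    ((measure_union_le _ _).trans (add_le_add ?_ ((measure_union_le _ _).trans (add_le_add ?_
    ((measure_union_le _ _).trans (add_le_add ?_ ?_))))))))
  · exact measure_not_separates_le hZ hind hlaw hmass A.T
  · refine measure_biUnion_le_card_mul _ _ _ fun S hS => measure_biUnion_le_card_mul _ _ _
      fun f hf => measure_biUnion_le_card_mul _ _ _ fun g hg => ?_
    exact hbad_le ((hm f hf).sub (hm g hg)) (abs_lossDiff_le_one hM hf hg)
      (measurableSet_of_mem_gridRegions hS)
  · refine measure_biUnion_le_card_mul _ _ _ fun S hS => ?_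
    have hmeas := measurableSet_of_mem_gridRegions hS
    rw [two_mul]
    refine (measure_union_le _ _).trans (add_le_add ?_ ?_)
    · refine (measure_biUnion_le_card_mul _ _ _ fun b _ =>
        measure_visits_le hZ hind hlaw hmeas σ (Nat.zero_le b)).trans (le_of_eq ?_)
      rw [Finset.card_range]
      push_cast
      rfl
    · refine (measure_biUnion_le_card_mul _ _ _ fun b hb =>
        measure_visits_le hZ hind hlaw hmeas σ (Finset.mem_Icc.1 hb).1).trans
          (mul_le_mul_left ?_ _)
      rw [Nat.card_Icc]
      exact_mod_cast Nat.sub_le _ _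
  · refine measure_biUnion_le_card_mul _ _ _ fun S hS => measure_biUnion_le_card_mul _ _ _
      fun f hf => measure_biUnion_le_card_mul _ _ _ fun g hg => ?_
    have hmeas := measurableSet_of_mem_gridRegions hS
    exact hbad_le ((hm _ hh).sub (measurable_loss_combine hm hmeas hmeas.compl
      disjoint_compl_right hf hg)) (abs_lossDiff_combine_le_one hM disjoint_compl_right
      (Set.union_compl_self S) hf hg hh) MeasurableSet.univ
  · refine measure_biUnion_le_card_mul _ _ _ fun g hg => ?_
    have hf' := (hbest _ hL).1
    have hg' := (hbest _ hRt).1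
    exact hbad_le (φ := M.lossDiff wit g)
      ((measurable_loss_combine hm hL hRt hLR hf' hg').sub (hm g hg))
      (fun v => (lossDiff_comm wit g v).trans_le
        (abs_lossDiff_combine_le_one hM hLR hU hf' hg' hg v)) MeasurableSet.univ

theorem exists_fine_grid (M : Problem 𝒳) [IsProbabilityMeasure M.dist] {m : ℕ} (hm : 0 < m) :
    ∃ G : Fin D → Finset ℝ, (∀ d, (G d).card ≤ m) ∧
      ∀ d a, M.marginal.real {x : 𝒳 | x.1 d ∈ cell (G d) a} ≤ 1 / m := by
  have := marginal_isProbabilityMeasure M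
  have hp : ∀ d, IsProbabilityMeasure (M.marginal.map fun x : 𝒳 => x.1 d) := fun d =>
    Measure.isProbabilityMeasure_map (measurable_coord d).aemeasurable
  choose G hG using fun d => exists_grid (M.marginal.map fun x : 𝒳 => x.1 d) m hm
  refine ⟨G, fun d => (hG d).1, fun d a => ?_⟩
  have h := (hG d).2 a
  rw [measureReal_def, Measure.map_apply (measurable_coord d) (measurableSet_cell _ _)] at h
  exact h

/-- For a sufficiently small approximation error `η`, a run is typical with probability at least
`1 - 3 δ / 2`. -/
theorem exists_measure_not_typical_le (hM : M.Bounded) (hm : M.MeasurableLoss)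
    (hne : M.H.Nonempty) (hbest : ∀ S, MeasurableSet S → M.IsBestOn S (hstar S)) {ρ : ℝ}
    (hγ : A.γ = fun S => M.mass S * ρ / 2)
    (hZ : ∀ t, Measurable (Z t)) (hind : iIndepFun Z P)
    (hlaw : ∀ t, P.map (Z t) = M.dist.prod volume)
    (hcut : ∀ t, Measurable[past Z t] (cut t)) (hT : 1 ≤ A.T) (hκ : 1 ≤ A.κ)
    (hδ : 0 < A.δ) (hδ' : A.δ ≤ 2 / 3) (hσ : σ = slack M A) (d₀ : Fin D) (a₀ : ℝ) :
    2 ≤ σ ∧ ∃ η : ℝ, η * A.T ≤ σ ∧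
      P {ω | ¬ Typical M A (fun t => Z t ω) (fun t => cut t ω) hstar (A.κ - 1) σ η d₀ a₀} ≤
        ENNReal.ofReal (3 * A.δ / 2) := by
  have hD : 1 ≤ D := by have := d₀.2; omega
  have hh : 1 ≤ M.H.card := Finset.card_pos.2 hne
  have hT' : (1 : ℝ) ≤ A.T := by exact_mod_cast hT
  have hκ' : (1 : ℝ) ≤ A.κ := by exact_mod_cast hκ
  have hD' : (1 : ℝ) ≤ D := by exact_mod_cast hD
  set B := 8 * (A.T : ℝ) ^ 3 * (M.H.card : ℝ) ^ 3 * A.κ * D / A.δ with hB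
  have hB12 : 12 ≤ B := twelve_le hT hh hκ hD hδ hδ'
  have hlogB := seven_thirds_le_log hB12
  have hσB : σ = A.κ * D * Real.log B := hσ
  have hσκ : 7 / 3 * A.κ ≤ σ := by
    have h1 : (A.κ : ℝ) * 1 ≤ A.κ * D := mul_le_mul_of_nonneg_left hD' (by linarith)
    have h2 : A.κ * D * (7 / 3) ≤ A.κ * D * Real.log B :=
      mul_le_mul_of_nonneg_left hlogB (by positivity)
    linarith
  have hσ2 : 2 ≤ σ := by linarith
  -- This grid size makes the collision probability at most `D T² / m ≤ δ/2`.
  set m := ⌈2 * D * (A.T : ℝ) ^ 2 / A.δ⌉₊ with hmdef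
  have hx0 : 0 < 2 * D * (A.T : ℝ) ^ 2 / A.δ := by positivity
  have hm1 : 2 * D * (A.T : ℝ) ^ 2 / A.δ ≤ m := Nat.le_ceil _
  have hm2 : (m : ℝ) ≤ 2 * D * (A.T : ℝ) ^ 2 / A.δ + 1 := (Nat.ceil_lt_add_one hx0.le).le
  have hm0 : 0 < m := Nat.ceil_pos.2 hx0
  have hm0' : (0 : ℝ) < m := by exact_mod_cast hm0
  obtain ⟨G, hGc, hmass⟩ := exists_fine_grid M hm0
  -- Since `δ ≤ 2/3`, `m ≥ 3T²`, so the left side is at most `7κ/3`, and `σ ≥ 7κ/3` by the bound on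
  -- `log B`.
  have hη : 7 * (((A.κ - 1 : ℕ) : ℝ) / m) * A.T ^ 2 ≤ σ := by
    have h1 : ((A.κ - 1 : ℕ) : ℝ) ≤ A.κ := by exact_mod_cast Nat.sub_le _ _
    rw [div_le_iff₀ hδ] at hm1
    have h2 : (A.T : ℝ) ^ 2 ≤ m * (1 / 3) := by
      have h3 : m * A.δ ≤ m * (2 / 3) := mul_le_mul_of_nonneg_left hδ' hm0'.le
      have h4 : (1 : ℝ) * A.T ^ 2 ≤ D * A.T ^ 2 := mul_le_mul_of_nonneg_right hD' (by positivity)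
      linarith
    calc 7 * (((A.κ - 1 : ℕ) : ℝ) / m) * A.T ^ 2 ≤ 7 * ((A.κ : ℝ) / m) * (m * (1 / 3)) := by
          gcongr
      _ = 7 / 3 * A.κ := by field_simp
      _ ≤ σ := hσκ
  refine ⟨hσ2, ((A.κ - 1 : ℕ) : ℝ) / m, ?_, ?_⟩
  · have h1 : (0 : ℝ) ≤ ((A.κ - 1 : ℕ) : ℝ) / m := by positivity
    have h2 : (A.T : ℝ) ≤ A.T ^ 2 := le_self_pow₀ hT' (by norm_num)
    have h3 := mul_le_mul_of_nonneg_left h2 h1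
    have h4 : 0 ≤ ((A.κ - 1 : ℕ) : ℝ) / m * (A.T : ℝ) ^ 2 := by positivity
    linarith
  · refine (measure_not_typical_le hM hm hne hbest hγ hZ hind hlaw hcut hmass hT hσ2 hη).trans ?_
    have hcardR : ((gridRegions (𝒳 := 𝒳) G (A.κ - 1)).card : ℝ) ≤ B ^ (D * (A.κ - 1)) :=
      le_trans (by exact_mod_cast card_gridRegions G hGc (A.κ - 1))
        (gridRegions_count_le hT hh hκ hD hδ hδ' hB hm2)
    have hRe := mul_exp_neg_le hκ hD (by linarith) hσB hcardR
    -- The witness split counts as a single region.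
    have he := mul_exp_neg_le (R := 1) hκ hD (by linarith) hσB (one_le_pow₀ (by linarith))
    rw [one_mul] at he
    have hfin := failure_probability_le hT hh hκ hD hδ (Real.exp_pos (-σ)).le hB hRe he hm1 hm0
    refine le_trans (le_of_eq ?_) (ENNReal.ofReal_le_ofReal hfin)
    have hcast : ∀ k : ℕ, (k : ℝ≥0∞) = ENNReal.ofReal k := fun k =>
      (ENNReal.ofReal_natCast k).symm
    have e0 := (Real.exp_pos (-σ)).le
    rw [ENNReal.ofReal_add (by positivity) (by positivity),
      ENNReal.ofReal_add (by positivity) (by positivity),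
      ENNReal.ofReal_add (by positivity) (by positivity),
      ENNReal.ofReal_add (by positivity) (by positivity)]
    have hT1 : ((A.T : ℝ≥0∞) + 1) = ENNReal.ofReal ((A.T : ℝ) + 1) := by
      rw [ENNReal.ofReal_add (by positivity) (by positivity), ENNReal.ofReal_natCast,
        ENNReal.ofReal_one]
    have h2 : (2 : ℝ≥0∞) = ENNReal.ofReal 2 := (ENNReal.ofReal_ofNat 2).symm
    rw [hT1, h2]
    simp only [hcast]
    rw [ENNReal.ofReal_mul (by positivity), ENNReal.ofReal_mul (by positivity),
      ENNReal.ofReal_mul (by positivity)]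
    simp only [ENNReal.ofReal_mul, Nat.cast_nonneg, zero_le_two,
      show (0 : ℝ) ≤ (A.T : ℝ) + 1 by positivity]

end Main

/-- The Lipschitz condition enters through continuity only, and its constant plays no role. -/
theorem measurableLoss_of_lipschitz {D : ℕ} {𝒳 : Set (Fin D → ℝ)} {M : Problem 𝒳} {Zset : Set ℝ}
    {μ : ℝ≥0} (hlip : ∀ y, LipschitzOnWith μ (fun a => M.loss a y) Zset)
    (hHmeas : ∀ h ∈ M.H, Measurable h) (hHval : ∀ h ∈ M.H, ∀ x, h x ∈ Zset) :
    M.MeasurableLoss := by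
  intro h hh
  refine measurable_of_cover (fun y : ℤˣ => {v : 𝒳 × ℤˣ | v.2 = y})
    (fun y v => M.loss (h v.1) y) (fun y => measurable_snd (measurableSet_singleton y))
    (fun y => ?_) (fun v => ⟨v.2, rfl⟩) (fun y v hv => by rw [show v.2 = y from hv])
  have h1 : Measurable fun a : Zset => M.loss a y :=
    (continuousOn_iff_continuous_domRestrict.1 (hlip y).continuousOn).measurable
  exact h1.comp (((hHmeas h hh).subtype_mk (h := hHval h hh)).comp measurable_fst)

end ARBAL

/-! ### Assembly of the two bounds -/

theorem mainTheorem3 {D : ℕ} {𝒳 : Set (Fin D → ℝ)} (M : ARBAL.Problem 𝒳)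
    [IsProbabilityMeasure M.dist]
    -- the loss and the hypotheses, with predictions in `Zset`
    (Zset : Set ℝ) (μ : ℝ≥0)
    (hloss : ∀ a ∈ Zset, ∀ y, M.loss a y ∈ Set.Icc (0 : ℝ) 1)
    (hlip : ∀ y, LipschitzOnWith μ (fun a => M.loss a y) Zset)
    (hHne : M.H.Nonempty)
    (hHmeas : ∀ h ∈ M.H, Measurable h)
    (hHval : ∀ h ∈ M.H, ∀ x, h x ∈ Zset)
    -- a best-in-class hypothesis for each region
    (hstar : Set 𝒳 → 𝒳 → ℝ)
    (hbest : ∀ S, MeasurableSet S → M.IsBestOn S (hstar S))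
    -- the parameters, with adaptive threshold
    (T τ κ : ℕ) (δ ρ c : ℝ)
    (hτ : 1 ≤ τ) (hτT : τ ≤ T) (hκ : 1 ≤ κ) (hδ : 0 < δ) (hρ : 0 < ρ)
    (hc : 0 < c) (hc' : c < 1 / 2)
    (A : ARBAL.Params 𝒳)
    (hA : A = { T := T, τ := τ, κ := κ, δ := δ, γ := fun S => M.mass S * ρ / 2 })
    (σ : ℝ) (hσ : σ = ARBAL.slack M A)
    (hlog : Real.logb (1 / c) (τ / (2 * σ * (4 / ρ + 1) ^ 2)) ≤ κ - 1)
    -- i.i.d. examples and independent uniform coins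
    {Ω : Type*} [MeasurableSpace Ω] (P : Measure Ω) [IsProbabilityMeasure P]
    (Z : ℕ → Ω → ARBAL.Sample 𝒳)
    (hZmeas : ∀ t, Measurable (Z t))
    (hZindep : iIndepFun Z P)
    (hZlaw : ∀ t, P.map (Z t) = M.dist.prod volume)
    -- the splits chosen by the algorithm: measurable functions of the past, of maximal gap
    (cut : ℕ → Ω → Fin D × ℝ)
    (hcutmeas : ∀ t, Measurable[MeasurableSpace.comap
      (fun ω (s : Finset.Icc 1 t) => Z s ω) inferInstance] (cut t))
    (hcutmax : ∀ ω, ARBAL.MaximizesGap M A (fun t => Z t ω) (fun t => cut t ω))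
    (RU : ℝ)
    (hRU : RU = M.risk (hstar Set.univ) -
      ρ * c / (2 * (1 - c)) * (1 - 2 * σ * (4 / ρ + 1) ^ 2 / τ)) :
    P {ω | ¬ (ARBAL.IntermediateSplittable M A hstar ρ c (fun t => Z t ω) (fun t => cut t ω) →
      ∀ st, st = ARBAL.run M A (fun t => Z t ω) (fun t => cut t ω) T →
        -- the generalization bound, for all empirical risk minimizers on the final regions
        (∀ hhat : ℕ → 𝒳 → ℝ,
          (∀ k < st.K, ARBAL.IsERM M (fun t => Z t ω) st.p T (st.hyp k) (st.region k) (hhat k)) →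
          M.risk (st.predictor hhat) ≤
            RU + 2 * √(8 * st.K * σ / T) + 16 * st.K * σ / T) ∧
        -- the label bound
        ENNReal.ofReal (ARBAL.expectedLabels M A (fun t => Z t ω) (fun t => cut t ω)) ≤
          min (2 * M.disagreementCoeff M.dist (hstar Set.univ) *
              ENNReal.ofReal (⨆ h : M.H, M.rho M.dist h.1 (hstar Set.univ))) 1 * (τ : ℝ≥0∞) +
            4 * (⨆ k ∈ Finset.range st.K,
                M.disagreementCoeff (M.distOn (st.region k)) (hstar (st.region k))) *
              ENNReal.ofReal (((T : ℝ) - τ) * (RU + 8 * √(st.K * σ / ((T : ℝ) - τ)))) +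
            ENNReal.ofReal (√32 * st.K * σ))}
      ≤ ENNReal.ofReal (3 * δ / 2) := by
  subst hA
  have hM : M.Bounded := fun h hh x y => hloss _ (hHval h hh x) y
  have hm : M.MeasurableLoss := ARBAL.measurableLoss_of_lipschitz hlip hHmeas hHval
  -- For `δ > 2/3` the allowed failure probability exceeds one; below, `δ ≤ 2/3` provides `σ ≥ 2`.
  rcases lt_or_ge (2 / 3) δ with hδ1 | hδ1
  · refine prob_le_one.trans ?_
    rw [← ENNReal.ofReal_one]
    exact ENNReal.ofReal_le_ofReal (by linarith)
  -- Splittability of the whole space does not depend on the run. If it fails, the premise fails for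
  -- every run; if it holds, it supplies a deterministic witness split, the only part of the premise
  -- that the bounds require.
  by_cases hsplit : M.Splittable hstar ρ c Set.univ
  swap
  · refine le_trans (le_of_eq ?_) zero_le
    convert measure_empty (μ := P)
    refine Set.eq_empty_of_forall_notMem fun ω hω => hω fun h => absurd h.1 hsplit
  obtain ⟨d₀, a₀, hw, -⟩ := hsplit
  obtain ⟨hσ2, η, hη, hle⟩ := ARBAL.exists_measure_not_typical_le hM hm hHne hbest rfl hZmeas
    hZindep hZlaw hcutmeas (hτ.trans hτT) hκ hδ hδ1 hσ d₀ a₀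
  refine le_trans (measure_mono ?_) hle
  intro ω hω hty
  refine hω fun _ st hst => ?_
  subst hst
  have hn : κ ≤ κ - 1 + 1 := by omega
  have hbl := hty.bestLoss_final_le hM hm hHne hbest hn hσ (by linarith) hτ hτT rfl (hcutmax ω) hρ
    hc hc' hlog hη hw
  rw [← hRU] at hbl
  refine ⟨fun hhat hhat_erm => ?_,
    hty.expectedLabels_le hM hm hbest hn hκ hσ hσ2 hτ hτT hρ hw hbl⟩
  refine (hty.risk_predictor_le hM hm hbest hn hκ hσ (by linarith) (hτ.trans hτT) hhat_erm).trans ?_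
  exact add_le_add (add_le_add hbl le_rfl) le_rfl
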